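/- Let $\langle z,w\rangle=z_1\overline{w_{n+1}}+\sum_{i=2}^{n}z_i\overline{w_i}+z_{n+1}\overline{w_1}$ on $\mathbb{C}^{n+1}$, let $U(1,n)$ be its unitary group and $PU(1,n)\subset PGL(n+1,\mathbb{C})$ its projectivization, let $\mathbb{H}^n_{\mathbb{C}}\subset\mathbb{P}^n_{\mathbb{C}}$ be the set of negative points and $\partial\mathbb{H}^n_{\mathbb{C}}$ the set of null points. For $p\in\partial\mathbb{H}^n_{\mathbb{C}}$ let $p^\bot(p)$ be the set of complex projective lines $\ell$ with $p\in\ell\subset p^\bot$, with its topology as the projective space $\mathbb{P}(p^\bot/p)$. For a subgroup $\Gamma\subset PU(1,n)$ let $\Lambda_{CG}(\Gamma)\subset\partial\mathbb{H}^n_{\mathbb{C}}$ be the set of accumulation points of orbits of points of $\mathbb{H}^n_{\mathbb{C}}$; $\Gamma$ is non-elementary if $\Lambda_{CG}(\Gamma)$ is infinite. A sequence $(\gamma_m)$ of distinct elements of $PU(1,n)$ tends simply to infinity if $\gamma_m=[k_m\,\mathrm{diag}(e^{t_m},1,\dots,1,e^{-t_m})\,k_m']$ with $k_m,k_m'\in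 U(n+1)\cap U(1,n)$ convergent, $t_m\ge 0$ and $t_m\to\infty$. For such a sequence let $\mathcal{D}_{(\gamma_m)}(w)$ be the set of all accumulation points of sequences $(\gamma_m(w_m))$ with $w_m\to w$. A Cartan map for $(y,x,\Gamma)$ is a bijection $\mu:y^\bot(y)\to x^\bot(x)$ for which there is a sequence $(\gamma_m)\subset\Gamma$ tending simply to infinity such that $\gamma_m\to x$ uniformly on compact subsets of $\mathbb{P}^n_{\mathbb{C}}\setminus y^\bot$, $\gamma_m^{-1}\to y$ uniformly on compact subsets of $\mathbb{P}^n_{\mathbb{C}}\setminus x^\bot$, $\mathcal{D}_{(\gamma_m)}(w)=\mu(\ell)$ for all $\ell\in y^\bot(y)$ and $w\in\ell\setminus\{y\}$, and $\mathcal{D}_{(\gamma_m^{-1})}(w)=\mu^{-1}(\ell)$ for all $\ell\in x^\bot(x)$ and $w\in\ell\setminus\{x\}$. Let $\Gamma(y,x)$ be the set of these maps, with the topology of pointwise (equivalently, uniform) convergence, and put $$(\mu\star\nu)(\ell)=\mu\bigl(\mathrm{Span}(\nu(\ell)\cap y^\bot,\;y)\bigr).$$ **Theorem.** Let $\Gamma\subset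 PU(1,n)$ be a non-elementary discrete group and let $x,y\in\Lambda_{CG}(\Gamma)$ be distinct. Then $\Gamma(y,x)$ is a compact Lie group under the operation $\star$. More precisely, $\star$ is a group operation on $\Gamma(y,x)$; the topological space $\Gamma(y,x)$ is compact and Hausdorff and carries a smooth structure for which it is a (finite-dimensional, real) Lie group; and for some unitary identification $T:\mathbb{C}^{n-1}\to x^\bot\cap y^\bot$ (where $\langle\,,\rangle$ is positive definite) there is an isomorphism of topological groups $\varphi$ from $\Gamma(y,x)$ onto a closed subgroup of $PU(n-1)$, such that $\varphi(\mu)=[g]$ implies $\mu(\mathrm{Span}(y,[Tv]))=\mathrm{Span}(x,[T(gv)])$ for all $v\neq 0$. -/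

import Mathlib

open Filter Topology Set
open scoped Manifold ContDiff LinearAlgebra.Projectivization Matrix

namespace ComplexHyperbolic

noncomputable section

/-- Complex projective space `ℙⁿ`, the space of complex lines of `ℂⁿ⁺¹`. -/
abbrev CP (n : ℕ) : Type := ℙ ℂ (Fin (n + 1) → ℂ)

/-- The quotient topology of `ℙⁿ = (ℂⁿ⁺¹ ∖ {0}) / ℂ*`. -/
instance instTopologicalSpaceCP (n : ℕ) : TopologicalSpace (CP n) :=
  inferInstanceAs (TopologicalSpace (Quotient (projectivizationSetoid ℂ (Fin (n + 1) → ℂ))))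

/-- The group of projective transformations of `ℙⁿ`: `GL(n+1, ℂ)` modulo its centre, the scalars.
It acts on `CP n` through Mathlib's action. -/
abbrev PGL (n : ℕ) : Type := Matrix.ProjGenLinGroup (Fin (n + 1)) ℂ

/-- The quotient topology of `GL(n+1, ℂ) / ℂ*`. -/
instance instTopologicalSpacePGL (n : ℕ) : TopologicalSpace (PGL n) :=
  inferInstanceAs (TopologicalSpace (GL (Fin (n + 1)) ℂ ⧸ Subgroup.center (GL (Fin (n + 1)) ℂ)))

/-- The Hermitian matrix with entries `1` at the two corners of the antidiagonal and an identity
block of size `n - 1` in the middle, that is, the matrix of the permutation of the coordinates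
which exchanges the first with the last one. -/
def hermMatrix (n : ℕ) : Matrix (Fin (n + 1)) (Fin (n + 1)) ℂ :=
  Matrix.of fun i j => if Equiv.swap 0 (Fin.last n) i = j then 1 else 0

/-- The Hermitian form `⟨z, w⟩`, linear in `z` and antilinear in `w`; for `n ≥ 1` it has one
negative and `n` positive directions. -/
def herm {n : ℕ} (z w : Fin (n + 1) → ℂ) : ℂ :=
  star w ⬝ᵥ (hermMatrix n *ᵥ z)

/-- `U(1, n)`, the matrices `g` with `g H g* = H`. -/
def U1 (n : ℕ) : Subgroup (GL (Fin (n + 1)) ℂ) where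
  carrier := {g | (g : Matrix _ _ ℂ) * hermMatrix n * (g : Matrix _ _ ℂ)ᴴ = hermMatrix n}
  one_mem' := by simp
  mul_mem' := by
    intro a b ha hb
    simp only [mem_ofPred_eq] at ha hb ⊢
    calc (a * b).1 * hermMatrix n * (a * b).1ᴴ
        = a.1 * (b.1 * hermMatrix n * b.1ᴴ) * a.1ᴴ := by
          simp [Matrix.mul_assoc]
      _ = hermMatrix n := by rw [hb, ha]
  inv_mem' := by
    intro a ha
    simp only [mem_ofPred_eq] at ha ⊢
    have h1 : (a⁻¹).1 * a.1 = 1 := by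
      rw [← Units.val_mul, inv_mul_cancel, Units.val_one]
    have h2 : a.1ᴴ * (a⁻¹).1ᴴ = 1 := by
      rw [← Matrix.conjTranspose_mul, h1, Matrix.conjTranspose_one]
    calc (a⁻¹).1 * hermMatrix n * (a⁻¹).1ᴴ
        = (a⁻¹).1 * (a.1 * hermMatrix n * a.1ᴴ) * (a⁻¹).1ᴴ := by rw [ha]
      _ = ((a⁻¹).1 * a.1) * hermMatrix n * (a.1ᴴ * (a⁻¹).1ᴴ) := by
          simp only [Matrix.mul_assoc]
      _ = hermMatrix n := by rw [h1, h2, Matrix.one_mul, Matrix.mul_one]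

/-- `PU(1, n)`, the image of `U(1, n)` in the group of projective transformations. -/
def PU1 (n : ℕ) : Subgroup (PGL n) := (U1 n).map Matrix.ProjGenLinGroup.mk

/-- Complex hyperbolic space, the open ball of negative points. -/
def ball (n : ℕ) : Set (CP n) := {p | (herm p.rep p.rep).re < 0}

/-- The boundary of complex hyperbolic space, the set of null points. -/
def boundary (n : ℕ) : Set (CP n) := {p | herm p.rep p.rep = 0}

/-- The Chen–Greenberg limit set: the points of the boundary at which an orbit of a point of
complex hyperbolic space accumulates. -/
def limitSet {n : ℕ} (Γ : Subgroup (PGL n)) : Set (CP n) :=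
  {p | p ∈ boundary n ∧ ∃ z ∈ ball n, AccPt p (𝓟 (MulAction.orbit Γ z))}

/-- The (vector) hyperplane `p^⊥` of the vectors orthogonal to `p`. -/
def perp {n : ℕ} (p : CP n) : Submodule ℂ (Fin (n + 1) → ℂ) where
  carrier := {w | herm w p.rep = 0}
  zero_mem' := by simp [herm]
  add_mem' := by
    intro a b ha hb
    simp only [mem_ofPred_eq, herm, Matrix.mulVec_add, dotProduct_add] at ha hb ⊢
    rw [ha, hb, add_zero]
  smul_mem' := by
    intro c a ha
    simp only [mem_ofPred_eq, herm, Matrix.mulVec_smul, dotProduct_smul] at ha ⊢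
    rw [ha, smul_zero]

/-- `p^⊥(p)`, the set of projective lines `ℓ` with `p ∈ ℓ ⊆ p^⊥`; a projective line is given by
the corresponding vector subspace of dimension two. -/
def Pencil {n : ℕ} (p : CP n) : Type :=
  {L : Submodule ℂ (Fin (n + 1) → ℂ) //
    Module.finrank ℂ L = 2 ∧ p.submodule ≤ L ∧ L ≤ perp p}

/-- The points of a line of `p^⊥(p)`, as a subset of `ℙⁿ`. -/
def Pencil.points {n : ℕ} {p : CP n} (L : Pencil p) : Set (CP n) :=
  {z | z.submodule ≤ L.1}

/-- A line of `p^⊥(p)` and a point `q` of it other than `p`; the vector `q` is a representative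
of that point. -/
def MarkedPencil {n : ℕ} (p : CP n) : Type :=
  {q : (Fin (n + 1) → ℂ) × Pencil p // q.1 ∈ q.2.1 ∧ q.1 ∉ p.submodule}

/-- The quotient topology on `p^⊥(p) = ℙ(p^⊥ / p)`: a set of lines is open when the vectors of
`p^⊥ ∖ p` which span with `p` a line of the set form an open subset of `p^⊥ ∖ p`. For `p` in the
boundary this is the topology of the metric
`d_p(ℓ₁, ℓ₂) = arccos √(|⟨q₁, q₂⟩|² / (⟨q₁, q₁⟩ ⟨q₂, q₂⟩))`, `qᵢ ∈ ℓᵢ ∖ p`. -/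
instance instTopologicalSpacePencil {n : ℕ} (p : CP n) : TopologicalSpace (Pencil p) :=
  TopologicalSpace.coinduced (fun q : MarkedPencil p => q.1.2)
    (TopologicalSpace.induced (fun q : MarkedPencil p => q.1.1) inferInstance)

/-- The maximal compact subgroup `U(n+1) ∩ U(1, n)` of `U(1, n)`. -/
def K (n : ℕ) : Set (GL (Fin (n + 1)) ℂ) :=
  {g | g ∈ U1 n ∧ (g : Matrix _ _ ℂ) ∈ Matrix.unitaryGroup (Fin (n + 1)) ℂ}

/-- The matrix `diag(e^t, 1, …, 1, e^{-t})`. -/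
def cartanDiag (n : ℕ) (t : ℝ) : Matrix (Fin (n + 1)) (Fin (n + 1)) ℂ :=
  Matrix.diagonal fun i =>
    if i = 0 then (Real.exp t : ℂ) else if i = Fin.last n then (Real.exp (-t) : ℂ) else 1

/-- A sequence of distinct elements tends simply to infinity when it has Cartan decompositions
`γ_m = [k_m diag(e^{t_m}, 1, …, 1, e^{-t_m}) k'_m]`, `t_m ≥ 0`, whose compact factors converge
and for which `t_m → ∞`. -/
def TendsSimplyToInfinity {n : ℕ} (γ : ℕ → PGL n) : Prop :=
  Function.Injective γ ∧
  ∃ (g k k' : ℕ → GL (Fin (n + 1)) ℂ) (t : ℕ → ℝ) (κ κ' : GL (Fin (n + 1)) ℂ),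
    (∀ m, γ m = Matrix.ProjGenLinGroup.mk (g m)) ∧
    (∀ m, (g m : Matrix _ _ ℂ)
      = (k m : Matrix _ _ ℂ) * cartanDiag n (t m) * (k' m : Matrix _ _ ℂ)) ∧
    (∀ m, k m ∈ K n ∧ k' m ∈ K n ∧ 0 ≤ t m) ∧
    κ ∈ K n ∧ κ' ∈ K n ∧
    Tendsto k atTop (𝓝 κ) ∧ Tendsto k' atTop (𝓝 κ') ∧ Tendsto t atTop atTop

/-- The transformations `γ_m` converge to the constant `x`, uniformly on the compact subsets
of `U`. -/
def ConvergesUniformlyOnCompacts {n : ℕ} (γ : ℕ → PGL n) (U : Set (CP n)) (x : CP n) : Prop :=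
  ∀ C : Set (CP n), IsCompact C → C ⊆ U → ∀ V ∈ 𝓝 x, ∀ᶠ m in atTop, ∀ z ∈ C, γ m • z ∈ V

/-- `𝒟_{(γ_m)}(w)`, the union over all sequences `u_m → w` of the sets of accumulation points of
the sequences `γ_m(u_m)`. -/
def dynSet {n : ℕ} (γ : ℕ → PGL n) (w : CP n) : Set (CP n) :=
  {z | ∃ u : ℕ → CP n, Tendsto u atTop (𝓝 w) ∧ MapClusterPt z atTop fun m => γ m • u m}

/-- `μ : y^⊥(y) → x^⊥(x)` is a Cartan map for `(y, x, Γ)`. -/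
def IsCartanMap {n : ℕ} (Γ : Subgroup (PGL n)) (y x : CP n) (μ : Pencil y ≃ Pencil x) : Prop :=
  ∃ γ : ℕ → PGL n, (∀ m, γ m ∈ Γ) ∧ TendsSimplyToInfinity γ ∧
    ConvergesUniformlyOnCompacts γ {z | ¬ z.submodule ≤ perp y} x ∧
    ConvergesUniformlyOnCompacts (fun m => (γ m)⁻¹) {z | ¬ z.submodule ≤ perp x} y ∧
    (∀ (ℓ : Pencil y), ∀ w ∈ ℓ.points, w ≠ y → dynSet γ w = (μ ℓ).points) ∧
    (∀ (ℓ : Pencil x), ∀ w ∈ ℓ.points, w ≠ x →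
      dynSet (fun m => (γ m)⁻¹) w = (μ.symm ℓ).points)

/-- `Γ(y, x)`, the set of Cartan maps for `(y, x, Γ)`. -/
def CartanMaps {n : ℕ} (Γ : Subgroup (PGL n)) (y x : CP n) : Type :=
  {μ : Pencil y ≃ Pencil x // IsCartanMap Γ y x μ}

/-- The topology of pointwise convergence on `Γ(y, x)`; since Cartan maps are isometries between
compact spaces, it is also that of uniform convergence. -/
instance instTopologicalSpaceCartanMaps {n : ℕ} (Γ : Subgroup (PGL n)) (y x : CP n) :
    TopologicalSpace (CartanMaps Γ y x) :=
  TopologicalSpace.induced (fun μ (ℓ : Pencil y) => μ.1 ℓ) Pi.topologicalSpace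

/-! ### The operation `⋆` -/

/-- Coordinates of the form. -/
lemma herm_apply {n : ℕ} (z w : Fin (n + 1) → ℂ) :
    herm z w = ∑ i, star (w i) * z (Equiv.swap 0 (Fin.last n) i) := by
  simp [herm, hermMatrix, dotProduct, Matrix.mulVec]

lemma herm_add_left {n : ℕ} (z z' w : Fin (n + 1) → ℂ) :
    herm (z + z') w = herm z w + herm z' w := by
  simp [herm, Matrix.mulVec_add, dotProduct_add]

lemma herm_smul_left {n : ℕ} (c : ℂ) (z w : Fin (n + 1) → ℂ) :
    herm (c • z) w = c * herm z w := by
  simp [herm, Matrix.mulVec_smul, dotProduct_smul]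

lemma star_herm {n : ℕ} (z w : Fin (n + 1) → ℂ) : star (herm z w) = herm w z := by
  rw [herm_apply, herm_apply, star_sum]
  rw [← Equiv.sum_comp (Equiv.swap 0 (Fin.last n))]
  refine Finset.sum_congr rfl fun i _ => ?_
  simp [mul_comm]

/-- A null vector with vanishing first coordinate is a multiple of the last basis vector. -/
lemma eq_zero_of_null {n : ℕ} {z : Fin (n + 1) → ℂ} (h : herm z z = 0) (h0 : z 0 = 0)
    (i : Fin (n + 1)) (hi : i ≠ Fin.last n) : z i = 0 := by
  have key : herm z z = ((∑ i, if i = Fin.last n then 0 else Complex.normSq (z i) : ℝ) : ℂ) := by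
    rw [herm_apply, Complex.ofReal_sum]
    refine Finset.sum_congr rfl fun j _ => ?_
    by_cases hj : j = Fin.last n
    · subst hj
      simp [h0]
    · by_cases hj0 : j = 0
      · subst hj0
        simp [h0]
      · rw [Equiv.swap_apply_of_ne_of_ne hj0 hj, if_neg hj, Complex.normSq_eq_conj_mul_self]
        rfl
  rw [key, Complex.ofReal_eq_zero, Finset.sum_eq_zero_iff_of_nonneg] at h
  · have := h i (Finset.mem_univ i)
    rwa [if_neg hi, Complex.normSq_eq_zero] at this
  · intro j _
    split_ifs
    · exact le_rfl
    · exact Complex.normSq_nonneg _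

lemma herm_of_last {n : ℕ} {z : Fin (n + 1) → ℂ} (hz : ∀ i, i ≠ Fin.last n → z i = 0)
    (w : Fin (n + 1) → ℂ) : herm z w = star (w 0) * z (Fin.last n) := by
  rw [herm_apply, Finset.sum_eq_single 0]
  · simp
  · intro j _ hj
    rw [hz, mul_zero]
    intro h
    apply hj
    have := congrArg (Equiv.swap 0 (Fin.last n)) h
    simpa using this
  · simp

/-- Two orthogonal null points coincide. -/
lemma eq_of_orthogonal {n : ℕ} {p q : CP n} (hp : p ∈ boundary n) (hq : q ∈ boundary n)
    (h : herm q.rep p.rep = 0) : p = q := by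
  have hp' : herm p.rep p.rep = 0 := hp
  have hq' : herm q.rep q.rep = 0 := hq
  have ha := p.rep_nonzero
  have hb := q.rep_nonzero
  have h' : herm p.rep q.rep = 0 := by rw [← star_herm, h, star_zero]
  suffices hs : ∃ c : ℂ, c • q.rep = p.rep by
    rw [← p.mk_rep, ← q.mk_rep, Projectivization.mk_eq_mk_iff']
    exact hs
  generalize p.rep = a at *
  generalize q.rep = b at *
  have hza : herm (b 0 • a + (-a 0) • b) a = 0 := by
    rw [herm_add_left, herm_smul_left, herm_smul_left, hp', h]; ring
  have hzb : herm (b 0 • a + (-a 0) • b) b = 0 := by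
    rw [herm_add_left, herm_smul_left, herm_smul_left, hq', h']; ring
  have hzz : herm (b 0 • a + (-a 0) • b) (b 0 • a + (-a 0) • b) = 0 := by
    rw [herm_add_left, herm_smul_left, herm_smul_left, ← star_herm _ a, ← star_herm _ b, hza, hzb]
    simp
  have hz := eq_zero_of_null hzz (by simp; ring)
  have hz1 := herm_of_last hz a
  have hz2 := herm_of_last hz b
  rw [hza] at hz1
  rw [hzb] at hz2
  by_cases ha0 : a 0 = 0
  · have hal := eq_zero_of_null hp' ha0
    by_cases hb0 : b 0 = 0
    · have hbl := eq_zero_of_null hq' hb0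
      have hb1 : b (Fin.last n) ≠ 0 := by
        intro hb1
        apply hb
        ext i
        by_cases hi : i = Fin.last n
        · rw [hi, hb1]; rfl
        · rw [hbl i hi]; rfl
      refine ⟨a (Fin.last n) / b (Fin.last n), ?_⟩
      ext i
      by_cases hi : i = Fin.last n
      · subst hi
        simp [hb1]
      · simp [hal i hi, hbl i hi]
    · exfalso
      apply ha
      ext i
      have h1 : (b 0 • a + (-a 0) • b) i = 0 := by
        by_cases hi : i = Fin.last n
        · subst hi
          simpa [hb0] using hz2
        · exact hz i hi
      simpa [ha0, hb0] using h1
  · have h0 : ∀ i, (b 0 • a + (-a 0) • b) i = 0 := by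
      intro i
      by_cases hi : i = Fin.last n
      · subst hi
        rcases mul_eq_zero.mp hz1.symm with h2 | h2
        · exact absurd (star_eq_zero.mp h2) ha0
        · exact h2
      · exact hz i hi
    have hb0 : b 0 ≠ 0 := by
      intro hb0
      apply hb
      ext i
      have := h0 i
      simpa [hb0, ha0] using this
    refine ⟨a 0 / b 0, ?_⟩
    ext i
    have h1 := h0 i
    simp only [Pi.add_apply, Pi.smul_apply, smul_eq_mul] at h1 ⊢
    field_simp
    linear_combination -h1

lemma mem_perp {n : ℕ} {p : CP n} {w : Fin (n + 1) → ℂ} : w ∈ perp p ↔ herm w p.rep = 0 :=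
  Iff.rfl

lemma submodule_le_iff {n : ℕ} {p : CP n} {S : Submodule ℂ (Fin (n + 1) → ℂ)} :
    p.submodule ≤ S ↔ p.rep ∈ S := by
  rw [Projectivization.submodule_eq, Submodule.span_singleton_le_iff_mem]

/-- For `p`, `q` in the boundary and `ℓ ∈ q^⊥(q)`, the span of `ℓ ∩ p^⊥` and `p` is a line of
`p^⊥(p)`. -/
lemma span_mem_pencil {n : ℕ} {p q : CP n} (hp : p ∈ boundary n) (hq : q ∈ boundary n)
    (ℓ : Pencil q) :
    Module.finrank ℂ ↥((ℓ.1 ⊓ perp p) ⊔ p.submodule) = 2 ∧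
      p.submodule ≤ (ℓ.1 ⊓ perp p) ⊔ p.submodule ∧ (ℓ.1 ⊓ perp p) ⊔ p.submodule ≤ perp p := by
  obtain ⟨L, hL2, hqL, hLq⟩ := ℓ
  have hpp : p.submodule ≤ perp p := submodule_le_iff.mpr hp
  refine ⟨?_, le_sup_right, sup_le inf_le_right hpp⟩
  change Module.finrank ℂ ↥((L ⊓ perp p) ⊔ p.submodule) = 2
  by_cases hpq : p = q
  · subst hpq
    rw [inf_eq_left.mpr hLq, sup_eq_left.mpr hqL, hL2]
  · have hqp : q.rep ∉ perp p := fun h => hpq (eq_of_orthogonal hp hq h)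
    have hpL : p.rep ∉ L := fun h => hpq (eq_of_orthogonal hq hp (hLq h)).symm
    have hinf : (L ⊓ perp p) ⊓ p.submodule = ⊥ := by
      rw [eq_bot_iff]
      rintro v ⟨⟨hvL, -⟩, hvp⟩
      rw [SetLike.mem_coe, Projectivization.submodule_eq, Submodule.mem_span_singleton] at hvp
      obtain ⟨c, rfl⟩ := hvp
      by_cases hc : c = 0
      · simp [hc]
      · exact absurd ((Submodule.smul_mem_iff L hc).mp hvL) hpL
    have hone : Module.finrank ℂ ↥(L ⊓ perp p) = 1 := by
      let f : (Fin (n + 1) → ℂ) →ₗ[ℂ] ℂ :=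
        { toFun := fun w => herm w p.rep
          map_add' := fun a b => herm_add_left a b _
          map_smul' := fun c a => herm_smul_left c a _ }
      have hker : (f.domRestrict L).ker = (perp p).comap L.subtype := by
        ext v; rfl
      have hsurj : (f.domRestrict L).range = ⊤ := by
        rw [LinearMap.range_eq_top]
        refine LinearMap.surjective fun h0 => hqp ?_
        exact LinearMap.congr_fun h0 ⟨q.rep, submodule_le_iff.mp hqL⟩
      have hrn := (f.domRestrict L).finrank_range_add_finrank_ker
      rw [hsurj, finrank_top, hL2, hker, Module.finrank_self] at hrn
      have hmap : ((perp p).comap L.subtype).map L.subtype = L ⊓ perp p := by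
        rw [Submodule.map_comap_subtype]
      rw [← hmap, LinearEquiv.finrank_eq (Submodule.equivMapOfInjective _ L.subtype_injective _).symm]
      omega
    have hsup := Submodule.finrank_sup_add_finrank_inf_eq (L ⊓ perp p) p.submodule
    rw [hinf, finrank_bot, hone, Projectivization.finrank_submodule] at hsup
    omega

/-- The map `ℓ ↦ Span(ℓ ∩ p^⊥, p)` from `q^⊥(q)` to `p^⊥(p)`; it is the identity for `p = q`. -/
def transfer {n : ℕ} {p q : CP n} (hp : p ∈ boundary n) (hq : q ∈ boundary n)
    (ℓ : Pencil q) : Pencil p :=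
  ⟨(ℓ.1 ⊓ perp p) ⊔ p.submodule, span_mem_pencil hp hq ℓ⟩

/-- The operation `⋆` on maps `p^⊥(p) → q^⊥(q)`:
`(μ ⋆ ν)(ℓ) = μ(Span(ν(ℓ) ∩ p^⊥, p))`. -/
def starOp {n : ℕ} {p q : CP n} (hp : p ∈ boundary n) (hq : q ∈ boundary n)
    (μ ν : Pencil p → Pencil q) : Pencil p → Pencil q :=
  fun ℓ => μ (transfer hp hq (ν ℓ))

/-- The projective unitary group `PU(k)`, with its quotient topology. -/
abbrev PU (k : ℕ) : Type :=
  Matrix.unitaryGroup (Fin k) ℂ ⧸ Subgroup.center (Matrix.unitaryGroup (Fin k) ℂ)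

end

end ComplexHyperbolic

open ComplexHyperbolic

/-! Choose null vectors `X`, `Y` over `x`, `y` with `⟨X, Y⟩ = 1`. The form is positive definite on
their common orthogonal complement, and an isometry `T` from `ℂⁿ⁻¹` onto it turns both pencils into
the projective space of `ℂⁿ⁻¹`. The theorem then reduces to a statement about unitary matrices.

By the Cartan decomposition, a sequence tending simply to infinity has lifts `l_m b_m ⟨·, c_m⟩ +
r_m` with `|l_m| → ∞` and `b_m`, `c_m`, `r_m` convergent (`RankOneLimit`). The limits of `b_m` and
`c_m` span the attracting points of the sequence and of its inverse. When these are `x` and `y`, the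
limit of `r_m` can be normalized to kill `X` and to map into `Y^⊥`. Passing to the limit in the
invariance of the form shows that it also kills `Y` and acts on the image of `T` as a unitary matrix
`A` (`IsFrame.exists_unitary`). Moving a point `w` of `Y^⊥` slightly in the direction of `X` gives
the rank one term any desired limit, so `𝒟(w)` is the line spanned by `X` and the image of `w` under
the remainder (`IsFrame.dynSet_eq`). Hence the Cartan maps are exactly the maps induced by the
matrices `A` in `unitaryLimits`.

The termwise product of two such sequences is again such a sequence, with matrix `A * B`, because
`⟨X, Y⟩ ≠ 0` and the remainders kill `X`. A diagonal argument shows that `unitaryLimits` is closed,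
and a nonempty compact subsemigroup of a group is a subgroup. In the coordinates `T` the map `ℓ ↦
Span(ℓ ∩ y^⊥, y)` is the identity, so `⋆` is the product of matrices modulo scalars. Thus `Γ(y, x)`
is a closed subgroup of `PU(n-1)`, and a Lie group by the closed subgroup theorem, applied to
conjugation on matrices.

It remains to see that `unitaryLimits` is nonempty. Take sequences `g_m`, `g'_m` in `Γ` attracting
to `x` and `y`, with inverses attracting to `c` and `c'`. Then `g_m h (g'_m)⁻¹` serves as soon as
some `h ∈ Γ` satisfies `⟨h c', c⟩ ≠ 0`. If there is none, `Γ` fixes a boundary point `P`. If all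
eigenvalues at `P` are unimodular, the limit set is contained in `{P}`. Otherwise some `g ∈ Γ` is
loxodromic, and discreteness, applied to the conjugates `g⁻ᵐ h gᵐ`, makes `Γ` fix the second fixed
point of `g` too, so the limit set has at most two points. Both cases contradict non-elementarity
(`exists_not_fixed`). -/

open ComplexHyperbolic

/-! ### The closed subgroup theorem for compact linear groups -/

section LieTheory

open NormedSpace

variable {𝔸 : Type*} [NormedRing 𝔸] [NormedAlgebra ℝ 𝔸]

/-- A one-parameter semigroup obtained as a limit of powers of small elements of a closed
multiplicative set stays in that set. -/
lemma exp_smul_mem_of_tendsto [CompleteSpace 𝔸] (S : Submonoid 𝔸) (hS : IsClosed (S : Set 𝔸))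
    {u : ℕ → 𝔸} {r : ℕ → ℝ} {X : 𝔸} (hu0 : Tendsto u atTop (𝓝 0)) (hu : ∀ m, exp (u m) ∈ S)
    (hr : ∀ m, 0 ≤ r m) (hX : Tendsto (fun m => r m • u m) atTop (𝓝 X)) {t : ℝ} (ht : 0 ≤ t) :
    exp (t • X) ∈ S := by
  let _ : NormedAlgebra ℚ 𝔸 := .restrictScalars ℚ ℝ 𝔸
  -- Rounding `t * r m` down to an integer costs at most `‖u m‖ → 0`, and the exponential of a
  -- natural multiple is a power, hence stays in `S`.
  have h1 : Tendsto (fun m => (⌊t * r m⌋₊ : ℕ) • u m) atTop (𝓝 (t • X)) := by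
    have h2 : Tendsto (fun m => (t * r m) • u m) atTop (𝓝 (t • X)) := by
      simpa only [mul_smul] using hX.const_smul t
    have h3 : Tendsto (fun m => ((⌊t * r m⌋₊ : ℝ) - t * r m) • u m) atTop (𝓝 0) := by
      refine squeeze_zero_norm (fun m => ?_) (tendsto_norm_zero.comp hu0)
      rw [norm_smul]
      refine mul_le_of_le_one_left (norm_nonneg _) ?_
      have h0 : 0 ≤ t * r m := mul_nonneg ht (hr m)
      rw [Real.norm_eq_abs, abs_le]
      constructor <;> linarith [Nat.floor_le h0, Nat.lt_floor_add_one (t * r m)]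
    have h4 := h2.add h3
    rw [add_zero] at h4
    refine h4.congr fun m => ?_
    rw [← add_smul, add_sub_cancel, Nat.cast_smul_eq_nsmul]
  have h5 : Tendsto (fun m => exp ((⌊t * r m⌋₊ : ℕ) • u m)) atTop (𝓝 (exp (t • X))) :=
    (exp_continuous.tendsto _).comp h1
  refine hS.mem_of_tendsto h5 (Eventually.of_forall fun m => ?_)
  rw [exp_nsmul]
  exact pow_mem (hu m) _

lemma contDiff_normedSpace_exp [CompleteSpace 𝔸] : ContDiff ℝ ω (exp : 𝔸 → 𝔸) :=
  contDiff_iff_contDiffAt.2 fun x => (exp_analytic (𝕂 := ℝ) x).contDiffAt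

/-- The Lie algebra of the closed subgroup which is the range of `ι`. -/
def lieAlgebraOfRange [CompleteSpace 𝔸] {G : Type*} [Group G] (ι : G →* 𝔸)
    (hS : IsClosed (range ι)) : Submodule ℝ 𝔸 where
  carrier := {X | ∀ t : ℝ, exp (t • X) ∈ range ι}
  zero_mem' t := ⟨1, by simp⟩
  smul_mem' c X hX t := by
    rw [smul_smul]
    exact hX _
  add_mem' := by
    intro X Y hX hY
    have hS' : IsClosed ((MonoidHom.mrange ι : Submonoid 𝔸) : Set 𝔸) := by
      simpa [MonoidHom.coe_mrange] using hS
    let f : 𝔸 → 𝔸 := exp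
    have hf : ContDiffAt ℝ ω f 0 := contDiff_normedSpace_exp.contDiffAt
    have hf' : HasFDerivAt f ((ContinuousLinearEquiv.refl ℝ 𝔸 : 𝔸 ≃L[ℝ] 𝔸) : 𝔸 →L[ℝ] 𝔸) 0 :=
      (hasStrictFDerivAt_exp_zero (𝕂 := ℝ)).hasFDerivAt
    -- `Ψ.symm` is a local logarithm. Since `log (exp (s X) * exp (s Y)) = s (X + Y) + o(s)`, the
    -- logarithms at `s = 1 / (m + 1)`, multiplied by `m + 1`, tend to `X + Y`, which is the
    -- situation of `exp_smul_mem_of_tendsto`.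
    let Ψ := hf.toOpenPartialHomeomorph f hf' (by simp)
    have h0 : (0 : 𝔸) ∈ Ψ.source := hf.mem_toOpenPartialHomeomorph_source hf' (by simp)
    have hΨ : ∀ Z, Ψ Z = exp Z := fun Z => rfl
    have h1 : (1 : 𝔸) ∈ Ψ.target := by
      have := Ψ.map_source h0
      rwa [hΨ, exp_zero] at this
    have hs1 : Ψ.symm 1 = 0 := by
      have := Ψ.left_inv h0
      rwa [hΨ, exp_zero] at this
    have hd : HasFDerivAt Ψ.symm
        (((ContinuousLinearEquiv.refl ℝ 𝔸).symm : 𝔸 ≃L[ℝ] 𝔸) : 𝔸 →L[ℝ] 𝔸) 1 := by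
      refine Ψ.hasFDerivAt_symm h1 ?_
      rw [hs1]
      exact hf'
    have hexp : ∀ Z : 𝔸, HasDerivAt (fun s : ℝ => exp (s • Z)) Z 0 := fun Z => by
      simpa using hasDerivAt_exp_smul_const Z (0 : ℝ)
    have hprod : HasDerivAt (fun s : ℝ => exp (s • X) * exp (s • Y)) (X + Y) 0 := by
      simpa using! (hexp X).mul (hexp Y)
    have hcomp : HasDerivAt (fun s : ℝ => Ψ.symm (exp (s • X) * exp (s • Y))) (X + Y) 0 := by
      have hd' : HasFDerivAt Ψ.symm
        (((ContinuousLinearEquiv.refl ℝ 𝔸).symm : 𝔸 ≃L[ℝ] 𝔸) : 𝔸 →L[ℝ] 𝔸)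
        (exp ((0 : ℝ) • X) * exp ((0 : ℝ) • Y)) := by simpa using hd
      exact hd'.comp_hasDerivAt (0 : ℝ) hprod
    have hz : Tendsto (fun m : ℕ => ((m : ℝ) + 1)⁻¹) atTop (𝓝 0) :=
      tendsto_inv_atTop_zero.comp (tendsto_natCast_atTop_atTop.atTop_add tendsto_const_nhds)
    have hcont : Tendsto (fun m : ℕ => exp (((m : ℝ) + 1)⁻¹ • X) * exp (((m : ℝ) + 1)⁻¹ • Y))
        atTop (𝓝 1) := by
      have := hprod.continuousAt.tendsto.comp hz
      simpa using! this
    -- From `N` on the products lie in the domain of the logarithm; the sequence `u` is shifted by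
    -- `N` so that this holds for all indices.
    obtain ⟨N, hN⟩ := eventually_atTop.1 (hcont.eventually (Ψ.open_target.mem_nhds h1))
    let u : ℕ → 𝔸 := fun m =>
      Ψ.symm (exp (((m + N : ℕ) + 1 : ℝ)⁻¹ • X) * exp (((m + N : ℕ) + 1 : ℝ)⁻¹ • Y))
    have hu : ∀ m, exp (u m) =
        exp (((m + N : ℕ) + 1 : ℝ)⁻¹ • X) * exp (((m + N : ℕ) + 1 : ℝ)⁻¹ • Y) := fun m => by
      have := Ψ.right_inv (hN (m + N) (Nat.le_add_left _ _))
      exact this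
    have hcont0 : Tendsto (fun s : ℝ => Ψ.symm (exp (s • X) * exp (s • Y))) (𝓝 0) (𝓝 0) := by
      simpa [hs1] using hcomp.continuousAt.tendsto
    have hlim : Tendsto (fun m => ((m + N : ℕ) + 1 : ℝ) • u m) atTop (𝓝 (X + Y)) := by
      have h2 := hcomp.tendsto_slope_zero
      have h3 : Tendsto (fun m : ℕ => ((m : ℝ) + 1)⁻¹) atTop (𝓝[≠] 0) := by
        refine tendsto_nhdsWithin_iff.2 ⟨hz, Eventually.of_forall fun m => ?_⟩
        have : (0 : ℝ) < (m : ℝ) + 1 := by positivity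
        exact inv_ne_zero this.ne'
      have h4 := (h2.comp h3).comp (tendsto_add_atTop_nat N)
      refine h4.congr fun m => ?_
      simp [u, hs1]
    have hlim0 : Tendsto u atTop (𝓝 0) :=
      (hcont0.comp hz).comp (tendsto_add_atTop_nat N)
    have hmem : ∀ m, exp (u m) ∈ MonoidHom.mrange ι := fun m => by
      rw [hu]
      exact mul_mem (hX _) (hY _)
    have hpos : ∀ t : ℝ, 0 ≤ t → exp (t • (X + Y)) ∈ range ι := fun t ht =>
      exp_smul_mem_of_tendsto _ hS' hlim0 hmem (fun m => by positivity) hlim ht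
    intro t
    rcases le_total 0 t with ht | ht
    · exact hpos t ht
    · obtain ⟨g, hg⟩ := hpos (-t) (by linarith)
      refine ⟨g⁻¹, ?_⟩
      have h6 : ι g⁻¹ * ι g = 1 := by rw [← map_mul]; simp
      have h7 : exp ((-t) • (X + Y)) * exp (t • (X + Y)) = 1 := by
        let _ : NormedAlgebra ℚ 𝔸 := .restrictScalars ℚ ℝ 𝔸
        rw [← exp_add_of_commute]
        · rw [← add_smul]; simp
        · exact ((Commute.refl _).smul_left _).smul_right _
      calc ι g⁻¹ = ι g⁻¹ * (exp ((-t) • (X + Y)) * exp (t • (X + Y))) := by rw [h7, mul_one]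
        _ = _ := by rw [← hg, ← mul_assoc, h6, one_mul]

variable [FiniteDimensional ℝ 𝔸]

/-- Small elements of a closed subgroup, written as `exp (p Z) * exp (Z - p Z)` for a projection `p`
onto the Lie algebra, have no component outside the Lie algebra. -/
lemma eventually_eq_of_exp_mul_exp_mem [CompleteSpace 𝔸] {G : Type*} [Group G] (ι : G →* 𝔸)
    (hS : IsClosed (range ι)) (p : 𝔸 →L[ℝ] 𝔸) (hp : ∀ Z, p Z ∈ lieAlgebraOfRange ι hS)
    (hpp : ∀ X ∈ lieAlgebraOfRange ι hS, p X = X) :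
    ∀ᶠ Z in 𝓝 (0 : 𝔸), exp (p Z) * exp (Z - p Z) ∈ range ι → p Z = Z := by
  -- Otherwise the components `y m = z m - p (z m)` of a sequence `z m → 0` are nonzero, and `exp (y
  -- m)` is in the group, since the factor `exp (p (z m))` can be cancelled. A limit `Y` of the
  -- normalized `y m` lies in the Lie algebra by `exp_smul_mem_of_tendsto` with scale `‖y m‖⁻¹`.
  -- Then `p Y = Y`, while `p (y m) = 0` gives `p Y = 0`, although `‖Y‖ = 1`.
  by_contra hcon
  rw [not_eventually] at hcon
  obtain ⟨z, hz0, hz⟩ := exists_seq_forall_of_frequently hcon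
  push Not at hz
  have hS' : IsClosed ((MonoidHom.mrange ι : Submonoid 𝔸) : Set 𝔸) := by
    simpa [MonoidHom.coe_mrange] using hS
  let y : ℕ → 𝔸 := fun m => z m - p (z m)
  have hyne : ∀ m, y m ≠ 0 := fun m h => (hz m).2 (sub_eq_zero.1 h).symm
  have hynorm : ∀ m, ‖y m‖ ≠ 0 := fun m => norm_ne_zero_iff.2 (hyne m)
  have hpy : ∀ m, p (y m) = 0 := fun m => by
    simp only [y, map_sub]
    rw [hpp _ (hp _), sub_self]
  have hy0 : Tendsto y atTop (𝓝 0) := by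
    have h1 : Tendsto (fun m => p (z m)) atTop (𝓝 0) := by
      simpa using! (p.continuous.tendsto 0).comp hz0
    simpa using hz0.sub h1
  have hymem : ∀ m, exp (y m) ∈ MonoidHom.mrange ι := fun m => by
    obtain ⟨g, hg⟩ := (hz m).1
    obtain ⟨k, hk⟩ := hp (z m) 1
    rw [one_smul] at hk
    refine ⟨k⁻¹ * g, ?_⟩
    rw [map_mul, hg, ← hk, ← mul_assoc, ← map_mul]
    simp [y]
  obtain ⟨Y, hY, φ, hφ, hφY⟩ := (isCompact_sphere (0 : 𝔸) 1).tendsto_subseq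
    (x := fun m => ‖y m‖⁻¹ • y m) (fun m => by simp [norm_smul, hynorm m])
  have hY1 : ‖Y‖ = 1 := by simpa using hY
  have hlie : ∀ t : ℝ, 0 ≤ t → exp (t • Y) ∈ range ι := fun t ht =>
    exp_smul_mem_of_tendsto _ hS' (hy0.comp hφ.tendsto_atTop) (fun m => hymem (φ m))
      (fun m => inv_nonneg.2 (norm_nonneg _)) hφY ht
  have hYmem : Y ∈ lieAlgebraOfRange ι hS := by
    intro t
    rcases le_total 0 t with ht | ht
    · exact hlie t ht
    · obtain ⟨g, hg⟩ := hlie (-t) (by linarith)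
      refine ⟨g⁻¹, ?_⟩
      have h6 : ι g⁻¹ * ι g = 1 := by rw [← map_mul]; simp
      have h7 : exp ((-t) • Y) * exp (t • Y) = 1 := by
        let _ : NormedAlgebra ℚ 𝔸 := .restrictScalars ℚ ℝ 𝔸
        rw [← exp_add_of_commute]
        · rw [← add_smul]; simp
        · exact ((Commute.refl _).smul_left _).smul_right _
      calc ι g⁻¹ = ι g⁻¹ * (exp ((-t) • Y) * exp (t • Y)) := by rw [h7, mul_one]
        _ = _ := by rw [← hg, ← mul_assoc, h6, one_mul]
  have hpY : p Y = 0 := by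
    refine tendsto_nhds_unique ((p.continuous.tendsto Y).comp hφY) ?_
    refine tendsto_const_nhds.congr fun m => ?_
    simp [hpy]
  rw [hpp Y hYmem] at hpY
  simp [hpY] at hY1

/-- A chart around the identity of a compact group of elements of a finite-dimensional algebra. -/
lemma exists_chart_of_injective {G : Type*} [Group G] [TopologicalSpace G]
    [CompactSpace G] (ι : G →* 𝔸) (hc : Continuous ι) (hi : Function.Injective ι) :
    ∃ (d : ℕ) (e : OpenPartialHomeomorph G (EuclideanSpace ℝ (Fin d)))
      (f : 𝔸 → EuclideanSpace ℝ (Fin d)) (h : EuclideanSpace ℝ (Fin d) → 𝔸) (V : Set 𝔸),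
      IsOpen V ∧ ContDiffOn ℝ ∞ f V ∧ ContDiff ℝ ∞ h ∧ 1 ∈ e.source ∧
      (∀ g ∈ e.source, ι g ∈ V ∧ e g = f (ι g)) ∧ ∀ v ∈ e.target, ι (e.symm v) = h v := by
  have : CompleteSpace 𝔸 := FiniteDimensional.complete ℝ 𝔸
  have hemb : IsClosedEmbedding ι := hc.isClosedEmbedding hi
  have hS := hemb.isClosed_range
  set 𝔤 := lieAlgebraOfRange ι hS with h𝔤
  let d := Module.finrank ℝ 𝔤
  let j0 : EuclideanSpace ℝ (Fin d) ≃ₗ[ℝ] 𝔤 := LinearEquiv.ofFinrankEq _ _ (by simp [d])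
  let j1 : EuclideanSpace ℝ (Fin d) →ₗ[ℝ] 𝔸 := 𝔤.subtype ∘ₗ j0.toLinearMap
  have hj1 : LinearMap.ker j1 = ⊥ := by
    rw [LinearMap.ker_eq_bot]
    exact 𝔤.subtype_injective.comp j0.injective
  obtain ⟨p1, hp1⟩ := LinearMap.exists_leftInverse_of_injective j1 hj1
  let j : EuclideanSpace ℝ (Fin d) →L[ℝ] 𝔸 := j1.toContinuousLinearMap
  let π : 𝔸 →L[ℝ] EuclideanSpace ℝ (Fin d) := p1.toContinuousLinearMap
  have hπj : ∀ v, π (j v) = v := fun v => LinearMap.congr_fun hp1 v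
  have hj : ∀ v, j v ∈ 𝔤 := fun v => (j0 v).2
  have hj' : ∀ X ∈ 𝔤, ∃ v, j v = X := fun X hX => ⟨j0.symm ⟨X, hX⟩, by simp [j, j1]⟩
  let p : 𝔸 →L[ℝ] 𝔸 := j.comp π
  have hp : ∀ Z, p Z = j (π Z) := fun Z => rfl
  have hpp : ∀ X ∈ 𝔤, p X = X := fun X hX => by
    obtain ⟨v, rfl⟩ := hj' X hX
    rw [hp, hπj]
  -- The derivative of `Φ` at `0` is `p + (1 - p) = 1`, so `Φ` gives local coordinates of `𝔸` at
  -- `1`. In these the group is the slice `p Z = Z`.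
  let Φ : 𝔸 → 𝔸 := fun Z => exp (p Z) * exp (Z - p Z)
  have hexp := contDiff_normedSpace_exp (𝔸 := 𝔸)
  have hΦ : ContDiff ℝ ω Φ :=
    (hexp.comp p.contDiff).mul (hexp.comp (contDiff_id.sub p.contDiff))
  have hΦ' : HasFDerivAt Φ ((ContinuousLinearEquiv.refl ℝ 𝔸 : 𝔸 ≃L[ℝ] 𝔸) : 𝔸 →L[ℝ] 𝔸) 0 := by
    have h0 := (hasStrictFDerivAt_exp_zero (𝕂 := ℝ) (𝔸 := 𝔸)).hasFDerivAt
    have h1 : HasFDerivAt (fun Z => exp (p Z)) ((1 : 𝔸 →L[ℝ] 𝔸).comp p) (0 : 𝔸) :=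
      HasFDerivAt.comp (0 : 𝔸) (by simpa using h0) p.hasFDerivAt
    have h2 : HasFDerivAt (fun Z => exp (Z - p Z))
        ((1 : 𝔸 →L[ℝ] 𝔸).comp (ContinuousLinearMap.id ℝ 𝔸 - p)) (0 : 𝔸) :=
      HasFDerivAt.comp (g := exp) (f := fun Z => Z - p Z) (0 : 𝔸) (by simpa using h0)
        ((hasFDerivAt_id _).sub p.hasFDerivAt)
    have h3 := h1.mul' h2
    refine h3.congr_fderiv ?_
    ext Z
    simp
  let Ψ0 := hΦ.contDiffAt.toOpenPartialHomeomorph Φ hΦ' (by simp)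
  have hΨ00 : (0 : 𝔸) ∈ Ψ0.source := hΦ.contDiffAt.mem_toOpenPartialHomeomorph_source hΦ' (by simp)
  have hΨ0 : ∀ Z, Ψ0 Z = Φ Z := fun Z => rfl
  have hΦ0 : Φ 0 = 1 := by simp [Φ]
  have hsm : ∀ᶠ a in 𝓝 (Φ 0), ContDiffAt ℝ ∞ Ψ0.symm a := by
    have h1 : ContDiffAt ℝ ω Ψ0.symm (Φ 0) := hΦ.contDiffAt.to_localInverse hΦ' (by simp)
    filter_upwards [h1.eventually (by simp)] with a ha using ha.of_le le_top
  have hsm' : ∀ᶠ Z in 𝓝 (0 : 𝔸), ContDiffAt ℝ ∞ Ψ0.symm (Φ Z) :=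
    hΦ.continuous.continuousAt.eventually hsm
  have hslice := eventually_eq_of_exp_mul_exp_mem ι hS p (fun Z => hj _) hpp
  obtain ⟨U, hU, hUo, hU0⟩ := eventually_nhds_iff.1 (hsm'.and hslice)
  let Ψ := Ψ0.restrOpen U hUo
  have hΨ : ∀ Z, Ψ Z = Φ Z := fun Z => rfl
  have hΨs : Ψ.source = Ψ0.source ∩ U := rfl
  have hΨsymm : ∀ a, Ψ.symm a = Ψ0.symm a := fun a => rfl
  have h0s : (0 : 𝔸) ∈ Ψ.source := ⟨hΨ00, hU0⟩
  have hΦj : ∀ v, Φ (j v) = exp (j v) := fun v => by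
    simp only [Φ]
    rw [hpp _ (hj v)]; simp
  have hkey : ∀ g, ι g ∈ Ψ.target → j (π (Ψ.symm (ι g))) = Ψ.symm (ι g) := fun g hg => by
    have h1 := Ψ.map_target hg
    have h2 := (hU _ h1.2).2
    refine h2 ?_
    exact ⟨g, (Ψ.right_inv hg).symm⟩
  have hjmem : ∀ v, exp (j v) ∈ range ι := fun v => by simpa using hj v 1
  have hinv : ∀ v, ι (Function.invFun ι (exp (j v))) = exp (j v) := fun v =>
    Function.invFun_eq (hjmem v)
  let e : OpenPartialHomeomorph G (EuclideanSpace ℝ (Fin d)) :=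
    { toFun := fun g => π (Ψ.symm (ι g))
      invFun := fun v => Function.invFun ι (exp (j v))
      source := ι ⁻¹' Ψ.target
      target := j ⁻¹' Ψ.source
      map_source' := fun g hg => by
        rw [mem_preimage, hkey g hg]
        exact Ψ.map_target hg
      map_target' := fun v hv => by
        rw [mem_preimage, hinv, ← hΦj, ← hΨ]
        exact Ψ.map_source hv
      left_inv' := fun g hg => by
        apply hi
        rw [hinv, ← hΦj, hkey g hg, ← hΨ]
        exact Ψ.right_inv hg
      right_inv' := fun v hv => by
        rw [hinv, ← hΦj, ← hΨ, Ψ.left_inv hv, hπj]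
      open_source := Ψ.open_target.preimage hc
      open_target := Ψ.open_source.preimage j.continuous
      continuousOn_toFun := π.continuous.comp_continuousOn
        (Ψ.symm.continuousOn.comp hc.continuousOn fun g hg => hg)
      continuousOn_invFun := by
        refine Continuous.continuousOn ?_
        rw [hemb.isEmbedding.continuous_iff]
        have : (ι ∘ fun v => Function.invFun ι (exp (j v))) = fun v => exp (j v) :=
          funext hinv
        rw [this]
        exact hexp.continuous.comp j.continuous }
  -- The chart is the restriction of a smooth map defined on an open set of `𝔸`, and its inverse,
  -- seen in `𝔸`, is smooth as well. All smoothness on `G` will be read off from these two ambient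
  -- maps.
  refine ⟨d, e, fun a => π (Ψ.symm a), fun v => exp (j v), Ψ.target, Ψ.open_target, ?_, ?_, ?_, ?_,
    ?_⟩
  · intro a ha
    refine (π.contDiff.contDiffAt.comp a ?_).contDiffWithinAt
    have h1 := Ψ.map_target ha
    have h2 := (hU _ h1.2).1
    rwa [← hΨ, Ψ.right_inv ha] at h2
  · exact (hexp.of_le le_top).comp j.contDiff
  · change ι 1 ∈ Ψ.target
    rw [map_one, ← hΦ0, ← hΨ]
    exact Ψ.map_source h0s
  · exact fun g hg => ⟨hg, rfl⟩
  · exact fun v _ => hinv v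

/-- **Closed subgroup theorem** for compact groups: a compact group with a faithful continuous
homomorphism to the multiplicative monoid of a finite-dimensional algebra is a Lie group. -/
theorem exists_lieGroup_of_injective {G : Type*} [Group G] [TopologicalSpace G]
    [CompactSpace G] (ι : G →* 𝔸) (hc : Continuous ι) (hi : Function.Injective ι) :
    ∃ (d : ℕ) (_cs : ChartedSpace (EuclideanSpace ℝ (Fin d)) G), LieGroup (𝓡 d) ∞ G := by
  have : CompleteSpace 𝔸 := FiniteDimensional.complete ℝ 𝔸
  have hemb : IsClosedEmbedding ι := hc.isClosedEmbedding hi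
  obtain ⟨d, e, f, h, V, hV, hf, hh, h1, he, hes⟩ := exists_chart_of_injective ι hc hi
  have hunit : ∀ g, ι g * ι g⁻¹ = 1 := fun g => by rw [← map_mul]; simp
  have hunit' : ∀ g, ι g⁻¹ * ι g = 1 := fun g => by rw [← map_mul]; simp
  let un : G → 𝔸ˣ := fun g => ⟨ι g, ι g⁻¹, hunit g, hunit' g⟩
  have hring : ∀ g, ι g⁻¹ = Ring.inverse (ι g) := fun g => (Ring.inverse_unit (un g)).symm
  have htg : IsTopologicalGroup G :=
    { continuous_mul := by
        rw [hemb.isEmbedding.continuous_iff]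
        have : (ι ∘ fun q : G × G => q.1 * q.2) = fun q => ι q.1 * ι q.2 := by
          ext q; simp
        rw [this]
        fun_prop
      continuous_inv := by
        rw [hemb.isEmbedding.continuous_iff]
        have : (ι ∘ fun g : G => g⁻¹) = fun g => Ring.inverse (ι g) := funext hring
        rw [this, continuous_iff_continuousAt]
        intro g
        exact ContinuousAt.comp (f := ι) (g := Ring.inverse)
          (contDiffAt_ringInverse ℝ (n := 0) (un g)).continuousAt hc.continuousAt }
  -- The atlas consists of the left translates of the chart at `1`; the transition from the chart at
  -- `a` to the one at `b` is `v ↦ f (ι (b⁻¹ * a) * h v)`.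
  let ch : G → OpenPartialHomeomorph G (EuclideanSpace ℝ (Fin d)) := fun g =>
    (Homeomorph.mulLeft g⁻¹).toOpenPartialHomeomorph.trans e
  have hch : ∀ g a, ch g a = e (g⁻¹ * a) := fun g a => rfl
  have hchs : ∀ g a, a ∈ (ch g).source ↔ g⁻¹ * a ∈ e.source := fun g a => by
    simp [ch]
  have hcht : ∀ g, (ch g).target = e.target := fun g => by simp [ch]
  have hchsymm : ∀ g v, (ch g).symm v = g * e.symm v := fun g v => by
    simp [ch, Homeomorph.mulLeft_symm]
  let cs : ChartedSpace (EuclideanSpace ℝ (Fin d)) G :=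
    { atlas := range ch
      chartAt := ch
      mem_chart_source := fun g => by rw [hchs]; simpa using h1
      chart_mem_atlas := fun g => ⟨g, rfl⟩ }
  have hchart : ∀ g : G, chartAt (EuclideanSpace ℝ (Fin d)) g = ch g := fun g => rfl
  have hman : IsManifold (𝓡 d) ∞ G := by
    refine isManifold_of_contDiffOn _ _ _ ?_
    rintro _ _ ⟨a, rfl⟩ ⟨b, rfl⟩
    have hsrc : ∀ v ∈ ((ch a).symm ≫ₕ ch b).source,
        v ∈ e.target ∧ (b⁻¹ * (a * e.symm v)) ∈ e.source := by
      intro v hv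
      rw [OpenPartialHomeomorph.trans_source] at hv
      obtain ⟨h2, h3⟩ := hv
      rw [mem_preimage, hchsymm, hchs] at h3
      exact ⟨by simpa [hcht] using h2, h3⟩
    have hval : ∀ v ∈ e.target, ι (b⁻¹ * (a * e.symm v)) = ι (b⁻¹ * a) * h v := fun v hv => by
      rw [← mul_assoc, map_mul, hes v hv]
    have hcd : ContDiffOn ℝ ∞ (fun v => f (ι (b⁻¹ * a) * h v))
        ((ch a).symm ≫ₕ ch b).source := by
      refine hf.comp (contDiff_const.mul hh).contDiffOn fun v hv => ?_
      obtain ⟨h2, h3⟩ := hsrc v hv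
      rw [← hval v h2]
      exact (he _ h3).1
    simp only [modelWithCornersSelf_coe, modelWithCornersSelf_coe_symm, Function.id_comp,
      Function.comp_id, preimage_id, range_id, inter_univ]
    refine hcd.congr fun v hv => ?_
    obtain ⟨h2, h3⟩ := hsrc v hv
    rw [← hval v h2, ← (he _ h3).2]
    simp [hchsymm, hch]
  have hι : ContMDiff (𝓡 d) 𝓘(ℝ, 𝔸) ∞ ι := by
    intro g
    rw [contMDiffAt_iff]
    refine ⟨hc.continuousAt, ?_⟩
    have h2 : ContDiffWithinAt ℝ ∞ (fun v => ι g * h v) (range (𝓡 d))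
        (extChartAt (𝓡 d) g g) := (contDiff_const.mul hh).contDiffWithinAt
    have hx : ∀ v ∈ e.target, ι ((extChartAt (𝓡 d) g).symm v) = ι g * h v := fun v hv => by
      have : (extChartAt (𝓡 d) g).symm v = g * e.symm v := by
        simp [extChartAt, hchart, hchsymm]
      rw [this, map_mul, hes v hv]
    have hmem : extChartAt (𝓡 d) g g ∈ e.target := by
      have : extChartAt (𝓡 d) g g = e 1 := by simp [extChartAt, hchart, hch]
      rw [this]
      exact e.map_source h1
    refine h2.congr_of_eventuallyEq ?_ (hx _ hmem)
    filter_upwards [mem_nhdsWithin_of_mem_nhds (e.open_target.mem_nhds hmem)] with v hv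
    exact hx v hv
  -- A continuous map into `G` is smooth once its composite with `ι` is, because in the chart at `F
  -- m` it reads `f (ι (F m)⁻¹ * ι (F m'))`. Smoothness of the group operations thus descends from
  -- `𝔸`.
  have hlift : ∀ {M : Type _} [TopologicalSpace M]
      {E : Type} [NormedAddCommGroup E] [NormedSpace ℝ E] {H : Type _} [TopologicalSpace H]
      (I : ModelWithCorners ℝ E H) [ChartedSpace H M] (F : M → G), Continuous F →
      ContMDiff I 𝓘(ℝ, 𝔸) ∞ (fun m => ι (F m)) → ContMDiff I (𝓡 d) ∞ F := by
    intro M _ E _ _ H _ I _ F hF hιF m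
    rw [contMDiffAt_iff_target]
    refine ⟨hF.continuousAt, ?_⟩
    have hmem : ι ((F m)⁻¹) * ι (F m) ∈ V := by
      rw [hunit', ← map_one ι]
      exact (he _ h1).1
    have h2 : ContDiffAt ℝ ∞ (fun a => f (ι (F m)⁻¹ * a)) (ι (F m)) :=
      ContDiffAt.comp (g := f) (f := fun a => ι (F m)⁻¹ * a) _
        (hf.contDiffAt (hV.mem_nhds hmem)) (contDiff_const.mul contDiff_id).contDiffAt
    have h3 : ContMDiffAt I 𝓘(ℝ, EuclideanSpace ℝ (Fin d)) ∞
        (fun m' => f (ι (F m)⁻¹ * ι (F m'))) m :=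
      ContMDiffAt.comp (I' := 𝓘(ℝ, 𝔸)) (g := fun a => f (ι (F m)⁻¹ * a)) (f := fun m' => ι (F m')) m
        h2.contMDiffAt (hιF m)
    refine h3.congr_of_eventuallyEq ?_
    have hop : IsOpen {m' | (F m)⁻¹ * F m' ∈ e.source} :=
      e.open_source.preimage (continuous_const.mul hF)
    filter_upwards [hop.mem_nhds (by simpa using h1)] with m' hm'
    rw [← map_mul, ← (he _ hm').2]
    simp [extChartAt, hchart, hch]
  refine ⟨d, cs, ?_⟩
  have hmul : ContMDiffMul (𝓡 d) ∞ G :=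
    { hman with
      contMDiff_mul := by
        refine hlift _ _ continuous_mul ?_
        have h2 : ContMDiff ((𝓡 d).prod (𝓡 d)) 𝓘(ℝ, 𝔸) ∞ fun q : G × G => ι q.1 * ι q.2 := by
          have h3 : ContDiff ℝ ∞ fun q : 𝔸 × 𝔸 => q.1 * q.2 := contDiff_fst.mul contDiff_snd
          exact h3.contMDiff.comp
            ((hι.comp contMDiff_fst).prodMk_space (hι.comp contMDiff_snd))
        simpa using h2 }
  exact
    { hmul with
      contMDiff_inv := by
        refine hlift _ _ continuous_inv ?_
        intro g
        have h2 : ContDiffAt ℝ ∞ Ring.inverse (ι g) := contDiffAt_ringInverse ℝ (un g)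
        have h3 := h2.contMDiffAt.comp g (hι g)
        exact h3.congr_of_eventuallyEq (Eventually.of_forall hring) }

end LieTheory

/-! ### The Hermitian form and its adjoints -/

section HermitianForm

variable {n : ℕ}

lemma hermMatrix_conjTranspose : (hermMatrix n)ᴴ = hermMatrix n := by
  ext i j
  simp only [hermMatrix, Matrix.conjTranspose_apply, Matrix.of_apply]
  have : (Equiv.swap 0 (Fin.last n) j = i) ↔ (Equiv.swap 0 (Fin.last n) i = j) := by
    constructor <;> rintro rfl <;> simp
  simp only [this]
  split_ifs <;> simp

lemma hermMatrix_mulVec (z : Fin (n + 1) → ℂ) :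
    hermMatrix n *ᵥ z = fun i => z (Equiv.swap 0 (Fin.last n) i) := by
  ext i
  simp [hermMatrix, Matrix.mulVec, dotProduct]

lemma hermMatrix_mul_self : hermMatrix n * hermMatrix n = 1 := by
  refine Matrix.ext_of_mulVec_single fun i => ?_
  rw [← Matrix.mulVec_mulVec, hermMatrix_mulVec, hermMatrix_mulVec, Matrix.one_mulVec]
  simp

lemma herm_add_right (z w w' : Fin (n + 1) → ℂ) : herm z (w + w') = herm z w + herm z w' := by
  rw [← star_herm, herm_add_left, star_add, star_herm, star_herm]

lemma herm_smul_right (c : ℂ) (z w : Fin (n + 1) → ℂ) : herm z (c • w) = star c * herm z w := by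
  rw [← star_herm, herm_smul_left, star_mul', star_herm]

@[simp] lemma herm_zero_left (w : Fin (n + 1) → ℂ) : herm 0 w = 0 := by simp [herm]

lemma herm_comm_eq_zero {z w : Fin (n + 1) → ℂ} (h : herm z w = 0) : herm w z = 0 := by
  rw [← star_herm, h, star_zero]

lemma Continuous.herm_comp {α : Type*} [TopologicalSpace α] {u v : α → Fin (n + 1) → ℂ}
    (hu : Continuous u) (hv : Continuous v) : Continuous fun a => herm (u a) (v a) := by
  simp only [herm_apply]
  fun_prop

lemma Filter.Tendsto.herm_comp {α : Type*} {f : Filter α} {u v : α → Fin (n + 1) → ℂ}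
    {p q : Fin (n + 1) → ℂ} (hu : Tendsto u f (𝓝 p)) (hv : Tendsto v f (𝓝 q)) :
    Tendsto (fun a => herm (u a) (v a)) f (𝓝 (herm p q)) := by
  simp only [herm_apply]
  exact tendsto_finsetSum _ fun i _ => (tendsto_pi_nhds.1 hv i).star.mul (tendsto_pi_nhds.1 hu _)

/-- The adjoint of a matrix for the Hermitian form. -/
lemma herm_mulVec_left (M : Matrix (Fin (n + 1)) (Fin (n + 1)) ℂ) (z w : Fin (n + 1) → ℂ) :
    herm (M *ᵥ z) w = herm z ((hermMatrix n * Mᴴ * hermMatrix n) *ᵥ w) := by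
  unfold herm
  rw [Matrix.star_mulVec, ← Matrix.dotProduct_mulVec]
  simp only [Matrix.conjTranspose_mul, Matrix.conjTranspose_conjTranspose,
    hermMatrix_conjTranspose, Matrix.mulVec_mulVec]
  congr 2
  rw [Matrix.mul_assoc, Matrix.mul_assoc, hermMatrix_mul_self, Matrix.mul_one]

lemma mem_U1_iff {g : GL (Fin (n + 1)) ℂ} :
    g ∈ U1 n ↔ (g : Matrix _ _ ℂ) * hermMatrix n * (g : Matrix _ _ ℂ)ᴴ = hermMatrix n := Iff.rfl

/-- The inverse is the adjoint for the form. It is therefore continuous in the entries, and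
asymptotics of `g` pass to `g⁻¹`. -/
lemma coe_inv_of_mem_U1 {g : GL (Fin (n + 1)) ℂ} (hg : g ∈ U1 n) :
    ((g⁻¹ : GL (Fin (n + 1)) ℂ) : Matrix _ _ ℂ)
      = hermMatrix n * (g : Matrix _ _ ℂ)ᴴ * hermMatrix n := by
  have h1 : g.1 * (hermMatrix n * (g : Matrix _ _ ℂ)ᴴ * hermMatrix n) = 1 := by
    rw [← Matrix.mul_assoc, ← Matrix.mul_assoc, mem_U1_iff.1 hg, hermMatrix_mul_self]
  have h2 : (g⁻¹).1 * g.1 = 1 := by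
    rw [← Units.val_mul, inv_mul_cancel, Units.val_one]
  exact left_inv_eq_right_inv h2 h1

lemma herm_mulVec_U1 {g : GL (Fin (n + 1)) ℂ} (hg : g ∈ U1 n) (z w : Fin (n + 1) → ℂ) :
    herm (g.1 *ᵥ z) (g.1 *ᵥ w) = herm z w := by
  rw [herm_mulVec_left, ← coe_inv_of_mem_U1 hg, Matrix.mulVec_mulVec, ← Units.val_mul,
    inv_mul_cancel, Units.val_one, Matrix.one_mulVec]

lemma herm_mulVec_U1_left {g : GL (Fin (n + 1)) ℂ} (hg : g ∈ U1 n) (z w : Fin (n + 1) → ℂ) :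
    herm (g.1 *ᵥ z) w
      = herm z ((g⁻¹).1 *ᵥ w) := by
  rw [herm_mulVec_left, ← coe_inv_of_mem_U1 hg]

/-- The vector which represents the functional `⟨·, w⟩`. -/
noncomputable def dualVec (w : Fin (n + 1) → ℂ) : Fin (n + 1) → ℂ := hermMatrix n *ᵥ star w

lemma dualVec_dotProduct (w z : Fin (n + 1) → ℂ) : dualVec w ⬝ᵥ z = herm z w := by
  rw [dualVec, hermMatrix_mulVec, herm_apply, dotProduct,
    ← Equiv.sum_comp (Equiv.swap 0 (Fin.last n))]
  simp

lemma dualVec_apply (w : Fin (n + 1) → ℂ) (i : Fin (n + 1)) :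
    dualVec w i = star (w (Equiv.swap 0 (Fin.last n) i)) := by
  rw [dualVec, hermMatrix_mulVec]; rfl

lemma dualVec_smul (c : ℂ) (w : Fin (n + 1) → ℂ) : dualVec (c • w) = star c • dualVec w := by
  ext i; simp [dualVec_apply]

lemma dualVec_injective : Function.Injective (dualVec (n := n)) := by
  intro w w' h
  ext i
  have := congrFun h (Equiv.swap 0 (Fin.last n) i)
  simp only [dualVec_apply, Equiv.swap_apply_self] at this
  exact star_injective this

lemma dualVec_surjective (a : Fin (n + 1) → ℂ) : ∃ w, dualVec w = a := by
  refine ⟨fun i => star (a (Equiv.swap 0 (Fin.last n) i)), ?_⟩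
  ext i; simp [dualVec_apply]

lemma dualVec_zero : dualVec (0 : Fin (n + 1) → ℂ) = 0 := by
  ext i; simp [dualVec_apply]

/-- A null vector of the form is `0` if it is orthogonal to everything. -/
lemma eq_zero_of_herm_eq_zero {w : Fin (n + 1) → ℂ} (h : ∀ z, herm z w = 0) : w = 0 := by
  apply dualVec_injective
  rw [dualVec_zero]
  refine dotProduct_eq_zero _ fun z => ?_
  rw [dualVec_dotProduct, h]

/-- Orthogonal null vectors are proportional. -/
lemma exists_smul_eq_of_null {a b : Fin (n + 1) → ℂ} (ha : herm a a = 0) (hb : herm b b = 0)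
    (hab : herm a b = 0) (hb0 : b ≠ 0) : ∃ c : ℂ, a = c • b := by
  by_cases ha0 : a = 0
  · exact ⟨0, by simp [ha0]⟩
  have key : ∀ (v : Fin (n + 1) → ℂ) (hv : v ≠ 0), herm v v = 0 →
      Projectivization.mk ℂ v hv ∈ boundary n := by
    intro v hv h
    obtain ⟨c, hc⟩ := Projectivization.exists_smul_eq_mk_rep ℂ v hv
    change herm _ _ = 0
    rw [← hc, Units.smul_def, herm_smul_left, herm_smul_right, h]
    simp
  have h1 : Projectivization.mk ℂ a ha0 = Projectivization.mk ℂ b hb0 := by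
    refine eq_of_orthogonal (key a ha0 ha) (key b hb0 hb) ?_
    obtain ⟨c, hc⟩ := Projectivization.exists_smul_eq_mk_rep ℂ a ha0
    obtain ⟨d, hd⟩ := Projectivization.exists_smul_eq_mk_rep ℂ b hb0
    rw [← hc, ← hd, Units.smul_def, Units.smul_def, herm_smul_left, herm_smul_right,
      herm_comm_eq_zero hab]
    simp
  obtain ⟨c, hc⟩ := (Projectivization.mk_eq_mk_iff' ℂ a b ha0 hb0).1 h1
  exact ⟨c, hc.symm⟩

end HermitianForm

/-! ### The Cartan decomposition of `U(1, n)` -/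

section Cartan

variable {n : ℕ}

/-- A vector which spans the point of complex hyperbolic space fixed by `K n`. -/
def originVec (n : ℕ) : Fin (n + 1) → ℂ := Pi.single 0 1 - Pi.single (Fin.last n) 1

/-- The other eigenvector of the form in the plane spanned by the first and last coordinates. -/
def axisVec (n : ℕ) : Fin (n + 1) → ℂ := Pi.single 0 1 + Pi.single (Fin.last n) 1

/-- The matrix of the form is the reflection in the hyperplane orthogonal to `originVec n`, which
has squared length two. It therefore differs from the identity by a rank one term, and this links
`U(1, n)` with the unitary group. -/
lemma hermMatrix_eq (hn : n ≠ 0) :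
    hermMatrix n = 1 - Matrix.vecMulVec (originVec n) (star (originVec n)) := by
  have h0 : (0 : Fin (n + 1)) ≠ Fin.last n := fun h => hn (by simpa [Fin.ext_iff] using h.symm)
  ext i j
  simp only [hermMatrix, Matrix.of_apply, Matrix.sub_apply, Matrix.vecMulVec_apply, Pi.star_apply,
    originVec, Pi.sub_apply, Pi.single_apply, Matrix.one_apply]
  by_cases hi0 : i = 0
  · subst hi0
    rw [Equiv.swap_apply_left]
    by_cases hj0 : j = 0
    · subst hj0; simp [h0, h0.symm]
    · by_cases hj : j = Fin.last n
      · subst hj; simp [h0, h0.symm]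
      · simp [h0, hj0, hj, Ne.symm hj0, Ne.symm hj]
  · by_cases hi : i = Fin.last n
    · subst hi
      rw [Equiv.swap_apply_right]
      by_cases hj0 : j = 0
      · subst hj0; simp [h0, h0.symm]
      · by_cases hj : j = Fin.last n
        · subst hj; simp [h0, h0.symm]
        · simp [hi0, hj0, hj, Ne.symm hj0, Ne.symm hj]
    · rw [Equiv.swap_apply_of_ne_of_ne hi0 hi]
      simp [hi0, hi]

/-- The invertible matrix given by a unitary matrix. -/
noncomputable def unitaryGL {k : ℕ} (M : Matrix (Fin k) (Fin k) ℂ) (h : M * Mᴴ = 1) :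
    GL (Fin k) ℂ :=
  ⟨M, Mᴴ, h, mul_eq_one_comm.1 h⟩

/-- Writing the form as `1 - o oᴴ`, invariance reads `g gᴴ - (g o)(g o)ᴴ = 1 - o oᴴ`; the rank one
terms cancel when `g o` is `o` up to a phase. -/
lemma mem_K_of_mulVec_originVec (hn : n ≠ 0) {g : GL (Fin (n + 1)) ℂ} (hg : g ∈ U1 n) {c : ℂ}
    (hc : star c * c = 1) (h : g.1 *ᵥ originVec n = c • originVec n) :
    g ∈ K n := by
  refine ⟨hg, ?_⟩
  rw [Matrix.mem_unitaryGroup_iff, Matrix.star_eq_conjTranspose]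
  have h1 := mem_U1_iff.1 hg
  rw [hermMatrix_eq hn, Matrix.mul_sub, Matrix.sub_mul, Matrix.mul_one, Matrix.mul_vecMulVec,
    Matrix.vecMulVec_mul, h, ← Matrix.star_mulVec, h, star_smul, Matrix.smul_vecMulVec,
    Matrix.vecMulVec_smul, smul_smul, mul_comm, hc, one_smul] at h1
  exact sub_left_injective h1

lemma unitaryGL_mem_K (hn : n ≠ 0) {M : Matrix (Fin (n + 1)) (Fin (n + 1)) ℂ} (h : M * Mᴴ = 1)
    (ho : M *ᵥ originVec n = originVec n) : unitaryGL M h ∈ K n := by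
  refine ⟨?_, by rw [Matrix.mem_unitaryGroup_iff]; exact h⟩
  rw [mem_U1_iff]
  change M * _ * Mᴴ = _
  rw [hermMatrix_eq hn, Matrix.mul_sub, Matrix.sub_mul, Matrix.mul_one, Matrix.mul_vecMulVec,
    Matrix.vecMulVec_mul, h, ← Matrix.star_mulVec, ho]

lemma star_dotProduct_self {k : ℕ} (w : Fin k → ℂ) :
    star w ⬝ᵥ w = ((∑ i, Complex.normSq (w i) : ℝ) : ℂ) := by
  rw [Complex.ofReal_sum]
  refine Finset.sum_congr rfl fun i _ => ?_
  rw [Complex.normSq_eq_conj_mul_self]; rfl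

lemma sum_normSq_eq_zero {k : ℕ} {w : Fin k → ℂ} : ∑ i, Complex.normSq (w i) = 0 ↔ w = 0 := by
  rw [Finset.sum_eq_zero_iff_of_nonneg fun i _ => Complex.normSq_nonneg _]
  simp [funext_iff]

/-- A unitary matrix which maps `p` to a vector `q` of the same length, and is the identity
on the orthogonal complement of `p - q`. -/
lemma exists_unitary_mulVec_eq {k : ℕ} (p q : Fin k → ℂ) (hpq : star p ⬝ᵥ p = star q ⬝ᵥ q) :
    ∃ M : Matrix (Fin k) (Fin k) ℂ, M * Mᴴ = 1 ∧ M *ᵥ p = q ∧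
      ∀ o, star (p - q) ⬝ᵥ o = 0 → M *ᵥ o = o := by
  set w := p - q with hw
  set β := star w ⬝ᵥ p with hβ
  by_cases h0 : w = 0
  · refine ⟨1, by simp, ?_, by simp⟩
    rw [Matrix.one_mulVec]
    exact sub_eq_zero.1 h0
  -- The equal lengths enter here. This identity is what makes the complex reflection `1 - β⁻¹ w wᴴ`
  -- unitary.
  have hsum : β + star β = star w ⬝ᵥ w := by
    have h1 : star β = star p ⬝ᵥ w := by
      rw [hβ, Matrix.star_dotProduct, star_star]
    rw [h1, hβ, hw]
    simp only [star_sub, sub_dotProduct, dotProduct_sub]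
    rw [hpq]; ring
  have hww : star w ⬝ᵥ w ≠ 0 := by
    rw [star_dotProduct_self, Ne, Complex.ofReal_eq_zero, sum_normSq_eq_zero]
    exact h0
  have hβ0 : β ≠ 0 := by
    intro h
    rw [h, star_zero, add_zero] at hsum
    exact hww hsum.symm
  have hβ0' : star β ≠ 0 := star_ne_zero.2 hβ0
  refine ⟨1 - β⁻¹ • Matrix.vecMulVec w (star w), ?_, ?_, ?_⟩
  · rw [Matrix.conjTranspose_sub, Matrix.conjTranspose_one, Matrix.conjTranspose_smul,
      Matrix.conjTranspose_vecMulVec, star_star, Matrix.sub_mul, Matrix.mul_sub, Matrix.mul_sub,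
      Matrix.smul_mul, Matrix.smul_mul, Matrix.mul_smul, Matrix.mul_smul,
      Matrix.vecMulVec_mul_vecMulVec, ← hsum]
    simp only [Matrix.mul_one, Matrix.one_mul, Matrix.vecMulVec_smul, star_inv₀]
    have : (star β)⁻¹ + β⁻¹ - β⁻¹ * ((star β)⁻¹ * (β + star β)) = 0 := by
      field_simp; ring
    rw [sub_sub, sub_eq_self, smul_smul, smul_smul, ← sub_smul, ← add_smul]
    convert zero_smul ℂ _ using 2
    rw [← this]; ring
  · rw [Matrix.sub_mulVec, Matrix.one_mulVec, Matrix.smul_mulVec, Matrix.vecMulVec_mulVec, ← hβ]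
    simp [hβ0, hw]
  · intro o ho
    rw [Matrix.sub_mulVec, Matrix.one_mulVec, Matrix.smul_mulVec, Matrix.vecMulVec_mulVec, ho]
    simp

lemma cartanDiag_mul_cartanDiag (t s : ℝ) :
    cartanDiag n t * cartanDiag n s = cartanDiag n (t + s) := by
  rw [cartanDiag, cartanDiag, Matrix.diagonal_mul_diagonal, cartanDiag]
  congr 1
  ext i
  split_ifs
  · rw [Real.exp_add]; push_cast; rfl
  · rw [neg_add, Real.exp_add]; push_cast; rfl
  · simp

lemma cartanDiag_zero : cartanDiag n 0 = 1 := by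
  simp [cartanDiag]

/-- `diag(e^t, 1, …, 1, e^{-t})` as an invertible matrix. -/
noncomputable def cartanGL (n : ℕ) (t : ℝ) : GL (Fin (n + 1)) ℂ :=
  ⟨cartanDiag n t, cartanDiag n (-t), by rw [cartanDiag_mul_cartanDiag, add_neg_cancel,
    cartanDiag_zero], by rw [cartanDiag_mul_cartanDiag, neg_add_cancel, cartanDiag_zero]⟩

lemma cartanGL_mem_U1 (hn : n ≠ 0) (t : ℝ) : cartanGL n t ∈ U1 n := by
  have h0 : (0 : Fin (n + 1)) ≠ Fin.last n := fun h => hn (by simpa [Fin.ext_iff] using h.symm)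
  rw [mem_U1_iff]
  change cartanDiag n t * hermMatrix n * (cartanDiag n t)ᴴ = _
  ext i j
  rw [cartanDiag, Matrix.diagonal_conjTranspose, Matrix.mul_diagonal, Matrix.diagonal_mul]
  simp only [hermMatrix, Matrix.of_apply]
  by_cases hij : Equiv.swap 0 (Fin.last n) i = j
  · subst hij
    have he : (Real.exp t : ℂ) * (Real.exp (-t) : ℂ) = 1 := by
      rw [← Complex.ofReal_mul, ← Real.exp_add]; simp
    have he' : (Real.exp (-t) : ℂ) * (Real.exp t : ℂ) = 1 := by rw [mul_comm, he]
    by_cases hi0 : i = 0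
    · subst hi0
      simpa [h0, h0.symm, ← Complex.ofReal_exp] using he
    · by_cases hi : i = Fin.last n
      · subst hi
        simpa [h0, h0.symm, ← Complex.ofReal_exp] using he'
      · simp [Equiv.swap_apply_of_ne_of_ne hi0 hi, hi0, hi]
  · simp [hij]

lemma cartanDiag_mulVec_originVec (hn : n ≠ 0) (t : ℝ) :
    cartanDiag n t *ᵥ originVec n
      = (Real.cosh t : ℂ) • originVec n + (Real.sinh t : ℂ) • axisVec n := by
  have h0 : (0 : Fin (n + 1)) ≠ Fin.last n := fun h => hn (by simpa [Fin.ext_iff] using h.symm)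
  ext i
  rw [cartanDiag, Matrix.mulVec_diagonal]
  simp only [originVec, axisVec, Pi.add_apply, Pi.sub_apply, Pi.smul_apply, smul_eq_mul,
    Pi.single_apply]
  by_cases hi0 : i = 0
  · subst hi0
    simp only [if_pos, if_neg h0]
    rw [← Real.cosh_add_sinh]; push_cast; ring
  · by_cases hi : i = Fin.last n
    · subst hi
      simp only [if_pos, if_neg h0.symm]
      rw [← Real.cosh_sub_sinh]; push_cast; ring
    · simp [hi0, hi]

lemma star_originVec : star (originVec n) = originVec n := by
  ext i
  simp only [originVec, Pi.star_apply, Pi.sub_apply, Pi.single_apply, star_sub]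
  split_ifs <;> simp

/-- The **Cartan decomposition** of `U(1, n)`. -/
theorem exists_cartan_decomposition (hn : n ≠ 0) {g : GL (Fin (n + 1)) ℂ} (hg : g ∈ U1 n) :
    ∃ k ∈ K n, ∃ k' ∈ K n, ∃ t : ℝ, 0 ≤ t ∧ g = k * cartanGL n t * k' := by
  have h0 : (0 : Fin (n + 1)) ≠ Fin.last n := fun h => hn (by simpa [Fin.ext_iff] using h.symm)
  set o := originVec n with ho
  set p := axisVec n with hp
  have hoo : o ⬝ᵥ o = 2 := by
    simp [ho, originVec, dotProduct_sub, h0, h0.symm]; norm_num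
  have hpp : star p ⬝ᵥ p = 2 := by
    simp [hp, axisVec, dotProduct_add, h0, h0.symm, star_add]
    norm_num
  have hop : o ⬝ᵥ p = 0 := by
    simp [ho, hp, originVec, axisVec, dotProduct_add, h0, h0.symm]
  have hso : star o = o := star_originVec
  have hform : ∀ z w, herm z w = star w ⬝ᵥ z - (o ⬝ᵥ z) * (star w ⬝ᵥ o) := by
    intro z w
    rw [herm, hermMatrix_eq hn, Matrix.sub_mulVec, Matrix.one_mulVec, dotProduct_sub,
      Matrix.vecMulVec_mulVec, star_originVec]
    simp [ho]
  have hoform : herm o o = -2 := by rw [hform, hso, hoo]; norm_num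
  -- It suffices to find `k ∈ K` and `t` such that `k a_t o` is `v = g o` up to a phase; the
  -- remaining factor then preserves the line of `o`, so it lies in `K`.
  set v := g.1 *ᵥ o with hv
  have hvv : herm v v = -2 := by rw [hv, herm_mulVec_U1 hg, hoform]
  set α := (o ⬝ᵥ v) / 2 with hα
  set u := v - α • o with hu
  have hvu : v = α • o + u := by rw [hu]; abel
  have hou : o ⬝ᵥ u = 0 := by
    rw [hu, dotProduct_sub, dotProduct_smul, hoo, hα]; simp
  have hstar : ∀ w, o ⬝ᵥ w = 0 → star w ⬝ᵥ o = 0 := fun w h => by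
    rw [← hso, Matrix.star_dotProduct_star, h, star_zero]
  have huo : star u ⬝ᵥ o = 0 := hstar u hou
  set s := ∑ i, Complex.normSq (u i) with hs
  have hs0 : 0 ≤ s := Finset.sum_nonneg fun i _ => Complex.normSq_nonneg _
  have huu : star u ⬝ᵥ u = (s : ℂ) := star_dotProduct_self u
  -- `⟨v, v⟩ = -2` becomes `cosh² t = 1 + sinh² t` for `cosh t = ‖α‖` and `sinh² t = s / 2`.
  have hαs : star α * α = 1 + (s : ℂ) / 2 := by
    rw [hform, hvu] at hvv
    simp only [star_add, star_smul, add_dotProduct, dotProduct_add, smul_dotProduct,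
      dotProduct_smul, hso, hoo, hou, huo, huu, smul_eq_mul] at hvv
    linear_combination (-1 / 2 : ℂ) * hvv
  have hαn : ‖α‖ ^ 2 = 1 + s / 2 := by
    have h1 : star α * α = ((‖α‖ ^ 2 : ℝ) : ℂ) := by
      rw [← Complex.normSq_eq_norm_sq, Complex.normSq_eq_conj_mul_self]; rfl
    rw [h1] at hαs
    exact_mod_cast hαs
  have hα0 : α ≠ 0 := by
    intro h
    rw [h] at hαn
    simp at hαn
    linarith
  have hαn0 : (‖α‖ : ℂ) ≠ 0 := by simpa using hα0
  set r := Real.sqrt (s / 2) with hr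
  have hr2 : r ^ 2 = s / 2 := Real.sq_sqrt (by linarith)
  set t := Real.arsinh r with ht
  have ht0 : 0 ≤ t := Real.arsinh_nonneg_iff.2 (Real.sqrt_nonneg _)
  have hsinh : Real.sinh t = r := Real.sinh_arsinh r
  have hcosh : Real.cosh t = ‖α‖ := by
    rw [ht, Real.cosh_arsinh, hr2, ← hαn, Real.sqrt_sq (norm_nonneg _)]
  -- The phase for which the component of `c • v` along `o` is the positive number `cosh t`.
  set c : ℂ := (‖α‖ : ℂ) / α with hc
  have hc0 : c ≠ 0 := div_ne_zero hαn0 hα0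
  have hcc : star c * c = 1 := by
    have h1 : star c * c = ((‖c‖ ^ 2 : ℝ) : ℂ) := by
      rw [← Complex.normSq_eq_norm_sq, Complex.normSq_eq_conj_mul_self]; rfl
    rw [h1, hc, norm_div]
    simp [hα0]
  -- `q` is the direction of `c • u`, scaled to the length of the axis vector `p`; if `u = 0` then
  -- `t = 0` and `p` itself serves.
  have hq : ∃ q : Fin (n + 1) → ℂ, star q ⬝ᵥ q = 2 ∧ star q ⬝ᵥ o = 0 ∧ (r : ℂ) • q = c • u := by
    by_cases hu0 : u = 0
    · refine ⟨p, hpp, ?_, ?_⟩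
      · exact hstar p hop
      · have : s = 0 := sum_normSq_eq_zero.2 hu0
        simp [hu0, hr, this]
    · have hsne : s ≠ 0 := fun h => hu0 (sum_normSq_eq_zero.1 h)
      have hr0 : r ≠ 0 := by
        intro h
        rw [h] at hr2
        apply hsne
        linarith
      have hr0' : (r : ℂ) ≠ 0 := by simpa using hr0
      have hr2' : (r : ℂ) * r = (s : ℂ) / 2 := by
        rw [← sq]; exact_mod_cast hr2
      refine ⟨((r : ℂ)⁻¹ * c) • u, ?_, ?_, ?_⟩
      · rw [star_smul, smul_dotProduct, dotProduct_smul, huu, star_mul', star_inv₀,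
          show star (r : ℂ) = r from Complex.conj_ofReal r]
        simp only [smul_eq_mul]
        calc (r : ℂ)⁻¹ * star c * ((r : ℂ)⁻¹ * c * s)
            = (star c * c) * ((r : ℂ) * r)⁻¹ * s := by rw [mul_inv]; ring
          _ = 2 := by
            rw [hcc, hr2']
            have : (s : ℂ) ≠ 0 := by simpa using hsne
            field_simp
      · rw [star_smul, smul_dotProduct, huo, smul_zero]
      · rw [smul_smul, mul_inv_cancel_left₀ hr0']
  obtain ⟨q, hqq, hqo, hrq⟩ := hq
  have hpo : star p ⬝ᵥ o = 0 := hstar p hop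
  obtain ⟨M, hM1, hM2, hM3⟩ := exists_unitary_mulVec_eq p q (hpp.trans hqq.symm)
  have hMo : M *ᵥ o = o := hM3 o (by rw [star_sub, sub_dotProduct, hpo, hqo, sub_zero])
  have hk := unitaryGL_mem_K hn hM1 hMo
  set k := unitaryGL M hM1 with hkdef
  have hkM : k.1 = M := rfl
  have hkat : (k * cartanGL n t).1 *ᵥ o = c • v := by
    rw [Units.val_mul, ← Matrix.mulVec_mulVec, hkM]
    change M *ᵥ (cartanDiag n t *ᵥ o) = _
    rw [cartanDiag_mulVec_originVec hn, Matrix.mulVec_add, Matrix.mulVec_smul, Matrix.mulVec_smul,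
      hMo, hM2, hcosh, hsinh, hrq, hvu, smul_add, smul_smul, hc, div_mul_cancel₀ _ hα0]
  set k' := (k * cartanGL n t)⁻¹ * g with hk'
  have hk'U : k' ∈ U1 n :=
    mul_mem (inv_mem (mul_mem hk.1 (cartanGL_mem_U1 hn t))) hg
  have hk'o : k'.1 *ᵥ o = c⁻¹ • o := by
    have h1 : v = c⁻¹ • ((k * cartanGL n t).1 *ᵥ o) := by
      rw [hkat, smul_smul, inv_mul_cancel₀ hc0, one_smul]
    rw [hk', Units.val_mul, ← Matrix.mulVec_mulVec, ← hv, h1, Matrix.mulVec_smul,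
      Matrix.mulVec_mulVec, ← Units.val_mul, inv_mul_cancel, Units.val_one, Matrix.one_mulVec]
  refine ⟨k, hk, k', mem_K_of_mulVec_originVec hn hk'U ?_ hk'o, t, ht0, ?_⟩
  · rw [star_inv₀, ← mul_inv, hcc, inv_one]
  · rw [hk']; group

end Cartan

/-! ### Calculus of sequences asymptotic to rank one matrices -/

section RankOneLimit

variable {k : ℕ}

/-- The matrices `g m` are asymptotic to large multiples of rank one matrices, which converge to
the matrix `z ↦ (a ⬝ᵥ z) • b`, up to a remainder which converges to `R`. -/
def RankOneLimit (g : ℕ → Matrix (Fin k) (Fin k) ℂ) (b a : Fin k → ℂ)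
    (R : Matrix (Fin k) (Fin k) ℂ) : Prop :=
  ∃ (l : ℕ → ℂ) (bs as : ℕ → Fin k → ℂ) (r : ℕ → Matrix (Fin k) (Fin k) ℂ),
    (∀ᶠ m in atTop, g m = l m • Matrix.vecMulVec (bs m) (as m) + r m) ∧
    Tendsto (fun m => ‖l m‖) atTop atTop ∧ Tendsto bs atTop (𝓝 b) ∧ Tendsto as atTop (𝓝 a) ∧
    Tendsto r atTop (𝓝 R)

variable {g g' : ℕ → Matrix (Fin k) (Fin k) ℂ} {b a b' a' : Fin k → ℂ}
  {R R' : Matrix (Fin k) (Fin k) ℂ}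

lemma Filter.Tendsto.matrix_mul {ι : Type*} {f : Filter ι} {k l p : ℕ}
    {u : ι → Matrix (Fin k) (Fin l) ℂ} {v : ι → Matrix (Fin l) (Fin p) ℂ}
    {A : Matrix (Fin k) (Fin l) ℂ} {B : Matrix (Fin l) (Fin p) ℂ} (hu : Tendsto u f (𝓝 A))
    (hv : Tendsto v f (𝓝 B)) : Tendsto (fun m => u m * v m) f (𝓝 (A * B)) := by
  refine tendsto_pi_nhds.2 fun i => tendsto_pi_nhds.2 fun j => ?_
  simp only [Matrix.mul_apply]
  exact tendsto_finsetSum _ fun x _ => (tendsto_pi_nhds.1 (tendsto_pi_nhds.1 hu i) x).mul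
    (tendsto_pi_nhds.1 (tendsto_pi_nhds.1 hv x) j)

lemma Filter.Tendsto.matrix_mulVec {ι : Type*} {f : Filter ι} {k l : ℕ}
    {u : ι → Matrix (Fin k) (Fin l) ℂ} {v : ι → Fin l → ℂ}
    {A : Matrix (Fin k) (Fin l) ℂ} {w : Fin l → ℂ} (hu : Tendsto u f (𝓝 A))
    (hv : Tendsto v f (𝓝 w)) : Tendsto (fun m => u m *ᵥ v m) f (𝓝 (A *ᵥ w)) := by
  refine tendsto_pi_nhds.2 fun i => ?_
  simp only [Matrix.mulVec, dotProduct]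
  exact tendsto_finsetSum _ fun x _ => (tendsto_pi_nhds.1 (tendsto_pi_nhds.1 hu i) x).mul
    (tendsto_pi_nhds.1 hv x)

lemma Filter.Tendsto.matrix_vecMul {ι : Type*} {f : Filter ι} {k l : ℕ}
    {u : ι → Matrix (Fin k) (Fin l) ℂ} {v : ι → Fin k → ℂ}
    {A : Matrix (Fin k) (Fin l) ℂ} {w : Fin k → ℂ} (hv : Tendsto v f (𝓝 w))
    (hu : Tendsto u f (𝓝 A)) : Tendsto (fun m => v m ᵥ* u m) f (𝓝 (w ᵥ* A)) := by
  refine tendsto_pi_nhds.2 fun i => ?_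
  simp only [Matrix.vecMul, dotProduct]
  exact tendsto_finsetSum _ fun x _ => (tendsto_pi_nhds.1 hv x).mul
    (tendsto_pi_nhds.1 (tendsto_pi_nhds.1 hu x) i)

lemma Filter.Tendsto.matrix_dotProduct {ι : Type*} {f : Filter ι} {k : ℕ}
    {u v : ι → Fin k → ℂ} {w z : Fin k → ℂ} (hu : Tendsto u f (𝓝 w))
    (hv : Tendsto v f (𝓝 z)) : Tendsto (fun m => u m ⬝ᵥ v m) f (𝓝 (w ⬝ᵥ z)) := by
  simp only [dotProduct]
  exact tendsto_finsetSum _ fun x _ => (tendsto_pi_nhds.1 hu x).mul (tendsto_pi_nhds.1 hv x)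

lemma Filter.Tendsto.matrix_vecMulVec {ι : Type*} {f : Filter ι} {k : ℕ}
    {u v : ι → Fin k → ℂ} {w z : Fin k → ℂ} (hu : Tendsto u f (𝓝 w))
    (hv : Tendsto v f (𝓝 z)) :
    Tendsto (fun m => Matrix.vecMulVec (u m) (v m)) f (𝓝 (Matrix.vecMulVec w z)) := by
  refine tendsto_pi_nhds.2 fun i => tendsto_pi_nhds.2 fun j => ?_
  simp only [Matrix.vecMulVec_apply]
  exact (tendsto_pi_nhds.1 hu i).mul (tendsto_pi_nhds.1 hv j)

lemma tendsto_inv_zero_of_norm {ι : Type*} {f : Filter ι} {l : ι → ℂ}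
    (hl : Tendsto (fun m => ‖l m‖) f atTop) : Tendsto (fun m => (l m)⁻¹) f (𝓝 0) := by
  rw [tendsto_zero_iff_norm_tendsto_zero]
  simpa only [norm_inv] using! tendsto_inv_atTop_zero.comp hl

lemma eventually_ne_zero_of_norm {ι : Type*} {f : Filter ι} {l : ι → ℂ}
    (hl : Tendsto (fun m => ‖l m‖) f atTop) : ∀ᶠ m in f, l m ≠ 0 := by
  filter_upwards [hl.eventually_gt_atTop 0] with m hm
  exact norm_pos_iff.1 hm

namespace RankOneLimit

lemma comp (h : RankOneLimit g b a R) {φ : ℕ → ℕ} (hφ : Tendsto φ atTop atTop) :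
    RankOneLimit (g ∘ φ) b a R := by
  obtain ⟨l, bs, as, r, h1, h2, h3, h4, h5⟩ := h
  exact ⟨l ∘ φ, bs ∘ φ, as ∘ φ, r ∘ φ, hφ.eventually h1, h2.comp hφ, h3.comp hφ, h4.comp hφ,
    h5.comp hφ⟩

/-- Multiplying out gives the large term `l l' (a ⬝ᵥ b') b a'ᵀ` and two cross terms of sizes `l` and
`l'`. Completing the product absorbs the cross terms into `b` and `a'`, as perturbations of orders
`1/l` and `1/l'`. The price is the rank one correction in the new remainder. -/
lemma mul (h : RankOneLimit g b a R) (h' : RankOneLimit g' b' a' R') (hab : a ⬝ᵥ b' ≠ 0) :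
    RankOneLimit (fun m => g m * g' m) b a'
      (R * R' - (a ⬝ᵥ b')⁻¹ • Matrix.vecMulVec (R *ᵥ b') (a ᵥ* R')) := by
  obtain ⟨l, bs, as, r, h1, h2, h3, h4, h5⟩ := h
  obtain ⟨l', bs', as', r', h1', h2', h3', h4', h5'⟩ := h'
  have hd := h4.matrix_dotProduct h3'
  have hdi := hd.inv₀ hab
  have hdn : Tendsto (fun m => ‖as m ⬝ᵥ bs' m‖) atTop (𝓝 ‖a ⬝ᵥ b'‖) := hd.norm
  have hpos : 0 < ‖a ⬝ᵥ b'‖ := norm_pos_iff.2 hab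
  refine ⟨fun m => l m * l' m * (as m ⬝ᵥ bs' m),
    fun m => bs m + ((l m)⁻¹ * (as m ⬝ᵥ bs' m)⁻¹) • (r m *ᵥ bs' m),
    fun m => as' m + ((l' m)⁻¹ * (as m ⬝ᵥ bs' m)⁻¹) • (as m ᵥ* r' m),
    fun m => r m * r' m -
      (as m ⬝ᵥ bs' m)⁻¹ • Matrix.vecMulVec (r m *ᵥ bs' m) (as m ᵥ* r' m), ?_, ?_, ?_, ?_, ?_⟩
  · filter_upwards [h1, h1', eventually_ne_zero_of_norm h2, eventually_ne_zero_of_norm h2',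
      hd.eventually_ne hab] with m e1 e2 n1 n2 n3
    rw [e1, e2]
    ext i j
    simp only [Matrix.add_mul, Matrix.mul_add, Matrix.smul_mul, Matrix.mul_smul,
      Matrix.mul_vecMulVec, Matrix.vecMulVec_mul, Matrix.add_mulVec, Matrix.smul_mulVec,
      Matrix.vecMulVec_mulVec, MulOpposite.smul_eq_mul_unop, MulOpposite.unop_op, Matrix.add_apply, Matrix.sub_apply, Matrix.smul_apply, Matrix.vecMulVec_apply,
      Pi.add_apply, Pi.smul_apply, smul_eq_mul]
    field_simp
    ring
  · simp only [norm_mul]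
    exact (h2.atTop_mul_atTop₀ h2').atTop_mul_pos hpos hdn
  · have := h3.add (((tendsto_inv_zero_of_norm h2).mul hdi).smul (h5.matrix_mulVec h3'))
    simpa using this
  · have := h4'.add (((tendsto_inv_zero_of_norm h2').mul hdi).smul (h4.matrix_vecMul h5'))
    simpa using this
  · exact (h5.matrix_mul h5').sub (hdi.smul ((h5.matrix_mulVec h3').matrix_vecMulVec
      (h4.matrix_vecMul h5')))

lemma mul_tendsto (h : RankOneLimit g b a R) {M : ℕ → Matrix (Fin k) (Fin k) ℂ}
    {N : Matrix (Fin k) (Fin k) ℂ} (hM : Tendsto M atTop (𝓝 N)) :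
    RankOneLimit (fun m => g m * M m) b (a ᵥ* N) (R * N) := by
  obtain ⟨l, bs, as, r, h1, h2, h3, h4, h5⟩ := h
  refine ⟨l, bs, fun m => as m ᵥ* M m, fun m => r m * M m, ?_, h2, h3, h4.matrix_vecMul hM,
    h5.matrix_mul hM⟩
  filter_upwards [h1] with m e1
  rw [e1, Matrix.add_mul, Matrix.smul_mul, Matrix.vecMulVec_mul]

lemma tendsto_mul (h : RankOneLimit g b a R) {M : ℕ → Matrix (Fin k) (Fin k) ℂ}
    {N : Matrix (Fin k) (Fin k) ℂ} (hM : Tendsto M atTop (𝓝 N)) :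
    RankOneLimit (fun m => M m * g m) (N *ᵥ b) a (N * R) := by
  obtain ⟨l, bs, as, r, h1, h2, h3, h4, h5⟩ := h
  refine ⟨l, fun m => M m *ᵥ bs m, as, fun m => M m * r m, ?_, h2, hM.matrix_mulVec h3, h4,
    hM.matrix_mul h5⟩
  filter_upwards [h1] with m e1
  rw [e1, Matrix.mul_add, Matrix.mul_smul, Matrix.mul_vecMulVec]

lemma scale (h : RankOneLimit g b a R) {c d : ℂ} (hc : c ≠ 0) (hd : d ≠ 0) :
    RankOneLimit g (c • b) (d • a) R := by
  obtain ⟨l, bs, as, r, h1, h2, h3, h4, h5⟩ := h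
  refine ⟨fun m => l m * (c * d)⁻¹, fun m => c • bs m, fun m => d • as m, r, ?_, ?_,
    h3.const_smul c, h4.const_smul d, h5⟩
  · filter_upwards [h1] with m e1
    rw [e1]
    ext i j
    simp only [Matrix.add_apply, Matrix.smul_apply, Matrix.vecMulVec_apply, Pi.smul_apply,
      smul_eq_mul]
    field_simp
  · simp only [norm_mul]
    exact h2.atTop_mul_const (norm_pos_iff.2 (inv_ne_zero (mul_ne_zero hc hd)))

/-- The remainder can be chosen to vanish on `b` and to have its range in the kernel of `a`. -/
lemma exists_normalized (h : RankOneLimit g b a R) (hab : a ⬝ᵥ b = 1) :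
    ∃ R', RankOneLimit g b a R' ∧ R' *ᵥ b = 0 ∧ a ᵥ* R' = 0 := by
  obtain ⟨l, bs, as, r, h1, h2, h3, h4, h5⟩ := h
  -- Terms `β aᵀ` and `b αᵀ` of the remainder can be moved into the large term by changing `b` and
  -- `a` by `l⁻¹ β` and `l⁻¹ α`. The multiple of `b` subtracted in `β` is already accounted for by
  -- `b αᵀ`, and makes `a ⬝ᵥ β = 0`.
  set α := a ᵥ* R with hα
  set β := R *ᵥ b - (α ⬝ᵥ b) • b with hβ
  have haβ : a ⬝ᵥ β = 0 := by
    rw [hβ, dotProduct_sub, dotProduct_smul, hab, Matrix.dotProduct_mulVec]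
    simp [hα]
  refine ⟨R - Matrix.vecMulVec β a - Matrix.vecMulVec b α, ⟨l, fun m => bs m + (l m)⁻¹ • β,
    fun m => as m + (l m)⁻¹ • α, fun m => r m - Matrix.vecMulVec β (as m)
      - Matrix.vecMulVec (bs m) α - (l m)⁻¹ • Matrix.vecMulVec β α, ?_, h2, ?_, ?_, ?_⟩, ?_, ?_⟩
  · filter_upwards [h1, eventually_ne_zero_of_norm h2] with m e1 n1
    rw [e1]
    ext i j
    simp only [Matrix.add_apply, Matrix.sub_apply, Matrix.smul_apply, Matrix.vecMulVec_apply,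
      Pi.add_apply, Pi.smul_apply, smul_eq_mul]
    field_simp
    ring
  · simpa using h3.add ((tendsto_inv_zero_of_norm h2).smul_const β)
  · simpa using h4.add ((tendsto_inv_zero_of_norm h2).smul_const α)
  · simpa using ((h5.sub (tendsto_const_nhds.matrix_vecMulVec h4)).sub
      (h3.matrix_vecMulVec tendsto_const_nhds)).sub
      ((tendsto_inv_zero_of_norm h2).smul_const (Matrix.vecMulVec β α))
  · rw [Matrix.sub_mulVec, Matrix.sub_mulVec, Matrix.vecMulVec_mulVec, Matrix.vecMulVec_mulVec, hab]
    simp [hβ]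
  · rw [Matrix.vecMul_sub, Matrix.vecMul_sub, Matrix.vecMul_vecMulVec, Matrix.vecMul_vecMulVec,
      haβ, hab]
    simp [hα]

/-- A diagonal argument. -/
lemma exists_diagonal {G : ℕ → ℕ → Matrix (Fin k) (Fin k) ℂ}
    {Rs : ℕ → Matrix (Fin k) (Fin k) ℂ} (h : ∀ j, RankOneLimit (G j) b a (Rs j))
    (hR : Tendsto Rs atTop (𝓝 R)) : ∃ φ : ℕ → ℕ, RankOneLimit (fun j => G j (φ j)) b a R := by
  choose l bs as r h1 h2 h3 h4 h5 using h
  -- From the `j`-th sequence take one term of scale at least `j` whose data are within `1 / (j +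
  -- 1)` of their limits.
  have hex : ∀ j : ℕ, ∃ m, G j m = l j m • Matrix.vecMulVec (bs j m) (as j m) + r j m ∧
      (j : ℝ) ≤ ‖l j m‖ ∧ dist (bs j m) b < ((j : ℝ) + 1)⁻¹ ∧ dist (as j m) a < ((j : ℝ) + 1)⁻¹ ∧
      ∀ p q, dist (r j m p q) (Rs j p q) < ((j : ℝ) + 1)⁻¹ := by
    intro j
    have hj : (0 : ℝ) < ((j : ℝ) + 1)⁻¹ := by positivity
    have e5 : ∀ᶠ m in atTop, ∀ p q, dist (r j m p q) (Rs j p q) < ((j : ℝ) + 1)⁻¹ := by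
      rw [eventually_all]; intro p
      rw [eventually_all]; intro q
      have := tendsto_pi_nhds.1 (tendsto_pi_nhds.1 (h5 j) p) q
      exact (Metric.tendsto_nhds.1 this) _ hj
    exact ((h1 j).and (((h2 j).eventually_ge_atTop _).and
      (((Metric.tendsto_nhds.1 (h3 j)) _ hj).and
        (((Metric.tendsto_nhds.1 (h4 j)) _ hj).and e5)))).exists
  choose φ e1 e2 e3 e4 e5 using hex
  have hz : Tendsto (fun j : ℕ => ((j : ℝ) + 1)⁻¹) atTop (𝓝 0) :=
    tendsto_inv_atTop_zero.comp (tendsto_natCast_atTop_atTop.atTop_add tendsto_const_nhds)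
  refine ⟨φ, fun j => l j (φ j), fun j => bs j (φ j), fun j => as j (φ j), fun j => r j (φ j),
    Eventually.of_forall e1, tendsto_atTop_mono e2 tendsto_natCast_atTop_atTop, ?_, ?_, ?_⟩
  · exact tendsto_iff_dist_tendsto_zero.2
      (squeeze_zero (fun _ => dist_nonneg) (fun j => (e3 j).le) hz)
  · exact tendsto_iff_dist_tendsto_zero.2
      (squeeze_zero (fun _ => dist_nonneg) (fun j => (e4 j).le) hz)
  · refine tendsto_pi_nhds.2 fun p => tendsto_pi_nhds.2 fun q => ?_
    have hRpq := tendsto_pi_nhds.1 (tendsto_pi_nhds.1 hR p) q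
    refine (tendsto_iff_dist_tendsto_zero.2 ?_ : Tendsto (fun j => r j (φ j) p q) atTop (𝓝 (R p q)))
    have h6 := hz.add (tendsto_iff_dist_tendsto_zero.1 hRpq)
    rw [add_zero] at h6
    exact squeeze_zero (fun _ => dist_nonneg)
      (fun j => (dist_triangle _ (Rs j p q) _).trans (add_le_add (e5 j p q).le le_rfl)) h6

end RankOneLimit

/-- The sum of the absolute values of the entries. -/
noncomputable def entrySum (M : Matrix (Fin k) (Fin k) ℂ) : ℝ := ∑ i, ∑ j, ‖M i j‖

lemma norm_le_entrySum (M : Matrix (Fin k) (Fin k) ℂ) (i j : Fin k) : ‖M i j‖ ≤ entrySum M := by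
  refine (Finset.single_le_sum (f := fun j => ‖M i j‖) (fun _ _ => norm_nonneg _)
    (Finset.mem_univ j)).trans ?_
  exact Finset.single_le_sum (f := fun i => ∑ j, ‖M i j‖)
    (fun _ _ => Finset.sum_nonneg fun _ _ => norm_nonneg _) (Finset.mem_univ i)

lemma RankOneLimit.tendsto_entrySum (h : RankOneLimit g b a R) (hb : b ≠ 0) (ha : a ≠ 0) :
    Tendsto (fun m => entrySum (g m)) atTop atTop := by
  obtain ⟨l, bs, as, r, h1, h2, h3, h4, h5⟩ := h
  obtain ⟨i, hi⟩ := Function.ne_iff.1 hb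
  obtain ⟨j, hj⟩ := Function.ne_iff.1 ha
  have hbi : Tendsto (fun m => bs m i) atTop (𝓝 (b i)) := tendsto_pi_nhds.1 h3 i
  have haj : Tendsto (fun m => as m j) atTop (𝓝 (a j)) := tendsto_pi_nhds.1 h4 j
  have hr : Tendsto (fun m => r m i j) atTop (𝓝 (R i j)) :=
    tendsto_pi_nhds.1 (tendsto_pi_nhds.1 h5 i) j
  have hpos : 0 < ‖b i * a j‖ := norm_pos_iff.2 (mul_ne_zero hi hj)
  have h6 : Tendsto (fun m => ‖l m‖ * ‖bs m i * as m j‖ + -‖r m i j‖) atTop atTop :=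
    (h2.atTop_mul_pos hpos (hbi.mul haj).norm).atTop_add hr.norm.neg
  refine tendsto_atTop_mono' _ ?_ h6
  filter_upwards [h1] with m e1
  refine le_trans ?_ (norm_le_entrySum _ i j)
  rw [e1, Matrix.add_apply, Matrix.smul_apply, Matrix.vecMulVec_apply, smul_eq_mul, ← norm_mul]
  have := norm_sub_le (l m * (bs m i * as m j) + r m i j) (r m i j)
  rw [add_sub_cancel_right] at this
  linarith

end RankOneLimit

/-! ### Divergent sequences in `U(1, n)` -/

section Sequences

variable {n : ℕ}

lemma Filter.Tendsto.matrix_conjTranspose {ι : Type*} {f : Filter ι} {k l : ℕ}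
    {u : ι → Matrix (Fin k) (Fin l) ℂ} {A : Matrix (Fin k) (Fin l) ℂ} (hu : Tendsto u f (𝓝 A)) :
    Tendsto (fun m => (u m)ᴴ) f (𝓝 Aᴴ) :=
  tendsto_pi_nhds.2 fun i => tendsto_pi_nhds.2 fun j =>
    (tendsto_pi_nhds.1 (tendsto_pi_nhds.1 hu j) i).star

/-- The element of `U(1, n)` given by a matrix which preserves the form. -/
noncomputable def hermGL (M : Matrix (Fin (n + 1)) (Fin (n + 1)) ℂ)
    (h : M * hermMatrix n * Mᴴ = hermMatrix n) : GL (Fin (n + 1)) ℂ :=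
  have h' : M * (hermMatrix n * Mᴴ * hermMatrix n) = 1 := by
    rw [← Matrix.mul_assoc, ← Matrix.mul_assoc, h, hermMatrix_mul_self]
  ⟨M, hermMatrix n * Mᴴ * hermMatrix n, h', mul_eq_one_comm.1 h'⟩

lemma tendsto_inv_of_U1 {ι : Type*} {f : Filter ι} {g : ι → GL (Fin (n + 1)) ℂ}
    {g0 : GL (Fin (n + 1)) ℂ} (hg : ∀ m, g m ∈ U1 n) (hg0 : g0 ∈ U1 n)
    (h : Tendsto (fun m => (g m).1) f (𝓝 g0.1)) :
    Tendsto (fun m => ((g m)⁻¹).1) f (𝓝 (g0⁻¹).1) := by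
  rw [coe_inv_of_mem_U1 hg0]
  simp only [fun m => coe_inv_of_mem_U1 (hg m)]
  exact (tendsto_const_nhds.matrix_mul h.matrix_conjTranspose).matrix_mul tendsto_const_nhds

/-- The topology of `GL` records a matrix together with its inverse; on `U(1, n)` convergence of the
entries alone suffices, as the inverse is the adjoint. -/
lemma tendsto_GL_of_U1 {ι : Type*} {f : Filter ι} {g : ι → GL (Fin (n + 1)) ℂ}
    {g0 : GL (Fin (n + 1)) ℂ} (hg : ∀ m, g m ∈ U1 n) (hg0 : g0 ∈ U1 n)
    (h : Tendsto (fun m => (g m).1) f (𝓝 g0.1)) : Tendsto g f (𝓝 g0) := by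
  rw [Units.isEmbedding_embedProduct.tendsto_nhds_iff]
  refine Tendsto.prodMk_nhds h ?_
  exact (MulOpposite.continuous_op.tendsto _).comp (tendsto_inv_of_U1 hg hg0 h)

/-- Bolzano–Weierstrass for the entries. The equation of `U(1, n)` is closed and itself forces the
limit to be invertible. -/
lemma exists_tendsto_of_entrySum_le {g : ℕ → GL (Fin (n + 1)) ℂ} (hg : ∀ m, g m ∈ U1 n) {C : ℝ}
    (hC : ∀ m, entrySum (g m).1 ≤ C) :
    ∃ φ : ℕ → ℕ, StrictMono φ ∧ ∃ g0 ∈ U1 n,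
      Tendsto (fun m => (g (φ m)).1) atTop (𝓝 (g0 : GL (Fin (n + 1)) ℂ).1) := by
  let u : ℕ → Fin (n + 1) → Fin (n + 1) → ℂ := fun m => (g m).1
  have hb : ∀ m, u m ∈ Metric.closedBall (0 : Fin (n + 1) → Fin (n + 1) → ℂ) C := fun m => by
    have hC0 : 0 ≤ C := (Finset.sum_nonneg fun _ _ =>
      Finset.sum_nonneg fun _ _ => norm_nonneg _).trans (hC m)
    rw [mem_closedBall_zero_iff, pi_norm_le_iff_of_nonneg hC0]
    intro i
    rw [pi_norm_le_iff_of_nonneg hC0]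
    exact fun j => (norm_le_entrySum (g m).1 i j).trans (hC m)
  obtain ⟨M, -, φ, hφ, hM⟩ := (isCompact_closedBall _ _).tendsto_subseq hb
  have hM' : Tendsto (fun m => (g (φ m)).1) atTop (𝓝 (Matrix.of M)) := hM
  have hU : Matrix.of M * hermMatrix n * (Matrix.of M)ᴴ = hermMatrix n := by
    refine tendsto_nhds_unique
      ((hM'.matrix_mul tendsto_const_nhds).matrix_mul hM'.matrix_conjTranspose) ?_
    refine tendsto_const_nhds.congr fun m => ?_
    exact (mem_U1_iff.1 (hg (φ m))).symm
  exact ⟨φ, hφ, hermGL (Matrix.of M) hU, hU, hM'⟩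

lemma norm_entry_le_of_mem_K {k : GL (Fin (n + 1)) ℂ} (hk : k ∈ K n) (i j : Fin (n + 1)) :
    ‖k.1 i j‖ ≤ 1 :=
  entry_norm_bound_of_unitary hk.2 i j

lemma exists_tendsto_of_mem_K {k : ℕ → GL (Fin (n + 1)) ℂ} (hk : ∀ m, k m ∈ K n) :
    ∃ φ : ℕ → ℕ, StrictMono φ ∧ ∃ κ ∈ K n, Tendsto (fun m => k (φ m)) atTop (𝓝 κ) := by
  obtain ⟨φ, hφ, κ, hκ, h⟩ := exists_tendsto_of_entrySum_le (fun m => (hk m).1)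
    (C := ∑ _i : Fin (n + 1), ∑ _j : Fin (n + 1), (1 : ℝ)) fun m =>
      Finset.sum_le_sum fun i _ => Finset.sum_le_sum fun j _ => norm_entry_le_of_mem_K (hk m) i j
  refine ⟨φ, hφ, κ, ⟨hκ, ?_⟩, tendsto_GL_of_U1 (fun m => (hk _).1) hκ h⟩
  rw [Matrix.mem_unitaryGroup_iff, Matrix.star_eq_conjTranspose]
  refine tendsto_nhds_unique (h.matrix_mul h.matrix_conjTranspose) ?_
  refine tendsto_const_nhds.congr fun m => ?_
  have := (hk (φ m)).2
  rw [Matrix.mem_unitaryGroup_iff, Matrix.star_eq_conjTranspose] at this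
  exact this.symm

lemma cartanDiag_eq (t : ℝ) : cartanDiag n t
    = (Real.exp t : ℂ) • Matrix.vecMulVec (Pi.single 0 1) (Pi.single 0 1)
      + Matrix.diagonal (fun i : Fin (n + 1) => if i = 0 then (0 : ℂ) else
        if i = Fin.last n then (Real.exp (-t) : ℂ) else 1) := by
  ext i j
  simp only [cartanDiag, Matrix.diagonal_apply, Matrix.add_apply, Matrix.smul_apply,
    Matrix.vecMulVec_apply, Pi.single_apply, smul_eq_mul]
  by_cases hij : i = j
  · subst hij
    by_cases hi : i = 0 <;> simp [hi]
  · by_cases hi : i = 0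
    · subst hi
      simp [hij, Ne.symm hij]
    · simp [hij, hi]

lemma rankOneLimit_cartanDiag {t : ℕ → ℝ} (ht : Tendsto t atTop atTop) :
    RankOneLimit (fun m => cartanDiag n (t m)) (Pi.single 0 1) (Pi.single 0 1)
      (Matrix.diagonal (fun i : Fin (n + 1) => if i = 0 then (0 : ℂ) else
        if i = Fin.last n then 0 else 1)) := by
  refine ⟨fun m => (Real.exp (t m) : ℂ), fun _ => Pi.single 0 1, fun _ => Pi.single 0 1, _,
    Eventually.of_forall fun m => cartanDiag_eq (t m), ?_, tendsto_const_nhds, tendsto_const_nhds,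
    ?_⟩
  · simp only [Complex.norm_real, Real.norm_eq_abs, Real.abs_exp]
    exact Real.tendsto_exp_atTop.comp ht
  · refine tendsto_pi_nhds.2 fun i => tendsto_pi_nhds.2 fun j => ?_
    simp only [Matrix.diagonal_apply]
    split_ifs
    · exact tendsto_const_nhds
    · have h1 : Tendsto (fun m => Real.exp (-t m)) atTop (𝓝 0) :=
        Real.tendsto_exp_neg_atTop_nhds_zero.comp ht
      exact_mod_cast (Complex.continuous_ofReal.tendsto 0).comp h1
    · exact tendsto_const_nhds
    · exact tendsto_const_nhds

lemma norm_cartanDiag_le {t : ℝ} (ht : 0 ≤ t) (i j : Fin (n + 1)) :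
    ‖cartanDiag n t i j‖ ≤ Real.exp t := by
  rw [cartanDiag, Matrix.diagonal_apply]
  split_ifs
  · simp
  · rw [Complex.norm_real, Real.norm_eq_abs, Real.abs_exp, Real.exp_le_exp]; linarith
  · simpa using ht
  · simpa using (Real.exp_pos t).le

/-- The compact factors have entries of modulus at most one, so only `t` can make a matrix large;
unboundedness of the matrices will force `t → ∞`. -/
lemma entrySum_cartan_le {k k' : GL (Fin (n + 1)) ℂ} (hk : k ∈ K n) (hk' : k' ∈ K n) {t : ℝ}
    (ht : 0 ≤ t) : entrySum (k.1 * cartanDiag n t * k'.1) ≤ ((n : ℝ) + 1) ^ 4 * Real.exp t := by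
  have hM : ∀ i j, ‖(k.1 * cartanDiag n t * k'.1) i j‖ ≤ ((n : ℝ) + 1) ^ 2 * Real.exp t := by
    intro i j
    have h1 : ∀ x, ‖(k.1 * cartanDiag n t) i x‖ ≤ ((n : ℝ) + 1) * Real.exp t := by
      intro x
      rw [Matrix.mul_apply]
      refine (norm_sum_le _ _).trans ?_
      refine (Finset.sum_le_card_nsmul _ _ (Real.exp t) fun y _ => ?_).trans (by simp)
      rw [norm_mul]
      exact (mul_le_of_le_one_left (norm_nonneg _) (norm_entry_le_of_mem_K hk _ _)).trans
        (norm_cartanDiag_le ht _ _)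
    rw [Matrix.mul_apply]
    refine (norm_sum_le _ _).trans ?_
    refine (Finset.sum_le_card_nsmul _ _ (((n : ℝ) + 1) * Real.exp t) fun y _ => ?_).trans ?_
    · rw [norm_mul]
      exact (mul_le_of_le_one_right (norm_nonneg _) (norm_entry_le_of_mem_K hk' _ _)).trans (h1 y)
    · simp; apply le_of_eq; ring
  calc entrySum (k.1 * cartanDiag n t * k'.1)
      ≤ ∑ _i : Fin (n + 1), ∑ _j : Fin (n + 1), ((n : ℝ) + 1) ^ 2 * Real.exp t :=
        Finset.sum_le_sum fun i _ => Finset.sum_le_sum fun j _ => hM i j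
    _ = _ := by simp; ring

lemma exists_smul_of_mk_eq {g g' : GL (Fin (n + 1)) ℂ} (hg : g ∈ U1 n) (hg' : g' ∈ U1 n)
    (h : Matrix.ProjGenLinGroup.mk g = Matrix.ProjGenLinGroup.mk g') :
    ∃ c : ℂ, ‖c‖ = 1 ∧ g'.1 = c • g.1 := by
  obtain ⟨u, hu⟩ := Matrix.ProjGenLinGroup.mk_eq_mk_iff.1 h
  have h1 : g'.1 = (u : ℂ) • g.1 := by
    rw [← hu, Units.val_mul]
    simp [← Matrix.smul_eq_mul_diagonal]
  refine ⟨u, ?_, h1⟩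
  have h2 := mem_U1_iff.1 hg'
  rw [h1, Matrix.conjTranspose_smul, Matrix.smul_mul, Matrix.smul_mul, Matrix.mul_smul, smul_smul,
    mem_U1_iff.1 hg] at h2
  -- The corner entry of the form is `1`, so the scalar has modulus one.
  have h3 := congrFun (congrFun h2 0) (Fin.last n)
  simp only [Matrix.smul_apply, hermMatrix, Matrix.of_apply, Equiv.swap_apply_left, if_true,
    smul_eq_mul, mul_one] at h3
  have h4 : ((‖(u : ℂ)‖ ^ 2 : ℝ) : ℂ) = 1 := by
    rw [← Complex.normSq_eq_norm_sq, Complex.normSq_eq_conj_mul_self, mul_comm]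
    exact h3
  have h5 : ‖(u : ℂ)‖ ^ 2 = 1 := by exact_mod_cast h4
  nlinarith [norm_nonneg (u : ℂ)]

lemma entrySum_eq_of_mk_eq {g g' : GL (Fin (n + 1)) ℂ} (hg : g ∈ U1 n) (hg' : g' ∈ U1 n)
    (h : Matrix.ProjGenLinGroup.mk g = Matrix.ProjGenLinGroup.mk g') :
    entrySum g.1 = entrySum g'.1 := by
  obtain ⟨c, hc, hgg⟩ := exists_smul_of_mk_eq hg hg' h
  rw [hgg, entrySum, entrySum]
  simp [hc]

/-- An unbounded sequence in `U(1, n)` has a subsequence which tends simply to infinity. -/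
theorem exists_subseq_tendsSimplyToInfinity (hn : n ≠ 0) {g : ℕ → GL (Fin (n + 1)) ℂ}
    (hg : ∀ m, g m ∈ U1 n) (hunb : Tendsto (fun m => entrySum (g m).1) atTop atTop) :
    ∃ φ : ℕ → ℕ, StrictMono φ ∧
      TendsSimplyToInfinity fun m => Matrix.ProjGenLinGroup.mk (g (φ m)) := by
  choose k hk k' hk' t ht hkak using fun m => exists_cartan_decomposition hn (hg m)
  have hkak' : ∀ m, (g m).1 = (k m).1 * cartanDiag n (t m) * (k' m).1 := fun m => by
    conv_lhs => rw [hkak m]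
    rfl
  obtain ⟨φ₁, hφ₁, κ, hκ, hlim⟩ := exists_tendsto_of_mem_K hk
  obtain ⟨φ₂, hφ₂, κ', hκ', hlim'⟩ := exists_tendsto_of_mem_K fun m => hk' (φ₁ m)
  have hunb' := hunb.comp (hφ₁.comp hφ₂).tendsto_atTop
  -- Elements of `U(1, n)` with the same projective class have the same `entrySum`. Making it
  -- strictly increasing along the subsequence therefore makes the transformations distinct.
  obtain ⟨φ₃, hφ₃, hmono⟩ := strictMono_subseq_of_tendsto_atTop hunb'
  have htt : Tendsto t atTop atTop := by
    have hC : (0 : ℝ) < ((n : ℝ) + 1) ^ 4 := by positivity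
    have h1 : Tendsto (fun m => Real.exp (t m)) atTop atTop := by
      refine tendsto_atTop_mono (fun m => ?_) (hunb.const_mul_atTop (inv_pos.2 hC))
      rw [inv_mul_le_iff₀ hC, hkak' m]
      exact entrySum_cartan_le (hk m) (hk' m) (ht m)
    simpa [Function.comp_def] using Real.tendsto_log_atTop.comp h1
  refine ⟨φ₁ ∘ φ₂ ∘ φ₃, hφ₁.comp (hφ₂.comp hφ₃), ?_, ?_⟩
  · intro i j hij
    exact hmono.injective (entrySum_eq_of_mk_eq (hg _) (hg _) hij)
  · refine ⟨fun m => g (φ₁ (φ₂ (φ₃ m))), fun m => k (φ₁ (φ₂ (φ₃ m))),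
      fun m => k' (φ₁ (φ₂ (φ₃ m))), fun m => t (φ₁ (φ₂ (φ₃ m))), κ, κ', fun m => rfl,
      fun m => hkak' _, fun m => ⟨hk _, hk' _, ht _⟩, hκ, hκ', ?_, ?_, ?_⟩
    · exact hlim.comp (hφ₂.comp hφ₃).tendsto_atTop
    · exact hlim'.comp hφ₃.tendsto_atTop
    · exact htt.comp (hφ₁.comp (hφ₂.comp hφ₃)).tendsto_atTop

/-- A sequence which tends simply to infinity is asymptotic to a sequence of rank one. -/
theorem exists_rankOneLimit_of_tendsSimplyToInfinity (hn : n ≠ 0) {γ : ℕ → PGL n}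
    (hγ : TendsSimplyToInfinity γ) :
    ∃ g : ℕ → GL (Fin (n + 1)) ℂ, (∀ m, g m ∈ U1 n ∧ γ m = Matrix.ProjGenLinGroup.mk (g m)) ∧
      ∃ (b c : Fin (n + 1) → ℂ) (R : Matrix (Fin (n + 1)) (Fin (n + 1)) ℂ),
        b ≠ 0 ∧ c ≠ 0 ∧ herm b b = 0 ∧ herm c c = 0 ∧
        RankOneLimit (fun m => (g m).1) b (dualVec c) R := by
  have h0 : (0 : Fin (n + 1)) ≠ Fin.last n := fun h => hn (by simpa [Fin.ext_iff] using h.symm)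
  obtain ⟨-, g, k, k', t, κ, κ', hγg, hkak, hk, hκ, hκ', hkl, hkl', ht⟩ := hγ
  have hgk : ∀ m, g m = k m * cartanGL n (t m) * k' m := fun m => Units.ext (hkak m)
  have hinj : ∀ (h : GL (Fin (n + 1)) ℂ) (v : Fin (n + 1) → ℂ), v ≠ 0 → h.1 *ᵥ v ≠ 0 := by
    intro h v hv h1
    apply hv
    have := congrArg (fun w => (h⁻¹).1 *ᵥ w) h1
    simpa [Matrix.mulVec_mulVec, ← Units.val_mul] using this
  have he0 : herm (Pi.single 0 1 : Fin (n + 1) → ℂ) (Pi.single 0 1) = 0 := by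
    rw [herm_apply]
    refine Finset.sum_eq_zero fun i _ => ?_
    by_cases hi : i = 0
    · subst hi; simp [h0.symm]
    · simp [hi]
  have hel : herm (Pi.single (Fin.last n) 1 : Fin (n + 1) → ℂ) (Pi.single (Fin.last n) 1) = 0 := by
    rw [herm_apply]
    refine Finset.sum_eq_zero fun i _ => ?_
    by_cases hi : i = Fin.last n
    · subst hi; simp [h0]
    · simp [hi]
  -- The large entry of the diagonal factor sits at the first basis vector, and the first coordinate
  -- is the functional `⟨·, w⟩` for the last basis vector `w`; the limit factors `κ` and `κ'` move
  -- these two null vectors.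
  refine ⟨g, fun m => ⟨?_, hγg m⟩, κ.1 *ᵥ Pi.single 0 1, (κ'⁻¹).1 *ᵥ Pi.single (Fin.last n) 1,
    κ.1 * Matrix.diagonal (fun i : Fin (n + 1) => if i = 0 then (0 : ℂ) else
      if i = Fin.last n then 0 else 1) * κ'.1, hinj _ _ (by simp), hinj _ _ (by simp), ?_, ?_, ?_⟩
  · rw [hgk]
    exact mul_mem (mul_mem (hk m).1.1 (cartanGL_mem_U1 hn _)) (hk m).2.1.1
  · rw [herm_mulVec_U1 hκ.1, he0]
  · rw [herm_mulVec_U1 (inv_mem hκ'.1), hel]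
  · have h1 := ((rankOneLimit_cartanDiag (n := n) ht).tendsto_mul
      ((Units.continuous_val.tendsto κ).comp hkl)).mul_tendsto
      ((Units.continuous_val.tendsto κ').comp hkl')
    have h2 : (Pi.single 0 1 : Fin (n + 1) → ℂ) ᵥ* κ'.1
        = dualVec ((κ'⁻¹).1 *ᵥ Pi.single (Fin.last n) 1) := by
      refine dotProduct_eq _ _ fun z => ?_
      rw [dualVec_dotProduct, ← herm_mulVec_U1_left hκ'.1, ← Matrix.dotProduct_mulVec, herm_apply,
        Finset.sum_eq_single (Fin.last n)]
      · simp
      · intro j _ hj; simp [hj]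
      · simp
    rw [← h2]
    have h3 : (fun m => (g m).1) = fun m =>
        ((fun u : GL (Fin (n + 1)) ℂ => u.1) ∘ k) m * cartanDiag n (t m) *
          ((fun u : GL (Fin (n + 1)) ℂ => u.1) ∘ k') m := funext hkak
    rw [h3]
    exact h1

/-- The adjoint of `z ↦ ⟨z, c⟩ b` is `z ↦ ⟨z, b⟩ c`, so inversion exchanges the attracting and the
repelling vector. -/
lemma RankOneLimit.inv {g : ℕ → GL (Fin (n + 1)) ℂ} {b c : Fin (n + 1) → ℂ}
    {R : Matrix (Fin (n + 1)) (Fin (n + 1)) ℂ} (hg : ∀ m, g m ∈ U1 n)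
    (h : RankOneLimit (fun m => (g m).1) b (dualVec c) R) :
    RankOneLimit (fun m => ((g m)⁻¹).1) c (dualVec b) (hermMatrix n * Rᴴ * hermMatrix n) := by
  obtain ⟨l, bs, as, r, h1, h2, h3, h4, h5⟩ := h
  have hH : ∀ v : Fin (n + 1) → ℂ, v ᵥ* hermMatrix n = hermMatrix n *ᵥ v := by
    intro v
    ext i
    rw [hermMatrix_mulVec]
    have : ∀ j, (Equiv.swap 0 (Fin.last n) j = i) ↔ (j = Equiv.swap 0 (Fin.last n) i) := by
      intro j
      constructor <;> rintro rfl <;> simp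
    simp [Matrix.vecMul, dotProduct, hermMatrix, this]
  refine ⟨fun m => star (l m), fun m => hermMatrix n *ᵥ star (as m), fun m => dualVec (bs m),
    fun m => hermMatrix n * (r m)ᴴ * hermMatrix n, ?_, ?_, ?_, ?_, ?_⟩
  · filter_upwards [h1] with m e1
    rw [coe_inv_of_mem_U1 (hg m), e1, Matrix.conjTranspose_add, Matrix.conjTranspose_smul,
      Matrix.conjTranspose_vecMulVec, Matrix.mul_add, Matrix.add_mul, Matrix.mul_smul,
      Matrix.smul_mul, Matrix.mul_vecMulVec, Matrix.vecMulVec_mul, hH, dualVec]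
  · simpa using h2
  · have h6 : hermMatrix n *ᵥ star (dualVec c) = c := by
      ext i
      rw [hermMatrix_mulVec]
      simp [dualVec_apply]
    have h7 := tendsto_const_nhds (x := hermMatrix n) |>.matrix_mulVec h4.star
    rwa [h6] at h7
  · exact tendsto_const_nhds (x := hermMatrix n) |>.matrix_mulVec h3.star
  · exact (tendsto_const_nhds.matrix_mul h5.matrix_conjTranspose).matrix_mul tendsto_const_nhds

end Sequences

/-! ### The topology of projective space -/

section ProjectiveSpace

variable {n : ℕ}

/-- The saturation of an open set of vectors is the union of its scalar multiples, which are open.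
-/
lemma isOpenQuotientMap_mk' :
    IsOpenQuotientMap (Projectivization.mk' ℂ : {v : Fin (n + 1) → ℂ // v ≠ 0} → CP n) := by
  have hq : IsQuotientMap (Projectivization.mk' ℂ : {v : Fin (n + 1) → ℂ // v ≠ 0} → CP n) :=
    isQuotientMap_quot_mk
  refine ⟨hq.surjective, hq.continuous, fun U hU => ?_⟩
  rw [← hq.isOpen_preimage]
  have h1 : Projectivization.mk' ℂ ⁻¹' (Projectivization.mk' ℂ '' U)
      = ⋃ c : ℂˣ, (fun v : {v : Fin (n + 1) → ℂ // v ≠ 0} =>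
          (⟨c • v.1, (smul_ne_zero_iff_ne c).2 v.2⟩ : {v : Fin (n + 1) → ℂ // v ≠ 0})) ⁻¹' U := by
    ext v
    simp only [mem_preimage, mem_image, mem_iUnion]
    constructor
    · rintro ⟨w, hw, h⟩
      obtain ⟨c, hc⟩ := (Projectivization.mk_eq_mk_iff ℂ _ _ w.2 v.2).1 h
      refine ⟨c, ?_⟩
      have : (⟨c • v.1, (smul_ne_zero_iff_ne c).2 v.2⟩ : {v : Fin (n + 1) → ℂ // v ≠ 0}) = w :=
        Subtype.ext hc
      rwa [this]
    · rintro ⟨c, hc⟩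
      exact ⟨_, hc, (Projectivization.mk_eq_mk_iff ℂ _ _ _ v.2).2 ⟨c, rfl⟩⟩
  rw [h1]
  refine isOpen_iUnion fun c => hU.preimage ?_
  exact (continuous_subtype_val.const_smul c).subtype_mk _

/-- The point of projective space spanned by a vector (a junk value for the zero vector). -/
noncomputable def pt (v : Fin (n + 1) → ℂ) : CP n :=
  open scoped Classical in
  if h : v ≠ 0 then Projectivization.mk ℂ v h else
    Projectivization.mk ℂ (Pi.single 0 1) (by simp)

lemma pt_of_ne {v : Fin (n + 1) → ℂ} (h : v ≠ 0) : pt v = Projectivization.mk ℂ v h := dif_pos h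

lemma pt_rep (p : CP n) : pt p.rep = p := by rw [pt_of_ne p.rep_nonzero, Projectivization.mk_rep]

lemma pt_smul {c : ℂ} (hc : c ≠ 0) {v : Fin (n + 1) → ℂ} (hv : v ≠ 0) : pt (c • v) = pt v := by
  rw [pt_of_ne hv, pt_of_ne (smul_ne_zero hc hv), Projectivization.mk_eq_mk_iff']
  exact ⟨c, rfl⟩

lemma exists_smul_of_pt_eq {v w : Fin (n + 1) → ℂ} (hv : v ≠ 0) (hw : w ≠ 0) (h : pt v = pt w) :
    ∃ c : ℂ, c ≠ 0 ∧ w = c • v := by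
  rw [pt_of_ne hv, pt_of_ne hw] at h
  obtain ⟨c, hc⟩ := (Projectivization.mk_eq_mk_iff ℂ _ _ hw hv).1 h.symm
  exact ⟨c, c.ne_zero, hc.symm⟩

lemma exists_rep_pt {v : Fin (n + 1) → ℂ} (hv : v ≠ 0) : ∃ c : ℂ, c ≠ 0 ∧ (pt v).rep = c • v :=
  exists_smul_of_pt_eq hv (Projectivization.rep_nonzero _) (pt_rep _).symm

lemma submodule_pt {v : Fin (n + 1) → ℂ} (hv : v ≠ 0) :
    (pt v).submodule = Submodule.span ℂ {v} := by
  rw [pt_of_ne hv, Projectivization.submodule_mk]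

lemma mulVec_ne_zero_of_GL (g : GL (Fin (n + 1)) ℂ) {v : Fin (n + 1) → ℂ} (hv : v ≠ 0) :
    g.1 *ᵥ v ≠ 0 := by
  intro h1
  apply hv
  have := congrArg (fun w => (g⁻¹).1 *ᵥ w) h1
  simpa [Matrix.mulVec_mulVec, ← Units.val_mul] using this

lemma mk_smul_pt (g : GL (Fin (n + 1)) ℂ) {v : Fin (n + 1) → ℂ} (hv : v ≠ 0) :
    (Matrix.ProjGenLinGroup.mk g : PGL n) • pt v = pt (g.1 *ᵥ v) := by
  rw [pt_of_ne hv, pt_of_ne (mulVec_ne_zero_of_GL g hv)]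
  exact Projectivization.PGL.mk_smul_mk g hv

lemma map_nhds_pt {v : Fin (n + 1) → ℂ} (hv : v ≠ 0) : map pt (𝓝 v) = 𝓝 (pt v) := by
  have hopen : IsOpen {v : Fin (n + 1) → ℂ | v ≠ 0} := isOpen_ne
  have h1 : 𝓝 v = map Subtype.val (𝓝 (⟨v, hv⟩ : {v : Fin (n + 1) → ℂ // v ≠ 0})) :=
    (hopen.isOpenEmbedding_subtypeVal.map_nhds_eq ⟨v, hv⟩).symm
  have h2 : pt ∘ (Subtype.val : {v : Fin (n + 1) → ℂ // v ≠ 0} → _) = Projectivization.mk' ℂ := by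
    ext w
    exact pt_of_ne w.2
  rw [h1, map_map, h2, isOpenQuotientMap_mk'.map_nhds_eq, pt_of_ne hv]
  rfl

lemma continuousAt_pt {v : Fin (n + 1) → ℂ} (hv : v ≠ 0) : ContinuousAt pt v :=
  (map_nhds_pt hv).le

/-- A local section of `pt`. -/
lemma exists_section {v : Fin (n + 1) → ℂ} (hv : v ≠ 0) :
    ∃ s : CP n → Fin (n + 1) → ℂ, Tendsto s (𝓝 (pt v)) (𝓝 v) ∧
      ∀ᶠ p in 𝓝 (pt v), s p ≠ 0 ∧ pt (s p) = p := by
  obtain ⟨i, hi⟩ := Function.ne_iff.1 hv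
  have hi : v i ≠ 0 := hi
  let s : CP n → Fin (n + 1) → ℂ := fun p => (v i / p.rep i) • p.rep
  have hs : Tendsto s (𝓝 (pt v)) (𝓝 v) := by
    rw [← map_nhds_pt hv, tendsto_map'_iff]
    have h1 : ContinuousAt (fun w : Fin (n + 1) → ℂ => (v i / w i) • w) v :=
      (continuousAt_const.div (continuous_apply i).continuousAt hi).smul continuousAt_id
    have h2 : Tendsto (fun w : Fin (n + 1) → ℂ => (v i / w i) • w) (𝓝 v) (𝓝 v) := by
      have := h1.tendsto
      simpa [hi] using this
    refine h2.congr' ?_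
    filter_upwards [(continuous_apply i).continuousAt.eventually_ne hi] with w hw
    have hw0 : w ≠ 0 := by rintro rfl; exact hw rfl
    obtain ⟨c, hc, hr⟩ := exists_rep_pt hw0
    simp only [s, Function.comp_apply, hr, Pi.smul_apply, smul_eq_mul, smul_smul]
    congr 1
    field_simp
  refine ⟨s, hs, ?_⟩
  have h3 : Tendsto (fun p => s p i) (𝓝 (pt v)) (𝓝 (v i)) := tendsto_pi_nhds.1 hs i
  filter_upwards [h3.eventually_ne hi] with p hp
  have h4 : v i / p.rep i ≠ 0 := by
    intro h; simp [s, h] at hp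
  exact ⟨smul_ne_zero h4 p.rep_nonzero, by rw [pt_smul h4 p.rep_nonzero, pt_rep]⟩

/-- The orthogonal projection to the line spanned by a vector. -/
noncomputable def projMatrix {k : ℕ} (v : Fin k → ℂ) : Fin k → Fin k → ℂ :=
  fun i j => v i * star (v j) / ((∑ x, Complex.normSq (v x) : ℝ) : ℂ)

lemma projMatrix_smul {k : ℕ} {c : ℂ} (hc : c ≠ 0) (v : Fin k → ℂ) :
    projMatrix (c • v) = projMatrix v := by
  ext i j
  have h1 : ((∑ x, Complex.normSq (c * v x) : ℝ) : ℂ)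
      = (star c * c) * ((∑ x, Complex.normSq (v x) : ℝ) : ℂ) := by
    rw [show star c * c = (Complex.normSq c : ℂ) from (Complex.normSq_eq_conj_mul_self).symm]
    simp [Finset.mul_sum]
  have h2 : star c ≠ 0 := star_ne_zero.2 hc
  simp only [projMatrix, Pi.smul_apply, smul_eq_mul, star_mul']
  rw [h1, show c * v i * (star c * star (v j)) = (star c * c) * (v i * star (v j)) by ring,
    mul_div_mul_left _ _ (mul_ne_zero h2 hc)]

lemma exists_smul_of_projMatrix_eq {k : ℕ} {v w : Fin k → ℂ} (hv : v ≠ 0)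
    (h : projMatrix v = projMatrix w) : ∃ c : ℂ, v = c • w := by
  obtain ⟨j, hj⟩ := Function.ne_iff.1 hv
  have hj' : star (v j) ≠ 0 := star_ne_zero.2 hj
  have hN : ((∑ x, Complex.normSq (v x) : ℝ) : ℂ) ≠ 0 := by
    rw [Ne, Complex.ofReal_eq_zero, sum_normSq_eq_zero]
    exact hv
  refine ⟨star (w j) / ((∑ x, Complex.normSq (w x) : ℝ) : ℂ) *
    ((∑ x, Complex.normSq (v x) : ℝ) : ℂ) / star (v j), ?_⟩
  ext i
  have h1 := congrFun (congrFun h i) j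
  simp only [projMatrix] at h1
  rw [div_eq_iff hN] at h1
  rw [Pi.smul_apply, smul_eq_mul, div_mul_eq_mul_div, eq_div_iff hj', h1]
  ring

lemma continuousAt_projMatrix {k : ℕ} {v : Fin k → ℂ} (hv : v ≠ 0) :
    ContinuousAt projMatrix v := by
  have hN : ((∑ x, Complex.normSq (v x) : ℝ) : ℂ) ≠ 0 := by
    rw [Ne, Complex.ofReal_eq_zero, sum_normSq_eq_zero]
    exact hv
  refine continuousAt_pi.2 fun i => continuousAt_pi.2 fun j => ?_
  refine ContinuousAt.div ?_ ?_ hN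
  · fun_prop
  · refine Continuous.continuousAt ?_
    exact Complex.continuous_ofReal.comp (continuous_finsetSum _ fun x _ =>
      Complex.continuous_normSq.comp (continuous_apply x))

/-- The orthogonal projection onto a line determines the line and depends continuously on it. -/
instance : T2Space (CP n) := by
  let f : CP n → Fin (n + 1) → Fin (n + 1) → ℂ := fun p => projMatrix p.rep
  have hf : ∀ v : Fin (n + 1) → ℂ, v ≠ 0 → f (pt v) = projMatrix v := fun v hv => by
    obtain ⟨c, hc, hr⟩ := exists_rep_pt hv
    simp only [f, hr, projMatrix_smul hc]
  refine T2Space.of_injective_continuous (f := f) ?_ ?_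
  · intro p q hpq
    obtain ⟨c, hc⟩ := exists_smul_of_projMatrix_eq p.rep_nonzero hpq
    have hc0 : c ≠ 0 := by
      rintro rfl
      exact p.rep_nonzero (by simpa using hc)
    rw [← pt_rep p, ← pt_rep q, hc, pt_smul hc0 q.rep_nonzero]
  · rw [continuous_iff_continuousAt]
    intro p
    rw [← pt_rep p, ContinuousAt, hf _ p.rep_nonzero, ← map_nhds_pt p.rep_nonzero,
      tendsto_map'_iff]
    refine (continuousAt_projMatrix p.rep_nonzero).tendsto.congr' ?_
    filter_upwards [isOpen_ne.mem_nhds p.rep_nonzero] with v hv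
    exact (hf v hv).symm

end ProjectiveSpace

/-! ### Dynamics of rank one limits on projective space -/

section Dynamics

variable {n : ℕ}

lemma submodule_le_perp_iff {z : CP n} {c : Fin (n + 1) → ℂ} (hc : c ≠ 0) :
    z.submodule ≤ perp (pt c) ↔ herm z.rep c = 0 := by
  rw [submodule_le_iff, mem_perp]
  obtain ⟨d, hd, hr⟩ := exists_rep_pt hc
  rw [hr, herm_smul_right]
  simp [hd]

/-- Divided by `l m`, the image of a vector near `z` tends to `(a ⬝ᵥ z) • b`. Convergence is joint
in the index and the point, which is what gives uniformity on compact sets. -/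
lemma RankOneLimit.tendsto_pt {g : ℕ → GL (Fin (n + 1)) ℂ} {b a z : Fin (n + 1) → ℂ}
    {R : Matrix (Fin (n + 1)) (Fin (n + 1)) ℂ} (h : RankOneLimit (fun m => (g m).1) b a R)
    (hb : b ≠ 0) (hz : z ≠ 0) (haz : a ⬝ᵥ z ≠ 0) :
    Tendsto (fun q : ℕ × CP n => (Matrix.ProjGenLinGroup.mk (g q.1) : PGL n) • q.2)
      (atTop ×ˢ 𝓝 (pt z)) (𝓝 (pt b)) := by
  obtain ⟨l, bs, as, r, h1, h2, h3, h4, h5⟩ := h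
  obtain ⟨s, hs, hs'⟩ := exists_section hz
  have hs2 : Tendsto (fun q : ℕ × CP n => s q.2) (atTop ×ˢ 𝓝 (pt z)) (𝓝 z) := hs.comp tendsto_snd
  have h2' := h2.comp (tendsto_fst (f := (atTop : Filter ℕ)) (g := 𝓝 (pt z)))
  have h3' := h3.comp (tendsto_fst (f := (atTop : Filter ℕ)) (g := 𝓝 (pt z)))
  have h4' := h4.comp (tendsto_fst (f := (atTop : Filter ℕ)) (g := 𝓝 (pt z)))
  have h5' := h5.comp (tendsto_fst (f := (atTop : Filter ℕ)) (g := 𝓝 (pt z)))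
  have hlim : Tendsto (fun q : ℕ × CP n => (as q.1 ⬝ᵥ s q.2) • bs q.1
      + (l q.1)⁻¹ • (r q.1 *ᵥ s q.2)) (atTop ×ˢ 𝓝 (pt z)) (𝓝 ((a ⬝ᵥ z) • b)) := by
    have := ((h4'.matrix_dotProduct hs2).smul h3').add
      ((tendsto_inv_zero_of_norm h2').smul (h5'.matrix_mulVec hs2))
    simpa using! this
  have hne : (a ⬝ᵥ z) • b ≠ 0 := smul_ne_zero haz hb
  rw [← pt_smul haz hb]
  refine ((continuousAt_pt hne).tendsto.comp hlim).congr' ?_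
  filter_upwards [tendsto_fst.eventually h1, tendsto_snd.eventually hs',
    eventually_ne_zero_of_norm h2'] with q e1 e2 e3
  have e3 : l q.1 ≠ 0 := e3
  have e4 : (g q.1).1 *ᵥ s q.2 = l q.1 • ((as q.1 ⬝ᵥ s q.2) • bs q.1
      + (l q.1)⁻¹ • (r q.1 *ᵥ s q.2)) := by
    rw [e1, Matrix.add_mulVec, Matrix.smul_mulVec, Matrix.vecMulVec_mulVec, smul_add, smul_smul _ _ (r q.1 *ᵥ s q.2),
      mul_inv_cancel₀ e3, one_smul, op_smul_eq_smul]
  have e5 := mulVec_ne_zero_of_GL (g q.1) e2.1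
  conv_rhs => rw [← e2.2]
  rw [mk_smul_pt _ e2.1, e4, pt_smul e3, Function.comp_apply]
  rw [e4] at e5
  exact (smul_ne_zero_iff.1 e5).2

lemma RankOneLimit.convergesUniformlyOnCompacts {g : ℕ → GL (Fin (n + 1)) ℂ}
    {b c : Fin (n + 1) → ℂ} {R : Matrix (Fin (n + 1)) (Fin (n + 1)) ℂ}
    (h : RankOneLimit (fun m => (g m).1) b (dualVec c) R) (hb : b ≠ 0) (hc : c ≠ 0) :
    ConvergesUniformlyOnCompacts (fun m => Matrix.ProjGenLinGroup.mk (g m))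
      {z | ¬ z.submodule ≤ perp (pt c)} (pt b) := by
  intro C hC hCU V hV
  have hP : ∀ z ∈ C, {q : ℕ × CP n | (Matrix.ProjGenLinGroup.mk (g q.1) : PGL n) • q.2 ∈ V}
      ∈ (atTop : Filter ℕ) ×ˢ 𝓝 z := by
    intro z hz
    have h1 := hCU hz
    rw [mem_ofPred_eq, submodule_le_perp_iff hc] at h1
    have h2 := h.tendsto_pt hb z.rep_nonzero (by rwa [dualVec_dotProduct])
    rw [pt_rep] at h2
    exact h2 hV
  have h3 := hC.mem_prod_nhdsSet_of_forall hP
  obtain ⟨S, hS, W, hW, hSW⟩ := mem_prod_iff.1 h3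
  filter_upwards [hS] with m hm z hz
  exact hSW (mk_mem_prod hm (subset_of_mem_nhdsSet hW hz))

/-- Limits of combinations of two vectors with independent limits. -/
lemma mem_span_of_tendsto {ι : Type*} {f : Filter ι} [f.NeBot] {b d z : ι → Fin (n + 1) → ℂ}
    {X D ζ a e : Fin (n + 1) → ℂ} (hb : Tendsto b f (𝓝 X)) (hd : Tendsto d f (𝓝 D))
    (hz : Tendsto z f (𝓝 ζ)) (haX : a ⬝ᵥ X = 1) (haD : a ⬝ᵥ D = 0) (heX : e ⬝ᵥ X = 0)
    (heD : e ⬝ᵥ D = 1) (h : ∀ᶠ m in f, ∃ α β : ℂ, z m = α • b m + β • d m) :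
    ζ ∈ Submodule.span ℂ {X, D} := by
  have hab := (tendsto_const_nhds (x := a)).matrix_dotProduct hb
  have had := (tendsto_const_nhds (x := a)).matrix_dotProduct hd
  have haz := (tendsto_const_nhds (x := a)).matrix_dotProduct hz
  have heb := (tendsto_const_nhds (x := e)).matrix_dotProduct hb
  have hed := (tendsto_const_nhds (x := e)).matrix_dotProduct hd
  have hez := (tendsto_const_nhds (x := e)).matrix_dotProduct hz
  -- The functionals `a`, `e` are dual to `X`, `D`. By Cramer's rule they recover the two
  -- coefficients of `z m`, which therefore converge.
  have hΔ := (hab.mul hed).sub (had.mul heb)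
  rw [haX, heD, haD, heX, mul_one, mul_zero, sub_zero] at hΔ
  have hα := ((haz.mul hed).sub (hez.mul had)).div hΔ one_ne_zero
  have hβ := ((hab.mul hez).sub (heb.mul haz)).div hΔ one_ne_zero
  have hlim := (hα.smul hb).add (hβ.smul hd)
  have heq : ζ = _ := tendsto_nhds_unique hz (hlim.congr' ?_)
  · rw [heq, Submodule.mem_span_pair]
    exact ⟨_, _, rfl⟩
  · filter_upwards [h, hΔ.eventually_ne one_ne_zero] with m hm hne
    obtain ⟨α, β, hm⟩ := hm
    have e1 : a ⬝ᵥ z m = α * (a ⬝ᵥ b m) + β * (a ⬝ᵥ d m) := by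
      rw [hm, dotProduct_add, dotProduct_smul, dotProduct_smul]; rfl
    have e2 : e ⬝ᵥ z m = α * (e ⬝ᵥ b m) + β * (e ⬝ᵥ d m) := by
      rw [hm, dotProduct_add, dotProduct_smul, dotProduct_smul]; rfl
    have e3 : ((a ⬝ᵥ z m) * (e ⬝ᵥ d m) - (e ⬝ᵥ z m) * (a ⬝ᵥ d m)) /
        ((a ⬝ᵥ b m) * (e ⬝ᵥ d m) - (a ⬝ᵥ d m) * (e ⬝ᵥ b m)) = α := by
      rw [div_eq_iff hne, e1, e2]; ring
    have e4 : ((a ⬝ᵥ b m) * (e ⬝ᵥ z m) - (e ⬝ᵥ b m) * (a ⬝ᵥ z m)) /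
        ((a ⬝ᵥ b m) * (e ⬝ᵥ d m) - (a ⬝ᵥ d m) * (e ⬝ᵥ b m)) = β := by
      rw [div_eq_iff hne, e1, e2]; ring
    simp only [Pi.div_apply]
    rw [e3, e4, hm]

/-- Images of vectors near `w` are combinations of `bs m → X` and `r m *ᵥ s (u m) → R w`, so a
cluster point lies in the span of `X` and `R w`. The functional `e` witnesses that these two are
independent. -/
lemma RankOneLimit.dynSet_subset {g : ℕ → GL (Fin (n + 1)) ℂ} {X a w e : Fin (n + 1) → ℂ}
    {R : Matrix (Fin (n + 1)) (Fin (n + 1)) ℂ} (h : RankOneLimit (fun m => (g m).1) X a R)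
    (haX : a ⬝ᵥ X = 1) (hw : w ≠ 0) (haD : a ⬝ᵥ (R *ᵥ w) = 0)
    (heX : e ⬝ᵥ X = 0) (heD : e ⬝ᵥ (R *ᵥ w) = 1) :
    dynSet (fun m => Matrix.ProjGenLinGroup.mk (g m)) (pt w)
      ⊆ {z : CP n | z.submodule ≤ Submodule.span ℂ {X, R *ᵥ w}} := by
  obtain ⟨l, bs, as, r, h1, h2, h3, h4, h5⟩ := h
  rintro z ⟨u, hu, hz⟩
  obtain ⟨U, hU, hUz⟩ := mapClusterPt_iff_ultrafilter.1 hz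
  obtain ⟨s, hs, hs'⟩ := exists_section hw
  obtain ⟨s₂, hs₂, hs₂'⟩ := exists_section z.rep_nonzero
  rw [pt_rep] at hs₂ hs₂'
  rw [mem_ofPred_eq, submodule_le_iff]
  have hsu : Tendsto (fun m => s (u m)) U (𝓝 w) := (hs.comp hu).mono_left hU
  refine mem_span_of_tendsto (h3.mono_left hU) ((h5.mono_left hU).matrix_mulVec hsu)
    (hs₂.comp hUz) haX haD heX heD ?_
  filter_upwards [hU h1, (hu.mono_left hU).eventually hs', hUz.eventually hs₂'] with m e1 e2 e3
  have e4 : pt ((g m).1 *ᵥ s (u m)) = pt (s₂ (Matrix.ProjGenLinGroup.mk (g m) • u m)) := by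
    rw [e3.2, ← mk_smul_pt _ e2.1, e2.2]
  obtain ⟨c, -, hc⟩ := exists_smul_of_pt_eq (mulVec_ne_zero_of_GL _ e2.1) e3.1 e4
  refine ⟨c * (l m * (as m ⬝ᵥ s (u m))), c, ?_⟩
  have e1 : (g m).1 = _ := e1
  rw [Function.comp_apply, hc, e1, Matrix.add_mulVec, Matrix.smul_mulVec, Matrix.vecMulVec_mulVec,
    op_smul_eq_smul, smul_add, smul_smul, smul_smul, mul_assoc]

lemma RankOneLimit.subset_dynSet {g : ℕ → GL (Fin (n + 1)) ℂ} {X a w : Fin (n + 1) → ℂ}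
    {R : Matrix (Fin (n + 1)) (Fin (n + 1)) ℂ} (h : RankOneLimit (fun m => (g m).1) X a R)
    (haX : a ⬝ᵥ X = 1) (hw : w ≠ 0) (haw : a ⬝ᵥ w = 0) :
    {z : CP n | z.submodule ≤ Submodule.span ℂ {X, R *ᵥ w}}
      ⊆ dynSet (fun m => Matrix.ProjGenLinGroup.mk (g m)) (pt w) := by
  obtain ⟨l, bs, as, r, h1, h2, h3, h4, h5⟩ := h
  intro z hz
  have hX0 : X ≠ 0 := by rintro rfl; simp at haX
  have haX' := h4.matrix_dotProduct (tendsto_const_nhds (x := X))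
  have haw' := h4.matrix_dotProduct (tendsto_const_nhds (x := w))
  rw [haX] at haX'
  rw [haw] at haw'
  -- Adding to `w` a small multiple of `X` prescribes the value of the large functional: the rank
  -- one term becomes exactly `σ m • bs m`, for any `σ` of smaller order than `l`.
  have key : ∀ σ : ℕ → ℂ, Tendsto (fun m => σ m * (l m)⁻¹) atTop (𝓝 0) →
      ∃ y : ℕ → Fin (n + 1) → ℂ, Tendsto y atTop (𝓝 w) ∧
        ∀ᶠ m in atTop, (g m).1 *ᵥ y m = σ m • bs m + r m *ᵥ y m := by
    intro σ hσ
    refine ⟨fun m => w + ((σ m * (l m)⁻¹ - as m ⬝ᵥ w) / (as m ⬝ᵥ X)) • X, ?_, ?_⟩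
    · have := (tendsto_const_nhds (x := w)).add
        (((hσ.sub haw').div haX' one_ne_zero).smul (tendsto_const_nhds (x := X)))
      simpa using this
    · filter_upwards [h1, haX'.eventually_ne one_ne_zero, eventually_ne_zero_of_norm h2]
        with m e1 e2 e3
      have e1 : (g m).1 = _ := e1
      conv_lhs => rw [e1]
      rw [Matrix.add_mulVec, Matrix.smul_mulVec, Matrix.vecMulVec_mulVec, op_smul_eq_smul,
        smul_smul, dotProduct_add, dotProduct_smul, smul_eq_mul, div_mul_cancel₀ _ e2,
        add_sub_cancel, mul_comm (l m), inv_mul_cancel_right₀ e3]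
  have key2 : ∀ (y : ℕ → Fin (n + 1) → ℂ), Tendsto y atTop (𝓝 w) →
      Tendsto (fun m => pt ((g m).1 *ᵥ y m)) atTop (𝓝 z) →
      z ∈ dynSet (fun m => Matrix.ProjGenLinGroup.mk (g m)) (pt w) := by
    intro y hy hgy
    refine ⟨fun m => pt (y m), (continuousAt_pt hw).tendsto.comp hy, ?_⟩
    refine (hgy.congr' ?_).mapClusterPt
    filter_upwards [hy.eventually_ne hw] with m hm
    rw [mk_smul_pt _ hm]
  rw [mem_ofPred_eq, submodule_le_iff, Submodule.mem_span_pair] at hz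
  obtain ⟨α, β, hαβ⟩ := hz
  by_cases hβ : β = 0
  · have hα : α ≠ 0 := by
      rintro rfl
      exact z.rep_nonzero (by rw [← hαβ, hβ]; simp)
    have hzX : z = pt X := by
      rw [← pt_rep z, ← hαβ, hβ, zero_smul, add_zero, pt_smul hα hX0]
    -- To reach `X` itself the rank one term has to dominate, yet `σ` must stay of smaller order
    -- than `l`; `√‖l‖` does both.
    have hsq : Tendsto (fun m => Real.sqrt ‖l m‖) atTop atTop :=
      (Real.tendsto_sqrt_atTop).comp h2
    have hsq' : Tendsto (fun m => ‖((Real.sqrt ‖l m‖ : ℝ) : ℂ)‖) atTop atTop := by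
      simpa [abs_of_nonneg, Real.sqrt_nonneg] using hsq
    obtain ⟨y, hy, hgy⟩ := key (fun m => ((Real.sqrt ‖l m‖ : ℝ) : ℂ)) (by
      rw [tendsto_zero_iff_norm_tendsto_zero]
      refine (tendsto_inv_atTop_zero.comp hsq).congr fun m => ?_
      simp only [Function.comp_apply, norm_mul, norm_inv, Complex.norm_real, Real.norm_eq_abs,
        abs_of_nonneg (Real.sqrt_nonneg _)]
      conv_rhs => rw [← div_eq_mul_inv, Real.sqrt_div_self', one_div])
    refine key2 y hy ?_
    have hlim : Tendsto (fun m => bs m + ((Real.sqrt ‖l m‖ : ℝ) : ℂ)⁻¹ • (r m *ᵥ y m))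
        atTop (𝓝 X) := by
      simpa using h3.add ((tendsto_inv_zero_of_norm hsq').smul (h5.matrix_mulVec hy))
    rw [hzX]
    refine ((continuousAt_pt hX0).tendsto.comp hlim).congr' ?_
    filter_upwards [hgy, eventually_ne_zero_of_norm hsq', hlim.eventually_ne hX0] with m e1 e2 e3
    rw [Function.comp_apply, e1, ← pt_smul e2 e3, smul_add, smul_smul, mul_inv_cancel₀ e2, one_smul]
  · have hz2 : z.rep = β • ((α / β) • X + R *ᵥ w) := by
      rw [← hαβ, smul_add, smul_smul, mul_div_cancel₀ _ hβ]
    have hne : (α / β) • X + R *ᵥ w ≠ 0 := by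
      intro h
      apply z.rep_nonzero
      rw [hz2, h, smul_zero]
    obtain ⟨y, hy, hgy⟩ := key (fun _ => α / β) (by
      simpa using (tendsto_inv_zero_of_norm h2).const_mul (α / β))
    refine key2 y hy ?_
    have hlim : Tendsto (fun m => (α / β) • bs m + r m *ᵥ y m) atTop
        (𝓝 ((α / β) • X + R *ᵥ w)) :=
      (h3.const_smul _).add (h5.matrix_mulVec hy)
    rw [← pt_rep z, hz2, pt_smul hβ hne]
    refine ((continuousAt_pt hne).tendsto.comp hlim).congr' ?_
    filter_upwards [hgy] with m e1
    rw [Function.comp_apply, e1]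

end Dynamics

/-! ### Frames adapted to two boundary points -/

section Frames

variable {n : ℕ}

/-- Two null vectors with product one, together with an isometry `T` onto their orthogonal
complement. -/
structure IsFrame (X Y : Fin (n + 1) → ℂ) (T : Matrix (Fin (n + 1)) (Fin (n - 1)) ℂ) : Prop where
  herm_left : herm X X = 0
  herm_right : herm Y Y = 0
  herm_left_right : herm X Y = 1
  orthogonal_left : ∀ u, herm (T *ᵥ u) X = 0
  orthogonal_right : ∀ u, herm (T *ᵥ u) Y = 0
  isometry : ∀ u v, herm (T *ᵥ u) (T *ᵥ v) = star v ⬝ᵥ u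
  exists_eq : ∀ z, herm z X = 0 → herm z Y = 0 → ∃ u, z = T *ᵥ u

lemma exists_orthonormal_spanning {W : Type*} [AddCommGroup W] [Module ℂ W]
    [FiniteDimensional ℂ W] (c : InnerProductSpace.Core ℂ W) {d : ℕ}
    (hd : Module.finrank ℂ W = d) :
    ∃ e : Fin d → W, (∀ i j, c.inner (e i) (e j) = if i = j then 1 else 0) ∧
      ∀ w, ∃ u : Fin d → ℂ, w = ∑ i, u i • e i := by
  subst hd
  let _ : NormedAddCommGroup W := c.toNormedAddCommGroup
  let _ : InnerProductSpace ℂ W := InnerProductSpace.ofCore c.toCore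
  let b := stdOrthonormalBasis ℂ W
  refine ⟨b, fun i j => orthonormal_iff_ite.1 b.orthonormal i j, fun w => ⟨fun i => b.repr w i, ?_⟩⟩
  exact (b.sum_repr w).symm

lemma herm_re_nonneg_of_zero {z : Fin (n + 1) → ℂ} (h0 : z 0 = 0) : 0 ≤ (herm z z).re := by
  rw [herm_apply, Complex.re_sum]
  refine Finset.sum_nonneg fun i _ => ?_
  by_cases hi0 : i = 0
  · subst hi0; simp [h0]
  · by_cases hi : i = Fin.last n
    · subst hi; simp [h0]
    · rw [Equiv.swap_apply_of_ne_of_ne hi0 hi]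
      change 0 ≤ ((starRingEnd ℂ) (z i) * z i).re
      rw [← Complex.normSq_eq_conj_mul_self, Complex.ofReal_re]
      exact Complex.normSq_nonneg _

/-- Adding a multiple of `X` does not change `⟨w, w⟩` for `w ∈ X^⊥`, and where the first coordinate
vanishes the form is visibly nonnegative. If `X 0 = 0`, then `X` is a multiple of the last basis
vector and orthogonality already gives `w 0 = 0`. -/
lemma exists_add_smul_zero {X w : Fin (n + 1) → ℂ} (hX : X ≠ 0) (hXX : herm X X = 0)
    (hw : herm w X = 0) : ∃ α : ℂ, (w + α • X) 0 = 0 := by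
  by_cases hX0 : X 0 = 0
  · refine ⟨0, ?_⟩
    have h1 := eq_zero_of_null hXX hX0
    have h2 := herm_of_last h1 w
    have h3 : X (Fin.last n) ≠ 0 := by
      intro h
      apply hX
      ext i
      by_cases hi : i = Fin.last n
      · rw [hi, h]; rfl
      · rw [h1 i hi]; rfl
    rw [herm_comm_eq_zero hw] at h2
    simpa [h3] using h2.symm
  · refine ⟨-(w 0 / X 0), ?_⟩
    simp [hX0]

lemma herm_self_add_smul {X w : Fin (n + 1) → ℂ} (hXX : herm X X = 0) (hw : herm w X = 0) (α : ℂ) :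
    herm (w + α • X) (w + α • X) = herm w w := by
  rw [herm_add_left, herm_add_right, herm_add_right, herm_smul_left, herm_smul_left,
    herm_smul_right, herm_smul_right, hXX, hw, herm_comm_eq_zero hw]
  simp

/-- The form is positive semidefinite on the orthogonal complement of a null vector. -/
lemma herm_re_nonneg {X w : Fin (n + 1) → ℂ} (hX : X ≠ 0) (hXX : herm X X = 0)
    (hw : herm w X = 0) : 0 ≤ (herm w w).re := by
  obtain ⟨α, hα⟩ := exists_add_smul_zero hX hXX hw
  have := herm_re_nonneg_of_zero hα
  rwa [herm_self_add_smul hXX hw] at this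

lemma exists_smul_eq_of_herm_self_eq_zero {X w : Fin (n + 1) → ℂ} (hX : X ≠ 0)
    (hXX : herm X X = 0) (hw : herm w X = 0) (hww : herm w w = 0) : ∃ c : ℂ, w = c • X :=
  exists_smul_eq_of_null hww hXX hw hX

lemma exists_isFrame {x y : CP n} (hx : x ∈ boundary n) (hy : y ∈ boundary n) (hxy : x ≠ y) :
    ∃ X Y T, IsFrame (n := n) X Y T ∧ pt X = x ∧ pt Y = y := by
  set c := herm x.rep y.rep with hc
  have hc0 : c ≠ 0 := fun h => hxy (eq_of_orthogonal hy hx h).symm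
  set X := c⁻¹ • x.rep with hX
  set Y := y.rep with hY
  have hXX : herm X X = 0 := by
    rw [hX, herm_smul_left, herm_smul_right, show herm x.rep x.rep = 0 from hx]; simp
  have hYY : herm Y Y = 0 := hy
  have hXY : herm X Y = 1 := by rw [hX, herm_smul_left, ← hc, inv_mul_cancel₀ hc0]
  have hYX : herm Y X = 1 := by rw [← star_herm, hXY, star_one]
  have hX0 : X ≠ 0 := by intro h; rw [h] at hXY; simp at hXY
  let F : (Fin (n + 1) → ℂ) →ₗ[ℂ] ℂ × ℂ :=
    { toFun := fun z => (herm z X, herm z Y)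
      map_add' := fun a b => by simp [herm_add_left]
      map_smul' := fun a b => by simp [herm_smul_left] }
  have hF : ∀ z, z ∈ LinearMap.ker F ↔ herm z X = 0 ∧ herm z Y = 0 := fun z => by
    rw [LinearMap.mem_ker, Prod.ext_iff]; rfl
  have hFs : LinearMap.range F = ⊤ := by
    rw [LinearMap.range_eq_top]
    rintro ⟨p, q⟩
    refine ⟨p • Y + q • X, ?_⟩
    change (herm _ _, herm _ _) = _
    simp [herm_add_left, herm_smul_left, hXX, hYY, hXY, hYX]
  have hd : Module.finrank ℂ (LinearMap.ker F) = n - 1 := by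
    have := F.finrank_range_add_finrank_ker
    rw [hFs, finrank_top, Module.finrank_prod, Module.finrank_self, Module.finrank_fin_fun] at this
    omega
  -- The arguments are exchanged since inner products are antilinear in the first variable.
  -- Definiteness: a null vector of `X^⊥` is a multiple of `X`, and orthogonality to `Y` makes it
  -- vanish.
  let core : InnerProductSpace.Core ℂ (LinearMap.ker F) :=
    { inner := fun u v => herm v.1 u.1
      conj_inner_symm := fun u v => star_herm _ _
      re_inner_nonneg := fun u => herm_re_nonneg hX0 hXX ((hF _).1 u.2).1
      add_left := fun u v w => herm_add_right _ _ _
      smul_left := fun u v r => herm_smul_right _ _ _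
      definite := fun u hu => by
        obtain ⟨d, hd⟩ := exists_smul_eq_of_herm_self_eq_zero hX0 hXX ((hF _).1 u.2).1 hu
        have h1 := ((hF _).1 u.2).2
        rw [hd, herm_smul_left, hXY, mul_one] at h1
        apply Subtype.ext
        rw [hd, h1, zero_smul]; rfl }
  obtain ⟨e, he, hs⟩ := exists_orthonormal_spanning core hd
  let T : Matrix (Fin (n + 1)) (Fin (n - 1)) ℂ := Matrix.of fun i j => (e j).1 i
  have hT : ∀ u, T *ᵥ u = ((∑ i, u i • e i : LinearMap.ker F) : Fin (n + 1) → ℂ) := by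
    intro u
    ext i
    rw [Submodule.coe_sum, Finset.sum_apply]
    simp [T, Matrix.mulVec, dotProduct, mul_comm]
  refine ⟨X, Y, T, ⟨hXX, hYY, hXY, ?_, ?_, ?_, ?_⟩, ?_, pt_rep _⟩
  · intro u
    rw [hT]; exact ((hF _).1 (Subtype.mem _)).1
  · intro u
    rw [hT]; exact ((hF _).1 (Subtype.mem _)).2
  · intro u v
    have hsuml : ∀ (a : Fin (n - 1) → ℂ) (w : LinearMap.ker F),
        herm (∑ i, a i • e i : LinearMap.ker F).1 w.1 = ∑ i, a i * herm (e i).1 w.1 := by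
      intro a w
      rw [Submodule.coe_sum, ← dualVec_dotProduct, dotProduct_sum]
      refine Finset.sum_congr rfl fun i _ => ?_
      rw [dualVec_dotProduct, Submodule.coe_smul, herm_smul_left]
    have he' : ∀ i j, herm (e i).1 (e j).1 = if j = i then 1 else 0 := fun i j => he j i
    rw [hT, hT, hsuml, dotProduct]
    refine Finset.sum_congr rfl fun i _ => ?_
    rw [← star_herm, hsuml]
    simp only [he']
    simp [mul_comm]
  · intro z h1 h2
    obtain ⟨u, hu⟩ := hs ⟨z, (hF z).2 ⟨h1, h2⟩⟩
    exact ⟨u, by rw [hT, ← hu]⟩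
  · rw [hX, pt_smul (inv_ne_zero hc0) x.rep_nonzero, pt_rep]

/-- The matrix which acts as `A` on the image of an isometry `T`, and vanishes on its orthogonal
complement. -/
noncomputable def blockMap (T : Matrix (Fin (n + 1)) (Fin (n - 1)) ℂ)
    (A : Matrix (Fin (n - 1)) (Fin (n - 1)) ℂ) : Matrix (Fin (n + 1)) (Fin (n + 1)) ℂ :=
  T * A * (Tᴴ * hermMatrix n)

lemma blockMap_adjoint (T : Matrix (Fin (n + 1)) (Fin (n - 1)) ℂ)
    (A : Matrix (Fin (n - 1)) (Fin (n - 1)) ℂ) :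
    hermMatrix n * (blockMap T A)ᴴ * hermMatrix n = blockMap T Aᴴ := by
  simp only [blockMap, Matrix.conjTranspose_mul, Matrix.conjTranspose_conjTranspose,
    hermMatrix_conjTranspose, ← Matrix.mul_assoc, hermMatrix_mul_self, Matrix.one_mul]

lemma star_dotProduct_adjoint (T : Matrix (Fin (n + 1)) (Fin (n - 1)) ℂ) (z : Fin (n + 1) → ℂ)
    (v : Fin (n - 1) → ℂ) : star v ⬝ᵥ ((Tᴴ * hermMatrix n) *ᵥ z) = herm z (T *ᵥ v) := by
  rw [herm, Matrix.star_mulVec, ← Matrix.dotProduct_mulVec, Matrix.mulVec_mulVec]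

lemma eq_of_star_dotProduct {k : ℕ} {u v : Fin k → ℂ} (h : ∀ w, star w ⬝ᵥ u = star w ⬝ᵥ v) :
    u = v := by
  ext i
  have h1 : star (Pi.single i (1 : ℂ)) = (Pi.single i 1 : Fin k → ℂ) := by
    ext j
    simp only [Pi.star_apply, Pi.single_apply]
    split_ifs <;> simp
  simpa [h1] using h (Pi.single i 1)

namespace IsFrame

variable {X Y : Fin (n + 1) → ℂ} {T : Matrix (Fin (n + 1)) (Fin (n - 1)) ℂ}

lemma herm_right_left (hF : IsFrame X Y T) : herm Y X = 1 := by
  rw [← star_herm, hF.herm_left_right, star_one]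

lemma symm (hF : IsFrame X Y T) : IsFrame Y X T :=
  ⟨hF.herm_right, hF.herm_left, hF.herm_right_left, hF.orthogonal_right, hF.orthogonal_left,
    hF.isometry, fun z h h' => hF.exists_eq z h' h⟩

lemma ne_zero (hF : IsFrame X Y T) : X ≠ 0 := by
  intro h
  have := hF.herm_left_right
  rw [h] at this
  simp at this

lemma injective (hF : IsFrame X Y T) {u v : Fin (n - 1) → ℂ} (h : T *ᵥ u = T *ᵥ v) : u = v := by
  refine eq_of_star_dotProduct fun w => ?_
  rw [← hF.isometry, h, hF.isometry]

lemma mulVec_ne_zero (hF : IsFrame X Y T) {u : Fin (n - 1) → ℂ} (h : u ≠ 0) : T *ᵥ u ≠ 0 := by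
  intro h'
  exact h (hF.injective (h'.trans (Matrix.mulVec_zero T).symm))

lemma adjoint_mulVec (hF : IsFrame X Y T) (u : Fin (n - 1) → ℂ) :
    (Tᴴ * hermMatrix n) *ᵥ (T *ᵥ u) = u :=
  eq_of_star_dotProduct fun w => by rw [star_dotProduct_adjoint, hF.isometry]

lemma adjoint_left (hF : IsFrame X Y T) : (Tᴴ * hermMatrix n) *ᵥ X = 0 :=
  eq_of_star_dotProduct fun w => by
    rw [star_dotProduct_adjoint, herm_comm_eq_zero (hF.orthogonal_left w), dotProduct_zero]

lemma blockMap_left (hF : IsFrame X Y T) (A : Matrix (Fin (n - 1)) (Fin (n - 1)) ℂ) :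
    blockMap T A *ᵥ X = 0 := by
  rw [blockMap, ← Matrix.mulVec_mulVec, hF.adjoint_left, Matrix.mulVec_zero]

lemma blockMap_mulVec (hF : IsFrame X Y T) (A : Matrix (Fin (n - 1)) (Fin (n - 1)) ℂ)
    (u : Fin (n - 1) → ℂ) : blockMap T A *ᵥ (T *ᵥ u) = T *ᵥ (A *ᵥ u) := by
  rw [blockMap, ← Matrix.mulVec_mulVec, hF.adjoint_mulVec, Matrix.mulVec_mulVec]

lemma exists_decomposition (hF : IsFrame X Y T) (z : Fin (n + 1) → ℂ) :
    ∃ u, z = herm z Y • X + herm z X • Y + T *ᵥ u := by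
  obtain ⟨u, hu⟩ := hF.exists_eq (z + (-herm z Y) • X + (-herm z X) • Y)
    (by rw [herm_add_left, herm_add_left, herm_smul_left, herm_smul_left, hF.herm_left,
      hF.herm_right_left]; ring)
    (by rw [herm_add_left, herm_add_left, herm_smul_left, herm_smul_left, hF.herm_right,
      hF.herm_left_right]; ring)
  refine ⟨u, ?_⟩
  rw [← hu]
  module

lemma matrix_ext (hF : IsFrame X Y T) {M N : Matrix (Fin (n + 1)) (Fin (n + 1)) ℂ}
    (hX : M *ᵥ X = N *ᵥ X) (hY : M *ᵥ Y = N *ᵥ Y) (hT : ∀ u, M *ᵥ (T *ᵥ u) = N *ᵥ (T *ᵥ u)) :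
    M = N := by
  refine Matrix.ext_of_mulVec_single fun i => ?_
  obtain ⟨u, hu⟩ := hF.exists_decomposition (Pi.single i 1)
  rw [hu]
  simp only [Matrix.mulVec_add, Matrix.mulVec_smul, hX, hY, hT]

lemma blockMap_mul (hF : IsFrame X Y T) (A B : Matrix (Fin (n - 1)) (Fin (n - 1)) ℂ) :
    blockMap T A * blockMap T B = blockMap T (A * B) := by
  refine hF.matrix_ext ?_ ?_ fun u => ?_
  · rw [← Matrix.mulVec_mulVec, hF.blockMap_left, hF.blockMap_left, Matrix.mulVec_zero]
  · rw [← Matrix.mulVec_mulVec, hF.symm.blockMap_left, hF.symm.blockMap_left, Matrix.mulVec_zero]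
  · rw [← Matrix.mulVec_mulVec, hF.blockMap_mulVec, hF.blockMap_mulVec, hF.blockMap_mulVec,
      ← Matrix.mulVec_mulVec]

/-- The remainder of a sequence in `U(1, n)` which is asymptotically of rank one is unitary. -/
lemma exists_unitary (hF : IsFrame X Y T) {g : ℕ → GL (Fin (n + 1)) ℂ} (hg : ∀ m, g m ∈ U1 n)
    {R : Matrix (Fin (n + 1)) (Fin (n + 1)) ℂ}
    (h : RankOneLimit (fun m => (g m).1) X (dualVec Y) R) (hRX : R *ᵥ X = 0)
    (hYR : dualVec Y ᵥ* R = 0) :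
    ∃ A ∈ Matrix.unitaryGroup (Fin (n - 1)) ℂ, R = blockMap T A := by
  obtain ⟨l, bs, as, r, h1, h2, h3, h4, h5⟩ := h
  have haX := h4.matrix_dotProduct (tendsto_const_nhds (x := X))
  rw [dualVec_dotProduct, hF.herm_left_right] at haX
  -- A vector of `Y^⊥` can be moved slightly along `X` so that the large term vanishes exactly; what
  -- survives in the limit is `R w`. Invariance of the form then makes `R` isometric on `Y^⊥`.
  have key : ∀ w, herm w Y = 0 → ∃ y : ℕ → Fin (n + 1) → ℂ, Tendsto y atTop (𝓝 w) ∧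
      Tendsto (fun m => (g m).1 *ᵥ y m) atTop (𝓝 (R *ᵥ w)) := by
    intro w hw
    have haw := h4.matrix_dotProduct (tendsto_const_nhds (x := w))
    rw [dualVec_dotProduct, hw] at haw
    have hy : Tendsto (fun m => w + (-((as m ⬝ᵥ w) / (as m ⬝ᵥ X))) • X) atTop (𝓝 w) := by
      have := (tendsto_const_nhds (x := w)).add
        ((haw.div haX one_ne_zero).neg.smul (tendsto_const_nhds (x := X)))
      simpa using this
    refine ⟨_, hy, (h5.matrix_mulVec hy).congr' ?_⟩
    filter_upwards [h1, haX.eventually_ne one_ne_zero] with m e1 e2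
    have e1 : (g m).1 = _ := e1
    conv_rhs => rw [e1]
    rw [Matrix.add_mulVec, Matrix.smul_mulVec, Matrix.vecMulVec_mulVec, op_smul_eq_smul,
      dotProduct_add, dotProduct_smul, smul_eq_mul, neg_mul, div_mul_cancel₀ _ e2, add_neg_cancel,
      zero_smul, smul_zero, zero_add]
  have hiso : ∀ w w', herm w Y = 0 → herm w' Y = 0 → herm (R *ᵥ w) (R *ᵥ w') = herm w w' := by
    intro w w' hw hw'
    obtain ⟨y, hy, hgy⟩ := key w hw
    obtain ⟨y', hy', hgy'⟩ := key w' hw'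
    refine tendsto_nhds_unique (hgy.herm_comp hgy') ((hy.herm_comp hy').congr fun m => ?_)
    rw [herm_mulVec_U1 (hg m)]
  have hRY : ∀ z, herm (R *ᵥ z) Y = 0 := fun z => by
    rw [← dualVec_dotProduct, Matrix.dotProduct_mulVec, hYR, zero_dotProduct]
  -- `⟨y, X⟩ = ⟨g y, g X⟩` is bounded while `g X` grows like `l X`; dividing by the scale gives `⟨R
  -- w, X⟩ = 0`.
  have hRX' : ∀ w, herm w Y = 0 → herm (R *ᵥ w) X = 0 := by
    intro w hw
    obtain ⟨y, hy, hgy⟩ := key w hw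
    have hinv : Tendsto (fun m => (star (l m * (as m ⬝ᵥ X)))⁻¹) atTop (𝓝 0) := by
      refine tendsto_inv_zero_of_norm ?_
      simp only [norm_star, norm_mul]
      exact h2.atTop_mul_pos (by simp) haX.norm
    have hlim := hinv.mul ((hy.herm_comp (tendsto_const_nhds (x := X))).sub
      (hgy.herm_comp (h5.matrix_mulVec (tendsto_const_nhds (x := X)))))
    rw [zero_mul] at hlim
    refine tendsto_nhds_unique (hgy.herm_comp h3) (hlim.congr' ?_)
    filter_upwards [h1, haX.eventually_ne one_ne_zero, eventually_ne_zero_of_norm h2] with m e1 e2 e3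
    have e4 : (g m).1 *ᵥ X = (l m * (as m ⬝ᵥ X)) • bs m + r m *ᵥ X := by
      rw [show (g m).1 = _ from e1, Matrix.add_mulVec, Matrix.smul_mulVec, Matrix.vecMulVec_mulVec,
        op_smul_eq_smul, smul_smul]
    have e5 : herm (y m) X = star (l m * (as m ⬝ᵥ X)) * herm ((g m).1 *ᵥ y m) (bs m)
        + herm ((g m).1 *ᵥ y m) (r m *ᵥ X) := by
      rw [← herm_mulVec_U1 (hg m), e4, herm_add_right, herm_smul_right]
    rw [e5, add_sub_cancel_right, inv_mul_cancel_left₀ (star_ne_zero.2 (mul_ne_zero e3 e2))]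
  -- `R Y` is a null vector in the image of `T`, where the form is definite.
  have hRYY : R *ᵥ Y = 0 := by
    obtain ⟨u, hu⟩ := hF.exists_eq _ (hRX' Y hF.herm_right) (hRY Y)
    have h6 := hiso Y Y hF.herm_right hF.herm_right
    rw [hF.herm_right, hu, hF.isometry, star_dotProduct_self, Complex.ofReal_eq_zero,
      sum_normSq_eq_zero] at h6
    rw [hu, h6, Matrix.mulVec_zero]
  set A := (Tᴴ * hermMatrix n) * R * T with hA
  have hAT : ∀ u, R *ᵥ (T *ᵥ u) = T *ᵥ (A *ᵥ u) := by
    intro u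
    obtain ⟨u', hu'⟩ := hF.exists_eq _ (hRX' _ (hF.orthogonal_right u)) (hRY (T *ᵥ u))
    rw [hA, ← Matrix.mulVec_mulVec, ← Matrix.mulVec_mulVec, hu', hF.adjoint_mulVec]
  refine ⟨A, ?_, ?_⟩
  · rw [Matrix.mem_unitaryGroup_iff', Matrix.star_eq_conjTranspose]
    refine Matrix.ext_of_mulVec_single fun i => eq_of_star_dotProduct fun w => ?_
    rw [← Matrix.mulVec_mulVec, Matrix.dotProduct_mulVec, ← Matrix.star_mulVec, ← hF.isometry,
      ← hAT, ← hAT, hiso _ _ (hF.orthogonal_right _) (hF.orthogonal_right _), hF.isometry,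
      Matrix.one_mulVec]
  · refine hF.matrix_ext ?_ ?_ fun u => ?_
    · rw [hRX, hF.blockMap_left]
    · rw [hRYY, hF.symm.blockMap_left]
    · rw [hAT, hF.blockMap_mulVec]

end IsFrame

end Frames

/-! ### Pencils, unitary matrices and Cartan maps -/

section Pencils

variable {n : ℕ}

lemma mem_perp_pt {X z : Fin (n + 1) → ℂ} (hX : X ≠ 0) : z ∈ perp (pt X) ↔ herm z X = 0 := by
  obtain ⟨d, hd, hr⟩ := exists_rep_pt hX
  rw [mem_perp, hr, herm_smul_right]
  simp [hd]

lemma mulVec_ne_zero_of_mul_eq_one {k : ℕ} {A B : Matrix (Fin k) (Fin k) ℂ} (h : B * A = 1)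
    {v : Fin k → ℂ} (hv : v ≠ 0) : A *ᵥ v ≠ 0 := by
  intro h0
  apply hv
  have := congrArg (fun u => B *ᵥ u) h0
  simpa [Matrix.mulVec_mulVec, h] using this

lemma unitary_mulVec_ne_zero {k : ℕ} (A : Matrix.unitaryGroup (Fin k) ℂ) {v : Fin k → ℂ}
    (hv : v ≠ 0) : A.1 *ᵥ v ≠ 0 := by
  have hA := A.2
  rw [Matrix.mem_unitaryGroup_iff'] at hA
  exact mulVec_ne_zero_of_mul_eq_one hA hv

/-- The map `μ` between pencils is induced by the matrix `A`. -/
def IsInducedBy {p q : CP n} (T : Matrix (Fin (n + 1)) (Fin (n - 1)) ℂ) (μ : Pencil p → Pencil q)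
    (A : Matrix (Fin (n - 1)) (Fin (n - 1)) ℂ) : Prop :=
  ∀ (ℓ : Pencil p) (v : Fin (n - 1) → ℂ), T *ᵥ v ∈ ℓ.1 → T *ᵥ (A *ᵥ v) ∈ (μ ℓ).1

namespace IsFrame

variable {X Y : Fin (n + 1) → ℂ} {T : Matrix (Fin (n + 1)) (Fin (n - 1)) ℂ}

lemma mem_span_iff (hF : IsFrame X Y T) {v w : Fin (n - 1) → ℂ} :
    T *ᵥ v ∈ Submodule.span ℂ {X, T *ᵥ w} ↔ ∃ c : ℂ, v = c • w := by
  rw [Submodule.mem_span_pair]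
  constructor
  · rintro ⟨a, c, h⟩
    have h1 := congrArg (fun z => herm z Y) h
    simp only [herm_add_left, herm_smul_left, hF.orthogonal_right, hF.herm_left_right, mul_one,
      mul_zero, add_zero] at h1
    rw [h1, zero_smul, zero_add, ← Matrix.mulVec_smul] at h
    exact ⟨c, hF.injective h.symm⟩
  · rintro ⟨c, rfl⟩
    exact ⟨0, c, by rw [zero_smul, zero_add, Matrix.mulVec_smul]⟩

lemma finrank_span (hF : IsFrame X Y T) {w : Fin (n - 1) → ℂ} (hw : w ≠ 0) :
    Module.finrank ℂ (Submodule.span ℂ {X, T *ᵥ w}) = 2 := by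
  have hli : LinearIndependent ℂ ![X, T *ᵥ w] := by
    rw [LinearIndependent.pair_iff]
    intro a c h
    have h1 := congrArg (fun z => herm z Y) h
    simp only [herm_add_left, herm_smul_left, hF.orthogonal_right, hF.herm_left_right, mul_one,
      mul_zero, add_zero, herm_zero_left] at h1
    rw [h1, zero_smul, zero_add] at h
    exact ⟨h1, (smul_eq_zero.1 h).resolve_right (hF.mulVec_ne_zero hw)⟩
  have := finrank_span_eq_card hli
  rwa [Matrix.range_cons, Matrix.range_cons, Matrix.range_empty, union_empty, Fintype.card_fin,
    singleton_union] at this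

lemma left_mem_pencil (hF : IsFrame X Y T) (ℓ : Pencil (pt X)) : X ∈ ℓ.1 := by
  have := ℓ.2.2.1
  exact this (by rw [submodule_pt hF.ne_zero]; exact Submodule.mem_span_singleton_self X)

lemma pencil_eq_span (hF : IsFrame X Y T) (ℓ : Pencil (pt X)) {v : Fin (n - 1) → ℂ} (hv : v ≠ 0)
    (h : T *ᵥ v ∈ ℓ.1) : ℓ.1 = Submodule.span ℂ {X, T *ᵥ v} := by
  refine (Submodule.eq_of_le_of_finrank_eq ?_ ?_).symm
  · rw [Submodule.span_le]
    rintro z (rfl | rfl)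
    · exact hF.left_mem_pencil ℓ
    · exact h
  · rw [hF.finrank_span hv, ℓ.2.1]

/-- Modulo `X`, the space `X^⊥` is the image of `T`. With `mem_pencil_iff` this identifies the
pencil with the projective space of `ℂⁿ⁻¹`. -/
lemma exists_mem_pencil (hF : IsFrame X Y T) (ℓ : Pencil (pt X)) : ∃ v ≠ 0, T *ᵥ v ∈ ℓ.1 := by
  have h1 : ¬ ℓ.1 ≤ Submodule.span ℂ {X} := by
    intro h
    have h2 := Submodule.finrank_mono h
    rw [ℓ.2.1, finrank_span_singleton hF.ne_zero] at h2
    omega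
  obtain ⟨z, hz, hzX⟩ := SetLike.not_le_iff_exists.1 h1
  have hzX' := (mem_perp_pt hF.ne_zero).1 (ℓ.2.2.2 hz)
  obtain ⟨u, hu⟩ := hF.exists_decomposition z
  rw [hzX', zero_smul, add_zero] at hu
  refine ⟨u, ?_, ?_⟩
  · rintro rfl
    apply hzX
    rw [hu, Matrix.mulVec_zero, add_zero]
    exact Submodule.smul_mem _ _ (Submodule.mem_span_singleton_self X)
  · have h3 : T *ᵥ u = z - herm z Y • X := by
      conv_rhs => rw [hu]
      rw [← hu]
      exact (sub_eq_of_eq_add' hu).symm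
    rw [h3]
    exact ℓ.1.sub_mem hz (ℓ.1.smul_mem _ (hF.left_mem_pencil ℓ))

lemma pencil_ext (hF : IsFrame X Y T) {ℓ ℓ' : Pencil (pt X)} {v : Fin (n - 1) → ℂ} (hv : v ≠ 0)
    (h : T *ᵥ v ∈ ℓ.1) (h' : T *ᵥ v ∈ ℓ'.1) : ℓ = ℓ' :=
  Subtype.ext ((hF.pencil_eq_span ℓ hv h).trans (hF.pencil_eq_span ℓ' hv h').symm)

lemma mem_pencil_iff (hF : IsFrame X Y T) (ℓ : Pencil (pt X)) {v w : Fin (n - 1) → ℂ} (hw : w ≠ 0)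
    (h : T *ᵥ w ∈ ℓ.1) : T *ᵥ v ∈ ℓ.1 ↔ ∃ c : ℂ, v = c • w := by
  rw [hF.pencil_eq_span ℓ hw h, hF.mem_span_iff]

/-- The line spanned by `X` and `T v`. -/
def line (hF : IsFrame X Y T) (v : Fin (n - 1) → ℂ) (hv : v ≠ 0) : Pencil (pt X) :=
  ⟨Submodule.span ℂ {X, T *ᵥ v}, hF.finrank_span hv, by
    rw [submodule_pt hF.ne_zero]
    exact Submodule.span_mono (by simp), by
    rw [Submodule.span_le]
    rintro z (rfl | rfl)
    · exact (mem_perp_pt hF.ne_zero).2 hF.herm_left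
    · exact (mem_perp_pt hF.ne_zero).2 (hF.orthogonal_left v)⟩

lemma mem_line (hF : IsFrame X Y T) (v : Fin (n - 1) → ℂ) (hv : v ≠ 0) :
    T *ᵥ v ∈ (hF.line v hv).1 :=
  Submodule.subset_span (by simp)

lemma exists_induced (hF : IsFrame X Y T) {A B : Matrix (Fin (n - 1)) (Fin (n - 1)) ℂ}
    (hBA : B * A = 1) : ∃ f : Pencil (pt Y) → Pencil (pt X), IsInducedBy T f A := by
  have hA : ∀ v, v ≠ 0 → A *ᵥ v ≠ 0 := fun v => mulVec_ne_zero_of_mul_eq_one hBA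
  choose v hv hvm using fun ℓ => hF.symm.exists_mem_pencil ℓ
  refine ⟨fun ℓ => hF.line (A *ᵥ v ℓ) (hA _ (hv ℓ)), fun ℓ w hw => ?_⟩
  obtain ⟨c, rfl⟩ := (hF.symm.mem_pencil_iff ℓ (hv ℓ) (hvm ℓ)).1 hw
  rw [Matrix.mulVec_smul, Matrix.mulVec_smul]
  exact Submodule.smul_mem _ _ (hF.mem_line _ _)

lemma exists_inducedEquiv (hF : IsFrame X Y T) {A B : Matrix (Fin (n - 1)) (Fin (n - 1)) ℂ}
    (hBA : B * A = 1) : ∃ μ : Pencil (pt Y) ≃ Pencil (pt X), IsInducedBy T μ A ∧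
      IsInducedBy T μ.symm B := by
  have hAB : A * B = 1 := mul_eq_one_comm.1 hBA
  obtain ⟨f, hf⟩ := hF.exists_induced hBA
  obtain ⟨f', hf'⟩ := hF.symm.exists_induced hAB
  refine ⟨⟨f, f', fun ℓ => ?_, fun ℓ => ?_⟩, hf, hf'⟩
  · obtain ⟨v, hv, hvm⟩ := hF.symm.exists_mem_pencil ℓ
    have e : B *ᵥ (A *ᵥ v) = v := by rw [Matrix.mulVec_mulVec, hBA, Matrix.one_mulVec]
    have := hf' _ _ (hf _ _ hvm)
    rw [e] at this
    exact hF.symm.pencil_ext hv this hvm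
  · obtain ⟨v, hv, hvm⟩ := hF.exists_mem_pencil ℓ
    have e : A *ᵥ (B *ᵥ v) = v := by rw [Matrix.mulVec_mulVec, hAB, Matrix.one_mulVec]
    have := hf _ _ (hf' _ _ hvm)
    rw [e] at this
    exact hF.pencil_ext hv this hvm

/-- The dynamics on `Y^⊥` of a sequence which is asymptotically of rank one. -/
lemma dynSet_eq (hF : IsFrame X Y T) {g : ℕ → GL (Fin (n + 1)) ℂ}
    {A : Matrix (Fin (n - 1)) (Fin (n - 1)) ℂ} (hA : A ∈ Matrix.unitaryGroup (Fin (n - 1)) ℂ)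
    (h : RankOneLimit (fun m => (g m).1) X (dualVec Y) (blockMap T A))
    {μ : Pencil (pt Y) → Pencil (pt X)} (hμ : IsInducedBy T μ A) (ℓ : Pencil (pt Y)) {w : CP n}
    (hw : w ∈ ℓ.points) (hwY : w ≠ pt Y) :
    dynSet (fun m => Matrix.ProjGenLinGroup.mk (g m)) w = (μ ℓ).points := by
  rw [Matrix.mem_unitaryGroup_iff', Matrix.star_eq_conjTranspose] at hA
  obtain ⟨v, hv, hvm⟩ := hF.symm.exists_mem_pencil ℓ
  have hwℓ : w.rep ∈ ℓ.1 := submodule_le_iff.1 hw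
  rw [hF.symm.pencil_eq_span ℓ hv hvm, Submodule.mem_span_pair] at hwℓ
  obtain ⟨α, β, hαβ⟩ := hwℓ
  have hβ : β ≠ 0 := by
    rintro rfl
    rw [zero_smul, add_zero] at hαβ
    have hα : α ≠ 0 := by
      rintro rfl
      exact w.rep_nonzero (by rw [← hαβ, zero_smul])
    apply hwY
    rw [← pt_rep w, ← hαβ, pt_smul hα hF.symm.ne_zero]
  have hAv : A *ᵥ v ≠ 0 := mulVec_ne_zero_of_mul_eq_one hA hv
  have hR : blockMap T A *ᵥ w.rep = β • (T *ᵥ (A *ᵥ v)) := by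
    rw [← hαβ, Matrix.mulVec_add, Matrix.mulVec_smul, Matrix.mulVec_smul, hF.symm.blockMap_left,
      hF.blockMap_mulVec, smul_zero, zero_add]
  have hspan : Submodule.span ℂ {X, blockMap T A *ᵥ w.rep} = (μ ℓ).1 := by
    rw [hF.pencil_eq_span (μ ℓ) hAv (hμ ℓ v hvm), hR]
    apply le_antisymm
    · rw [Submodule.span_le]
      rintro z (rfl | rfl)
      · exact Submodule.subset_span (by simp)
      · exact Submodule.smul_mem _ _ (Submodule.subset_span (by simp))
    · rw [Submodule.span_le]
      rintro z (rfl | rfl)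
      · exact Submodule.subset_span (by simp)
      · refine (Submodule.smul_mem_iff _ hβ).1 (Submodule.subset_span (by simp))
  have haX : dualVec Y ⬝ᵥ X = 1 := by rw [dualVec_dotProduct, hF.herm_left_right]
  have haw : dualVec Y ⬝ᵥ w.rep = 0 := by
    rw [dualVec_dotProduct, ← hαβ, herm_add_left, herm_smul_left, herm_smul_left, hF.herm_right,
      hF.orthogonal_right]
    simp
  set D := T *ᵥ (A *ᵥ v) with hD
  have hDD : herm D D ≠ 0 := by
    rw [hD, hF.isometry, star_dotProduct_self, Ne, Complex.ofReal_eq_zero, sum_normSq_eq_zero]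
    exact hAv
  have hset : (μ ℓ).points = {z : CP n | z.submodule ≤ Submodule.span ℂ {X, blockMap T A *ᵥ w.rep}} := by
    rw [hspan]; rfl
  rw [hset]
  conv_lhs => rw [← pt_rep w]
  refine Subset.antisymm ?_ (h.subset_dynSet haX w.rep_nonzero haw)
  -- Since `D` is a nonzero vector of the definite space, `⟨·, D⟩`, suitably scaled, is the
  -- functional that separates the limit direction from `X`.
  refine h.dynSet_subset (e := (β * herm D D)⁻¹ • dualVec D) haX w.rep_nonzero ?_ ?_ ?_
  · rw [hR, dualVec_dotProduct, herm_smul_left, hF.orthogonal_right, mul_zero]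
  · rw [smul_dotProduct, dualVec_dotProduct, herm_comm_eq_zero (hF.orthogonal_left _), smul_zero]
  · rw [hR, smul_dotProduct, dualVec_dotProduct, herm_smul_left, smul_eq_mul,
      inv_mul_cancel₀ (mul_ne_zero hβ hDD)]

end IsFrame

/-- The unitary matrices which describe the action between the pencils of a sequence in `Γ` which
contracts to `X` and whose inverse contracts to `Y`. -/
def unitaryLimits (Γ : Subgroup (PGL n)) (X Y : Fin (n + 1) → ℂ)
    (T : Matrix (Fin (n + 1)) (Fin (n - 1)) ℂ) : Set (Matrix.unitaryGroup (Fin (n - 1)) ℂ) :=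
  {A | ∃ g : ℕ → GL (Fin (n + 1)) ℂ, (∀ m, g m ∈ U1 n ∧ Matrix.ProjGenLinGroup.mk (g m) ∈ Γ) ∧
    RankOneLimit (fun m => (g m).1) X (dualVec Y) (blockMap T A)}

lemma exists_common_nonvanishing {k : ℕ} {a b : Fin k → ℂ} (ha : a ≠ 0) (hb : b ≠ 0) :
    ∃ z, a ⬝ᵥ z ≠ 0 ∧ b ⬝ᵥ z ≠ 0 := by
  have ha' : ∃ z, a ⬝ᵥ z ≠ 0 := by
    by_contra! h; exact ha (dotProduct_eq_zero a h)
  have hb' : ∃ z, b ⬝ᵥ z ≠ 0 := by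
    by_contra! h; exact hb (dotProduct_eq_zero b h)
  obtain ⟨z, hz⟩ := ha'
  obtain ⟨w, hw⟩ := hb'
  by_cases hz' : b ⬝ᵥ z = 0
  · by_cases hw' : a ⬝ᵥ w = 0
    · exact ⟨z + w, by rw [dotProduct_add, hw', add_zero]; exact hz,
        by rw [dotProduct_add, hz', zero_add]; exact hw⟩
    · exact ⟨w, hw', hw⟩
  · exact ⟨z, hz, hz'⟩

lemma dualVec_ne_zero {c : Fin (n + 1) → ℂ} (hc : c ≠ 0) : dualVec c ≠ 0 := fun h =>
  hc (dualVec_injective (h.trans dualVec_zero.symm))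

/-- A point off both hyperplanes `c^⊥` and `Y^⊥` has an orbit with both limits, which must coincide.
-/
lemma RankOneLimit.pt_eq_of_converges {g : ℕ → GL (Fin (n + 1)) ℂ} {b c X Y : Fin (n + 1) → ℂ}
    {R : Matrix (Fin (n + 1)) (Fin (n + 1)) ℂ}
    (h : RankOneLimit (fun m => (g m).1) b (dualVec c) R) (hb : b ≠ 0) (hc : c ≠ 0) (hY : Y ≠ 0)
    (hconv : ConvergesUniformlyOnCompacts (fun m => Matrix.ProjGenLinGroup.mk (g m))
      {z | ¬ z.submodule ≤ perp (pt Y)} (pt X)) : pt b = pt X := by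
  obtain ⟨z, hz1, hz2⟩ := exists_common_nonvanishing (dualVec_ne_zero hc) (dualVec_ne_zero hY)
  have hz0 : z ≠ 0 := by rintro rfl; simp at hz1
  have h1 : Tendsto (fun m => (Matrix.ProjGenLinGroup.mk (g m) : PGL n) • pt z) atTop
      (𝓝 (pt b)) := by
    have e : Tendsto (fun m : ℕ => (m, pt z)) atTop (atTop ×ˢ 𝓝 (pt z)) :=
      tendsto_id.prodMk tendsto_const_nhds
    have k := h.tendsto_pt hb hz0 hz1
    have k' := k.comp e
    simpa only [Function.comp_def] using k'
  have h2 : Tendsto (fun m => (Matrix.ProjGenLinGroup.mk (g m) : PGL n) • pt z) atTop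
      (𝓝 (pt X)) := by
    intro V hV
    have := hconv {pt z} isCompact_singleton (by
      rintro _ rfl
      obtain ⟨d, hd, hr⟩ := exists_rep_pt hz0
      rw [mem_ofPred_eq, submodule_le_perp_iff hY, hr, herm_smul_left, ← dualVec_dotProduct]
      exact mul_ne_zero hd hz2) V hV
    exact this.mono fun m hm => hm _ rfl
  exact tendsto_nhds_unique h1 h2

variable {X Y : Fin (n + 1) → ℂ} {T : Matrix (Fin (n + 1)) (Fin (n - 1)) ℂ}

/-- Only the points spanned by `b` and `c` matter: the vectors can be rescaled to `X` and `Y`, after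
which the normalized remainder is unitary. -/
lemma IsFrame.exists_mem_unitaryLimits (hF : IsFrame X Y T) {Γ : Subgroup (PGL n)}
    {g : ℕ → GL (Fin (n + 1)) ℂ} (hg : ∀ m, g m ∈ U1 n ∧ Matrix.ProjGenLinGroup.mk (g m) ∈ Γ)
    {b c : Fin (n + 1) → ℂ} {R : Matrix (Fin (n + 1)) (Fin (n + 1)) ℂ}
    (hlim : RankOneLimit (fun m => (g m).1) b (dualVec c) R) (hb : b ≠ 0) (hc : c ≠ 0)
    (hbX : pt b = pt X) (hcY : pt c = pt Y) :
    ∃ A ∈ unitaryLimits Γ X Y T,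
      RankOneLimit (fun m => (g m).1) X (dualVec Y) (blockMap T A.1) := by
  obtain ⟨β, hβ, rfl⟩ := exists_smul_of_pt_eq hF.ne_zero hb hbX.symm
  obtain ⟨δ, hδ, rfl⟩ := exists_smul_of_pt_eq hF.symm.ne_zero hc hcY.symm
  have hδ' : star δ ≠ 0 := star_ne_zero.2 hδ
  have hlim2 := hlim.scale (inv_ne_zero hβ) (inv_ne_zero hδ')
  rw [dualVec_smul, smul_smul, smul_smul, inv_mul_cancel₀ hβ, inv_mul_cancel₀ hδ', one_smul,
    one_smul] at hlim2
  obtain ⟨R', hR', hR'X, hYR'⟩ := hlim2.exists_normalized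
    (by rw [dualVec_dotProduct, hF.herm_left_right])
  obtain ⟨A, hA, rfl⟩ := hF.exists_unitary (fun m => (hg m).1) hR' hR'X hYR'
  exact ⟨⟨A, hA⟩, ⟨g, hg, hR'⟩, hR'⟩

/-- A Cartan map is induced by a unitary matrix. -/
theorem IsFrame.exists_unitary_of_isCartanMap (hF : IsFrame X Y T) (hn : n ≠ 0)
    {Γ : Subgroup (PGL n)} {μ : Pencil (pt Y) ≃ Pencil (pt X)}
    (hμ : IsCartanMap Γ (pt Y) (pt X) μ) :
    ∃ A ∈ unitaryLimits Γ X Y T, IsInducedBy T μ A.1 := by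
  obtain ⟨γ, hγΓ, hγs, hγ1, hγ2, hγ3, -⟩ := hμ
  obtain ⟨g, hg, b, c, R, hb, hc, -, -, hlim⟩ :=
    exists_rankOneLimit_of_tendsSimplyToInfinity hn hγs
  obtain rfl : γ = fun m => Matrix.ProjGenLinGroup.mk (g m) := funext fun m => (hg m).2
  have hg' : ∀ m, g m ∈ U1 n := fun m => (hg m).1
  have hX0 := hF.ne_zero
  have hY0 := hF.symm.ne_zero
  have hbX := hlim.pt_eq_of_converges hb hc hY0 hγ1
  have hγ2' : ConvergesUniformlyOnCompacts
      (fun m => Matrix.ProjGenLinGroup.mk ((g m)⁻¹)) {z | ¬ z.submodule ≤ perp (pt X)} (pt Y) := by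
    simpa only [map_inv] using hγ2
  have hcY := (hlim.inv hg').pt_eq_of_converges (g := fun m => (g m)⁻¹) hc hb hX0 hγ2'
  obtain ⟨⟨A, hA⟩, hAS, hR'⟩ := hF.exists_mem_unitaryLimits (fun m => ⟨hg' m, hγΓ m⟩) hlim hb hc
    hbX hcY
  refine ⟨⟨A, hA⟩, hAS, ?_⟩
  intro ℓ v hv
  by_cases hv0 : v = 0
  · simp [hv0]
  have hA' := hA
  rw [Matrix.mem_unitaryGroup_iff', Matrix.star_eq_conjTranspose] at hA'
  have hAv : A *ᵥ v ≠ 0 := mulVec_ne_zero_of_mul_eq_one hA' hv0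
  -- `μ ℓ` and `ν ℓ` have the same points, as both are the dynamical set of any point of `ℓ` other
  -- than `y`; so `μ` inherits the matrix from `ν`.
  obtain ⟨ν, hν, -⟩ := hF.exists_inducedEquiv hA'
  have hTv := hF.mulVec_ne_zero hv0
  have hwℓ : pt (T *ᵥ v) ∈ ℓ.points := by
    change (pt (T *ᵥ v)).submodule ≤ ℓ.1
    rw [submodule_pt hTv, Submodule.span_singleton_le_iff_mem]
    exact hv
  have hwY : pt (T *ᵥ v) ≠ pt Y := by
    intro h
    obtain ⟨c, hc, h1⟩ := exists_smul_of_pt_eq hTv hY0 h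
    have h2 := hF.herm_right_left
    rw [h1, herm_smul_left, hF.orthogonal_left, mul_zero] at h2
    exact zero_ne_one h2
  have h1 := hγ3 ℓ _ hwℓ hwY
  rw [hF.dynSet_eq hA hR' hν ℓ hwℓ hwY] at h1
  have hTAv := hF.mulVec_ne_zero hAv
  have h2 : pt (T *ᵥ (A *ᵥ v)) ∈ (ν ℓ).points := by
    change (pt (T *ᵥ (A *ᵥ v))).submodule ≤ (ν ℓ).1
    rw [submodule_pt hTAv, Submodule.span_singleton_le_iff_mem]
    exact hν ℓ v hv
  rw [h1] at h2
  change (pt (T *ᵥ (A *ᵥ v))).submodule ≤ (μ ℓ).1 at h2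
  rwa [submodule_pt hTAv, Submodule.span_singleton_le_iff_mem] at h2

/-- Conversely, the unitary matrices in `unitaryLimits` induce Cartan maps. -/
theorem IsFrame.exists_isCartanMap (hF : IsFrame X Y T) (hn : n ≠ 0)
    {Γ : Subgroup (PGL n)} {A : Matrix.unitaryGroup (Fin (n - 1)) ℂ}
    (hA : A ∈ unitaryLimits Γ X Y T) :
    ∃ μ : Pencil (pt Y) ≃ Pencil (pt X), IsCartanMap Γ (pt Y) (pt X) μ ∧ IsInducedBy T μ A.1 := by
  obtain ⟨g, hg, hlim⟩ := hA
  have hX0 := hF.ne_zero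
  have hY0 := hF.symm.ne_zero
  have hA' := A.2
  rw [Matrix.mem_unitaryGroup_iff', Matrix.star_eq_conjTranspose] at hA'
  have hAs : A.1ᴴ ∈ Matrix.unitaryGroup (Fin (n - 1)) ℂ := by
    rw [Matrix.mem_unitaryGroup_iff, Matrix.star_eq_conjTranspose,
      Matrix.conjTranspose_conjTranspose]
    exact hA'
  obtain ⟨μ, hμ, hμ'⟩ := hF.exists_inducedEquiv hA'
  -- The definition of `unitaryLimits` asks for neither distinct terms nor convergent Cartan
  -- factors; a subsequence has both and keeps the same limit matrix.
  obtain ⟨φ, hφ, hsimple⟩ := exists_subseq_tendsSimplyToInfinity hn (fun m => (hg m).1)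
    (hlim.tendsto_entrySum hX0 (dualVec_ne_zero hY0))
  have hlim' : RankOneLimit (fun m => (g (φ m)).1) X (dualVec Y) (blockMap T A.1) :=
    hlim.comp hφ.tendsto_atTop
  have hinv := hlim'.inv fun m => (hg (φ m)).1
  rw [blockMap_adjoint] at hinv
  refine ⟨μ, ⟨fun m => Matrix.ProjGenLinGroup.mk (g (φ m)), fun m => (hg _).2, hsimple,
    hlim'.convergesUniformlyOnCompacts hX0 hY0, ?_, fun ℓ w hw hwY => ?_,
    fun ℓ w hw hwX => ?_⟩, hμ⟩
  · simp only [← map_inv]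
    exact hinv.convergesUniformlyOnCompacts (g := fun m => (g (φ m))⁻¹) hY0 hX0
  · exact hF.dynSet_eq A.2 hlim' hμ ℓ hw hwY
  · simp only [← map_inv]
    exact hF.symm.dynSet_eq (g := fun m => (g (φ m))⁻¹) hAs hinv hμ' ℓ hw hwX

end Pencils

/-! ### The unitary group and its centre -/

section UnitaryGroup

variable {k : ℕ}

lemma eq_smul_one_of_forall_mulVec {A : Matrix (Fin k) (Fin k) ℂ}
    (h : ∀ v, ∃ c : ℂ, A *ᵥ v = c • v) : ∃ c : ℂ, A = c • 1 := by
  obtain ⟨a, ha⟩ := (Matrix.toLin' A).exists_eq_smul_id_of_forall_notLinearIndependent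
    fun v => by
      by_cases hv : v = 0
      · simp [hv, linearIndependent_fin2]
      · rw [LinearIndependent.pair_iff' hv]
        push Not
        obtain ⟨c, hc⟩ := h v
        exact ⟨c, hc.symm⟩
  refine ⟨a, Matrix.toLin'.injective ?_⟩
  rw [ha, map_smul, Matrix.toLin'_one]
  rfl

instance compactSpace_unitaryGroup : CompactSpace (Matrix.unitaryGroup (Fin k) ℂ) := by
  refine isCompact_iff_compactSpace.1 (?_ : IsCompact
    ((Matrix.unitaryGroup (Fin k) ℂ : Set (Matrix (Fin k) (Fin k) ℂ))))
  have hb : IsCompact (univ.pi fun _ : Fin k => univ.pi fun _ : Fin k =>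
      Metric.closedBall (0 : ℂ) 1) :=
    isCompact_univ_pi fun _ => isCompact_univ_pi fun _ => isCompact_closedBall _ _
  refine hb.of_isClosed_subset (isClosed_unitary (R := Matrix (Fin k) (Fin k) ℂ)) ?_
  intro U hU i _ j _
  rw [mem_closedBall_zero_iff]
  exact entry_norm_bound_of_unitary hU i j

instance firstCountableTopology_unitaryGroup :
    FirstCountableTopology (Matrix.unitaryGroup (Fin k) ℂ) :=
  have : FirstCountableTopology (Matrix (Fin k) (Fin k) ℂ) :=
    inferInstanceAs (FirstCountableTopology (Fin k → Fin k → ℂ))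
  Topology.IsInducing.subtypeVal.firstCountableTopology

/-- The center of the unitary group consists of scalar matrices. -/
lemma exists_smul_one_of_mem_center {U : Matrix.unitaryGroup (Fin k) ℂ}
    (hU : U ∈ Subgroup.center (Matrix.unitaryGroup (Fin k) ℂ)) :
    ∃ c : ℂ, ‖c‖ = 1 ∧ U.1 = c • 1 := by
  have hv : ∀ v, ∃ c : ℂ, U.1 *ᵥ v = c • v := by
    intro v
    by_cases hv : v = 0
    · exact ⟨0, by simp [hv]⟩
    set s : ℂ := star v ⬝ᵥ v with hs
    have hs0 : s ≠ 0 := by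
      rw [hs, star_dotProduct_self, Ne, Complex.ofReal_eq_zero, sum_normSq_eq_zero]
      exact hv
    have hss : star s = s := by
      rw [hs, star_dotProduct_self]
      exact Complex.conj_ofReal _
    set V := Matrix.vecMulVec v (star v) with hV
    have hVV : V * V = s • V := by
      rw [hV, Matrix.vecMulVec_mul_vecMulVec, ← hs]
      ext i j
      simp [Matrix.vecMulVec_apply]; ring
    have hVs : Vᴴ = V := by rw [hV, Matrix.conjTranspose_vecMulVec, star_star]
    -- A central `U` commutes with the reflection in the hyperplane orthogonal to `v`, hence with
    -- the projection to the line of `v`, so `v` is an eigenvector.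
    have hP : 1 - (2 / s) • V ∈ Matrix.unitaryGroup (Fin k) ℂ := by
      rw [Matrix.mem_unitaryGroup_iff, Matrix.star_eq_conjTranspose, Matrix.conjTranspose_sub,
        Matrix.conjTranspose_one, Matrix.conjTranspose_smul, hVs]
      have h2 : star (2 / s) = 2 / s := by rw [star_div₀, hss]; simp
      rw [h2, mul_sub, mul_one, sub_mul, one_mul, Matrix.smul_mul, Matrix.mul_smul, hVV, smul_smul,
        smul_smul]
      have : 2 / s * (2 / s) * s = 2 * (2 / s) := by field_simp
      rw [this, mul_smul, two_smul]
      abel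
    have hcomm := congrArg Subtype.val (Subgroup.mem_center_iff.1 hU ⟨_, hP⟩)
    simp only [Submonoid.coe_mul] at hcomm
    have hc : V * U.1 = U.1 * V := by
      rw [sub_mul, mul_sub, one_mul, mul_one, sub_right_inj, Matrix.smul_mul,
        Matrix.mul_smul] at hcomm
      exact smul_right_injective _ (div_ne_zero two_ne_zero hs0) hcomm
    have h3 := congrArg (fun M => M *ᵥ v) hc
    simp only [← Matrix.mulVec_mulVec, hV, Matrix.vecMulVec_mulVec, op_smul_eq_smul,
      Matrix.mulVec_smul] at h3
    rw [← hs] at h3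
    refine ⟨s⁻¹ * (star v ⬝ᵥ U.1 *ᵥ v), ?_⟩
    rw [mul_smul, h3, smul_smul, inv_mul_cancel₀ hs0, one_smul]
  obtain ⟨c, hc⟩ := eq_smul_one_of_forall_mulVec hv
  rcases isEmpty_or_nonempty (Fin k) with hk | ⟨⟨i⟩⟩
  · exact ⟨1, norm_one, by ext i; exact hk.elim i⟩
  · refine ⟨c, ?_, hc⟩
    have h1 := U.2
    rw [Matrix.mem_unitaryGroup_iff, Matrix.star_eq_conjTranspose, hc, Matrix.conjTranspose_smul,
      Matrix.conjTranspose_one, Matrix.smul_mul, Matrix.mul_smul, smul_smul, one_mul] at h1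
    have h2 := congrFun (congrFun h1 i) i
    simp only [Matrix.smul_apply, Matrix.one_apply_eq, smul_eq_mul, mul_one] at h2
    have h3 : ‖c‖ * ‖c‖ = 1 := by
      have := congrArg norm h2
      rwa [norm_mul, norm_star, norm_one] at this
    nlinarith [norm_nonneg c]

lemma mem_center_of_eq_smul_one {U : Matrix.unitaryGroup (Fin k) ℂ} {c : ℂ} (h : U.1 = c • 1) :
    U ∈ Subgroup.center (Matrix.unitaryGroup (Fin k) ℂ) := by
  rw [Subgroup.mem_center_iff]
  intro V
  apply Subtype.ext
  simp [h]

end UnitaryGroup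

/-- A nonempty compact subsemigroup of a topological group is a subgroup. -/
lemma exists_subgroup_of_isCompact {G : Type*} [Group G] [TopologicalSpace G] [T2Space G]
    [ContinuousMul G] {s : Set G} (hs : IsCompact s) (hne : s.Nonempty)
    (hmul : ∀ a ∈ s, ∀ b ∈ s, a * b ∈ s) : ∃ H : Subgroup G, (H : Set G) = s := by
  have hinv : ∀ a ∈ s, a⁻¹ ∈ s := by
    intro a ha
    -- The compact semigroup `a s` contains an idempotent, which in a group can only be `1`; so `a`
    -- has its inverse in `s`.
    obtain ⟨e, ⟨b, hb, hbe⟩, hee⟩ := exists_idempotent_in_compact_subsemigroup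
      (fun r : G => continuous_mul_const r) ((fun b => a * b) '' s) (hne.image _)
      (hs.image (continuous_const_mul a)) (by
        rintro _ ⟨b, hb, rfl⟩ _ ⟨c, hc, rfl⟩
        exact ⟨b * (a * c), hmul _ hb _ (hmul _ ha _ hc), by simp only [mul_assoc]⟩)
    have he : e = 1 := by simpa using hee
    have hbe' : a * b = e := hbe
    rwa [inv_eq_of_mul_eq_one_right (hbe'.trans he)]
  obtain ⟨a, ha⟩ := hne
  exact ⟨⟨⟨⟨s, fun {a b} ha hb => hmul a ha b hb⟩, by
    simpa using hmul _ ha _ (hinv a ha)⟩, fun {a} ha => hinv a ha⟩, rfl⟩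

/-! ### The closed group of limit matrices -/

section Limits

variable {n : ℕ} {X Y : Fin (n + 1) → ℂ} {T : Matrix (Fin (n + 1)) (Fin (n - 1)) ℂ}
  {Γ : Subgroup (PGL n)}

/-- The termwise product of the two sequences works: the inner pairing is `⟨X, Y⟩ = 1`, and the
correction term of `RankOneLimit.mul` vanishes because the remainder kills `X`. -/
lemma IsFrame.mul_mem_unitaryLimits (hF : IsFrame X Y T) {A B : Matrix.unitaryGroup (Fin (n - 1)) ℂ}
    (hA : A ∈ unitaryLimits Γ X Y T) (hB : B ∈ unitaryLimits Γ X Y T) :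
    A * B ∈ unitaryLimits Γ X Y T := by
  obtain ⟨g, hg, h⟩ := hA
  obtain ⟨g', hg', h'⟩ := hB
  refine ⟨fun m => g m * g' m, fun m => ⟨(U1 n).mul_mem (hg m).1 (hg' m).1, ?_⟩, ?_⟩
  · rw [map_mul]
    exact Γ.mul_mem (hg m).2 (hg' m).2
  · have := h.mul h' (by rw [dualVec_dotProduct, hF.herm_left_right]; exact one_ne_zero)
    rwa [hF.blockMap_left, Matrix.zero_vecMulVec, smul_zero, sub_zero, hF.blockMap_mul] at this

lemma isClosed_unitaryLimits : IsClosed (unitaryLimits Γ X Y T) := by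
  apply IsSeqClosed.isClosed
  intro As A hAs hA
  choose g hg h using hAs
  have hA' : Tendsto (fun j => (As j).1) atTop (𝓝 A.1) := (continuous_subtype_val.tendsto A).comp hA
  obtain ⟨φ, hφ⟩ := RankOneLimit.exists_diagonal (R := blockMap T A.1) h
    ((tendsto_const_nhds.matrix_mul hA').matrix_mul tendsto_const_nhds)
  exact ⟨fun j => g j (φ j), fun j => hg j (φ j), hφ⟩

/-- If there is a sequence contracting to `X` whose inverse contracts to `Y`, the unitary matrices
arising from such sequences form a closed group. -/
theorem IsFrame.exists_subgroup_eq_unitaryLimits (hF : IsFrame X Y T)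
    (hne : (unitaryLimits Γ X Y T).Nonempty) :
    ∃ S : Subgroup (Matrix.unitaryGroup (Fin (n - 1)) ℂ), (S : Set _) = unitaryLimits Γ X Y T ∧
      IsClosed (S : Set (Matrix.unitaryGroup (Fin (n - 1)) ℂ)) := by
  have hcl := isClosed_unitaryLimits (Γ := Γ) (X := X) (Y := Y) (T := T)
  obtain ⟨S, hS⟩ := exists_subgroup_of_isCompact hcl.isCompact hne
    fun A hA B hB => hF.mul_mem_unitaryLimits hA hB
  exact ⟨S, hS, by rwa [hS]⟩

end Limits

/-! ### Limit points and existence of contracting sequences -/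

section LimitSet

variable {n : ℕ} {Γ : Subgroup (PGL n)}

instance firstCountableTopology_CP : FirstCountableTopology (CP n) :=
  ⟨fun p => by rw [← pt_rep p, ← map_nhds_pt p.rep_nonzero]; infer_instance⟩

lemma ne_zero_of_mem_boundary {x : CP n} (hx : x ∈ boundary n) : n ≠ 0 := by
  rintro rfl
  have h : herm x.rep x.rep = 0 := hx
  rw [herm_apply, Fin.sum_univ_one] at h
  have h0 : x.rep 0 = 0 := by simpa using h
  exact x.rep_nonzero (funext fun i => by rw [Fin.fin_one_eq_zero i, h0]; rfl)

lemma mem_boundary_iff {v : Fin (n + 1) → ℂ} (hv : v ≠ 0) : pt v ∈ boundary n ↔ herm v v = 0 := by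
  obtain ⟨d, hd, hr⟩ := exists_rep_pt hv
  change herm (pt v).rep (pt v).rep = 0 ↔ _
  rw [hr, herm_smul_left, herm_smul_right]
  simp [hd]

lemma exists_lift (hΓ : Γ ≤ PU1 n) {γ : PGL n} (hγ : γ ∈ Γ) :
    ∃ g ∈ U1 n, Matrix.ProjGenLinGroup.mk g = γ := hΓ hγ

/-- A convergent orbit of a point off the repelling hyperplane tends to the attracting point. -/
lemma RankOneLimit.pt_eq_of_tendsto {g : ℕ → GL (Fin (n + 1)) ℂ} {b c z : Fin (n + 1) → ℂ}
    {R : Matrix (Fin (n + 1)) (Fin (n + 1)) ℂ}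
    (h : RankOneLimit (fun m => (g m).1) b (dualVec c) R) (hb : b ≠ 0) (hz : z ≠ 0)
    (hzc : herm z c ≠ 0) {x : CP n}
    (hx : Tendsto (fun m => (Matrix.ProjGenLinGroup.mk (g m) : PGL n) • pt z) atTop (𝓝 x)) :
    pt b = x := by
  have e : Tendsto (fun m : ℕ => (m, pt z)) atTop (atTop ×ˢ 𝓝 (pt z)) :=
    tendsto_id.prodMk tendsto_const_nhds
  have k := h.tendsto_pt hb hz (by rwa [dualVec_dotProduct])
  have k' := k.comp e
  simp only [Function.comp_def] at k'
  exact tendsto_nhds_unique k' hx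

/-- A point of the limit set is the attracting point of a sequence in the group. -/
lemma exists_rankOneLimit_of_mem_limitSet (hΓ : Γ ≤ PU1 n) {x : CP n} (hx : x ∈ limitSet Γ) :
    ∃ g : ℕ → GL (Fin (n + 1)) ℂ, (∀ m, g m ∈ U1 n ∧ Matrix.ProjGenLinGroup.mk (g m) ∈ Γ) ∧
      ∃ (b c : Fin (n + 1) → ℂ) (R : Matrix (Fin (n + 1)) (Fin (n + 1)) ℂ),
        b ≠ 0 ∧ c ≠ 0 ∧ herm b b = 0 ∧ herm c c = 0 ∧ pt b = x ∧
        RankOneLimit (fun m => (g m).1) b (dualVec c) R := by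
  obtain ⟨hxb, z, hz, hacc⟩ := hx
  have hn := ne_zero_of_mem_boundary hxb
  have hz' : (herm z.rep z.rep).re < 0 := hz
  have hcl : x ∈ closure (MulAction.orbit Γ z) := mem_closure_iff_clusterPt.2 hacc.clusterPt
  obtain ⟨u, hu, hux⟩ := mem_closure_iff_seq_limit.1 hcl
  choose γ hγ using hu
  choose g hg hgγ using fun m => exists_lift hΓ (γ m).2
  have hgu : ∀ m, (Matrix.ProjGenLinGroup.mk (g m) : PGL n) • pt z.rep = u m := fun m => by
    rw [hgγ, pt_rep]; exact hγ m
  -- A bounded subsequence would converge in `U(1, n)`, and the orbit of the negative point `z`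
  -- would accumulate at a negative point instead of the null point `x`.
  have hunb : Tendsto (fun m => entrySum (g m).1) atTop atTop := by
    rw [tendsto_atTop]
    by_contra! hcon
    obtain ⟨C, hC⟩ := hcon
    obtain ⟨φ, hφ, hφC⟩ := extraction_of_frequently_atTop hC
    obtain ⟨ψ, hψ, g0, hg0, hlim⟩ := exists_tendsto_of_entrySum_le (fun m => hg (φ m))
      (C := C) fun m => (hφC m).le
    have h1 : Tendsto (fun m => (g (φ (ψ m))).1 *ᵥ z.rep) atTop (𝓝 (g0.1 *ᵥ z.rep)) :=
      hlim.matrix_mulVec tendsto_const_nhds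
    have h2 : g0.1 *ᵥ z.rep ≠ 0 := mulVec_ne_zero_of_GL g0 z.rep_nonzero
    have h3 := (continuousAt_pt h2).tendsto.comp h1
    have h4 : Tendsto (fun m => u (φ (ψ m))) atTop (𝓝 (pt (g0.1 *ᵥ z.rep))) := by
      refine h3.congr fun m => ?_
      rw [← hgu, mk_smul_pt _ z.rep_nonzero]; rfl
    have h5 := tendsto_nhds_unique h4 ((hux.comp hφ.tendsto_atTop).comp hψ.tendsto_atTop)
    rw [← h5, mem_boundary_iff h2, herm_mulVec_U1 hg0] at hxb
    rw [hxb] at hz'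
    simp at hz'
  obtain ⟨φ, hφ, hsimple⟩ := exists_subseq_tendsSimplyToInfinity hn hg hunb
  obtain ⟨g', hg', b, c, R, hb, hc, hbb, hcc, hlim⟩ :=
    exists_rankOneLimit_of_tendsSimplyToInfinity hn hsimple
  refine ⟨g', fun m => ⟨(hg' m).1, ?_⟩, b, c, R, hb, hc, hbb, hcc, ?_, hlim⟩
  · rw [← (hg' m).2, hgγ]
    exact (γ _).2
  · refine hlim.pt_eq_of_tendsto hb z.rep_nonzero (fun h0 => ?_)
      (x := x) ((hux.comp hφ.tendsto_atTop).congr fun m => ?_)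
    · exact absurd (herm_re_nonneg hc hcc h0) (not_le.2 hz')
    · rw [← (hg' m).2, hgu]; rfl

/-- A group with a sequence contracting to each of two points contains a sequence contracting to
one of them whose inverse contracts to the other one, unless it has a global fixed point. -/
lemma IsFrame.unitaryLimits_nonempty {X Y : Fin (n + 1) → ℂ}
    {T : Matrix (Fin (n + 1)) (Fin (n - 1)) ℂ} (hF : IsFrame X Y T) (hΓ : Γ ≤ PU1 n)
    (hX : pt X ∈ limitSet Γ) (hY : pt Y ∈ limitSet Γ)
    (hfix : ∀ P, P ≠ 0 → herm P P = 0 → ∃ h ∈ U1 n, Matrix.ProjGenLinGroup.mk h ∈ Γ ∧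
      ∀ c : ℂ, h.1 *ᵥ P ≠ c • P) :
    (unitaryLimits Γ X Y T).Nonempty := by
  obtain ⟨g, hg, b, c, R, hb, hc, hbb, hcc, hbX, hlim⟩ := exists_rankOneLimit_of_mem_limitSet hΓ hX
  obtain ⟨g', hg', b', c', R', hb', hc', hbb', hcc', hbY, hlim'⟩ :=
    exists_rankOneLimit_of_mem_limitSet hΓ hY
  -- This is the condition for multiplying the rank one limits of `g m * h` and `(g' m)⁻¹`. If it
  -- always fails, then `h = 1` shows that `c'` is a multiple of `c`, and every other `h` fixes the
  -- point of `c`, contrary to `hfix`.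
  have hex : ∃ h ∈ U1 n, Matrix.ProjGenLinGroup.mk h ∈ Γ ∧ herm (h.1 *ᵥ c') c ≠ 0 := by
    by_contra! hcon
    have h1 := hcon 1 (U1 n).one_mem (by rw [map_one]; exact Γ.one_mem)
    rw [Units.val_one, Matrix.one_mulVec] at h1
    obtain ⟨s, rfl⟩ := exists_smul_eq_of_null hcc' hcc h1 hc
    have hs : s ≠ 0 := by rintro rfl; simp at hc'
    obtain ⟨h, hh, hhΓ, hne⟩ := hfix c hc hcc
    have h2 := hcon h hh hhΓ
    rw [Matrix.mulVec_smul, herm_smul_left] at h2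
    obtain ⟨d, hd⟩ := exists_smul_eq_of_null ((herm_mulVec_U1 hh _ _).trans hcc) hcc
      ((mul_eq_zero.1 h2).resolve_left hs) hc
    exact hne d hd
  obtain ⟨h, hh, hhΓ, hne⟩ := hex
  have hl := (hlim.mul_tendsto (tendsto_const_nhds (x := h.1))).mul
    (hlim'.inv fun m => (hg' m).1)
    (by rwa [← Matrix.dotProduct_mulVec, dualVec_dotProduct])
  have hl' : RankOneLimit (fun m => (g m * h * (g' m)⁻¹).1) b (dualVec b') _ := hl
  obtain ⟨A, hA, -⟩ := hF.exists_mem_unitaryLimits (g := fun m => g m * h * (g' m)⁻¹) (Γ := Γ)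
    (fun m => ⟨(U1 n).mul_mem ((U1 n).mul_mem (hg m).1 hh) ((U1 n).inv_mem (hg' m).1), by
      rw [map_mul, map_mul, map_inv]
      exact Γ.mul_mem (Γ.mul_mem (hg m).2 hhΓ) (Γ.inv_mem (hg' m).2)⟩) hl' hb hb' hbX hbY
  exact ⟨A, hA⟩

end LimitSet

/-! ### A non-elementary discrete group has no fixed boundary point -/

section FixedPoint

variable {n : ℕ} {Γ : Subgroup (PGL n)}

lemma pow_mulVec_eigen {g : GL (Fin (n + 1)) ℂ} {P : Fin (n + 1) → ℂ} {c : ℂ}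
    (h : g.1 *ᵥ P = c • P) (m : ℕ) : (g ^ m).1 *ᵥ P = c ^ m • P := by
  induction m with
  | zero => simp
  | succ m ih =>
    rw [pow_succ, Units.val_mul, ← Matrix.mulVec_mulVec, h, Matrix.mulVec_smul, ih, smul_smul,
      pow_succ, mul_comm]

lemma inv_mulVec_eigen {g : GL (Fin (n + 1)) ℂ} {P : Fin (n + 1) → ℂ} {c : ℂ} (hP : P ≠ 0)
    (h : g.1 *ᵥ P = c • P) : c ≠ 0 ∧ (g⁻¹).1 *ᵥ P = c⁻¹ • P := by
  have hc : c ≠ 0 := by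
    rintro rfl
    rw [zero_smul] at h
    exact mulVec_ne_zero_of_GL g hP h
  refine ⟨hc, ?_⟩
  have h1 : (g⁻¹).1 *ᵥ (g.1 *ᵥ P) = P := by
    rw [Matrix.mulVec_mulVec, ← Units.val_mul, inv_mul_cancel, Units.val_one, Matrix.one_mulVec]
  rw [h, Matrix.mulVec_smul] at h1
  rw [← h1, smul_smul, inv_mul_cancel₀ hc, one_smul, h1]

lemma inv_mulVec_mulVec (g : GL (Fin (n + 1)) ℂ) (v : Fin (n + 1) → ℂ) :
    (g⁻¹).1 *ᵥ (g.1 *ᵥ v) = v := by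
  rw [Matrix.mulVec_mulVec, ← Units.val_mul, inv_mul_cancel, Units.val_one, Matrix.one_mulVec]

/-- The eigenvalues of an element of `U(1, n)` come in pairs `c`, `(star c)⁻¹`. -/
lemma exists_dual_eigenvector {g : GL (Fin (n + 1)) ℂ} (hg : g ∈ U1 n) {P : Fin (n + 1) → ℂ}
    (hP : P ≠ 0) {c : ℂ} (h : g.1 *ᵥ P = c • P) : ∃ Q ≠ 0, g.1 *ᵥ Q = (star c)⁻¹ • Q := by
  have hdet : (g.1 - c • 1).det = 0 := by
    rw [← Matrix.exists_mulVec_eq_zero_iff]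
    refine ⟨P, hP, ?_⟩
    rw [Matrix.sub_mulVec, h, Matrix.smul_mulVec, Matrix.one_mulVec, sub_self]
  -- A left eigenvector for `c` represents a functional `⟨·, Q⟩`, and `Q` is an eigenvector of
  -- `g⁻¹`, the adjoint of `g`, for the conjugate of `c`.
  obtain ⟨v, hv, hv0⟩ := Matrix.exists_vecMul_eq_zero_iff.2 hdet
  obtain ⟨Q, rfl⟩ := dualVec_surjective v
  have hQ : Q ≠ 0 := by rintro rfl; exact hv dualVec_zero
  refine ⟨Q, hQ, ?_⟩
  have h1 : ∀ z, herm z ((g⁻¹).1 *ᵥ Q + (-star c) • Q) = 0 := by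
    intro z
    rw [herm_add_right, ← herm_mulVec_U1_left hg, herm_smul_right, star_neg, star_star]
    have h2 : dualVec Q ⬝ᵥ ((g.1 - c • 1) *ᵥ z) = 0 := by
      rw [Matrix.dotProduct_mulVec, hv0, zero_dotProduct]
    rw [Matrix.sub_mulVec, Matrix.smul_mulVec, Matrix.one_mulVec, dotProduct_sub, dotProduct_smul,
      dualVec_dotProduct, dualVec_dotProduct, smul_eq_mul] at h2
    rw [neg_mul]
    exact h2
  have h3 := eq_zero_of_herm_eq_zero h1
  rw [neg_smul, add_neg_eq_zero] at h3
  have h4 := inv_mulVec_eigen hQ h3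
  rw [inv_inv] at h4
  exact h4.2

/-- An eigenvector for an eigenvalue which is not unimodular is a null vector. -/
lemma herm_eq_zero_of_eigen {g : GL (Fin (n + 1)) ℂ} (hg : g ∈ U1 n) {P : Fin (n + 1) → ℂ} {c : ℂ}
    (h : g.1 *ᵥ P = c • P) (hc : ‖c‖ ≠ 1) : herm P P = 0 := by
  have h1 := herm_mulVec_U1 hg P P
  rw [h, herm_smul_left, herm_smul_right] at h1
  by_contra h0
  have h2 : c * star c = 1 := by
    rw [← mul_assoc] at h1
    exact mul_right_cancel₀ h0 (h1.trans (one_mul _).symm)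
  have h3 := congrArg norm h2
  rw [norm_mul, norm_star, norm_one] at h3
  exact hc (by nlinarith [norm_nonneg c])

lemma continuous_mk : Continuous (Matrix.ProjGenLinGroup.mk : GL (Fin (n + 1)) ℂ → PGL n) :=
  QuotientGroup.continuous_mk

/-- In a discrete group, sequences of distinct elements have no bounded lifts. -/
lemma not_bounded_of_injective (hdisc : DiscreteTopology Γ) {g : ℕ → GL (Fin (n + 1)) ℂ}
    (hg : ∀ m, g m ∈ U1 n ∧ Matrix.ProjGenLinGroup.mk (g m) ∈ Γ)
    (hinj : Function.Injective fun m => (Matrix.ProjGenLinGroup.mk (g m) : PGL n)) {C : ℝ}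
    (hC : ∀ m, entrySum (g m).1 ≤ C) : False := by
  obtain ⟨φ, hφ, g0, hg0, hlim⟩ := exists_tendsto_of_entrySum_le (fun m => (hg m).1) hC
  have h1 := tendsto_GL_of_U1 (fun m => (hg (φ m)).1) hg0 hlim
  -- Quotients of consecutive terms of a convergent sequence tend to `1`; in a discrete group they
  -- are eventually `1`, against injectivity.
  have h2 : Tendsto (fun m => g (φ m) * (g (φ (m + 1)))⁻¹) atTop (𝓝 1) := by
    have := h1.mul (h1.comp (tendsto_add_atTop_nat 1)).inv
    rwa [mul_inv_cancel] at this
  have h3 := (continuous_mk.tendsto _).comp h2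
  rw [map_one] at h3
  have hmem : ∀ m, (Matrix.ProjGenLinGroup.mk (g (φ m) * (g (φ (m + 1)))⁻¹) : PGL n) ∈ Γ := by
    intro m
    rw [map_mul, map_inv]
    exact Γ.mul_mem (hg _).2 (Γ.inv_mem (hg _).2)
  have h4 : Tendsto (fun m => (⟨_, hmem m⟩ : Γ)) atTop (𝓝 1) :=
    tendsto_subtype_rng.2 h3
  rw [nhds_discrete, tendsto_pure] at h4
  obtain ⟨m, hm⟩ := h4.exists
  have h5 : (Matrix.ProjGenLinGroup.mk (g (φ m) * (g (φ (m + 1)))⁻¹) : PGL n) = 1 :=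
    congrArg Subtype.val hm
  rw [map_mul, map_inv, mul_inv_eq_one] at h5
  have := hφ.injective (hinj h5)
  omega

lemma RankOneLimit.exists_tendsto_inv_smul_mulVec {k : ℕ} {g : ℕ → Matrix (Fin k) (Fin k) ℂ}
    {b a : Fin k → ℂ} {R : Matrix (Fin k) (Fin k) ℂ} (h : RankOneLimit g b a R) :
    ∃ l : ℕ → ℂ, Tendsto (fun m => (l m)⁻¹) atTop (𝓝 0) ∧ ∀ z,
      Tendsto (fun m => (l m)⁻¹ • (g m *ᵥ z)) atTop (𝓝 ((a ⬝ᵥ z) • b)) := by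
  obtain ⟨l, bs, as, r, h1, h2, h3, h4, h5⟩ := h
  have hl := tendsto_inv_zero_of_norm h2
  refine ⟨l, hl, fun z => ?_⟩
  have t1 := (h4.matrix_dotProduct (tendsto_const_nhds (x := z))).smul h3
  have t2 := hl.smul (h5.matrix_mulVec (tendsto_const_nhds (x := z)))
  have t3 := t1.add t2
  rw [zero_smul, add_zero] at t3
  refine t3.congr' ?_
  filter_upwards [h1, eventually_ne_zero_of_norm h2] with m hm hm0
  rw [hm, Matrix.add_mulVec, Matrix.smul_mulVec, Matrix.vecMulVec_mulVec, op_smul_eq_smul,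
    smul_add, smul_smul, inv_mul_cancel₀ hm0, one_smul]

/-- If a point of the boundary is fixed, with unimodular eigenvalues, there are no other points in
the limit set. -/
lemma mem_limitSet_of_fixed (hΓ : Γ ≤ PU1 n) {P : Fin (n + 1) → ℂ} (hP : P ≠ 0)
    (hPP : herm P P = 0)
    (hfix : ∀ h ∈ U1 n, Matrix.ProjGenLinGroup.mk h ∈ Γ → ∃ c : ℂ, ‖c‖ = 1 ∧ h.1 *ᵥ P = c • P) :
    limitSet Γ ⊆ {pt P} := by
  intro x hx
  obtain ⟨g, hg, b, c, R, hb, hc, hbb, hcc, rfl, hlim⟩ :=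
    exists_rankOneLimit_of_mem_limitSet hΓ hx
  obtain ⟨z, hz⟩ : ∃ z, dualVec c ⬝ᵥ z ≠ 0 := by
    by_contra! h
    exact dualVec_ne_zero hc (dotProduct_eq_zero _ h)
  choose s hs hgs using fun m => hfix _ (hg m).1 (hg m).2
  -- The pairing with `P` keeps its modulus, while `g z` grows like a multiple of `l b`. So `⟨b, P⟩
  -- = 0`, and orthogonal null vectors are proportional.
  have hbd : ∀ m, ‖herm ((g m).1 *ᵥ z) P‖ = ‖herm z P‖ := by
    intro m
    have e := herm_mulVec_U1 (hg m).1 z P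
    rw [hgs, herm_smul_right] at e
    rw [← e, norm_mul, norm_star, hs, one_mul]
  obtain ⟨l, hl, hlz⟩ := hlim.exists_tendsto_inv_smul_mulVec
  have e1 := hlz z
  have e2 : Tendsto (fun m => herm ((l m)⁻¹ • ((g m).1 *ᵥ z)) P) atTop
      (𝓝 (herm ((dualVec c ⬝ᵥ z) • b) P)) :=
    e1.herm_comp tendsto_const_nhds
  have e3 : Tendsto (fun m => herm ((l m)⁻¹ • ((g m).1 *ᵥ z)) P) atTop (𝓝 0) := by
    rw [tendsto_zero_iff_norm_tendsto_zero]
    have := (tendsto_zero_iff_norm_tendsto_zero.1 hl).mul_const ‖herm z P‖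
    rw [zero_mul] at this
    refine this.congr fun m => ?_
    rw [herm_smul_left, norm_mul, hbd]
  have e4 := tendsto_nhds_unique e2 e3
  rw [herm_smul_left] at e4
  obtain ⟨d, rfl⟩ := exists_smul_eq_of_null hbb hPP ((mul_eq_zero.1 e4).resolve_left hz) hP
  have hd : d ≠ 0 := by rintro rfl; simp at hb
  rw [mem_singleton_iff, pt_smul hd hP]

/-- If two points of the boundary are fixed, there are no other points in the limit set. -/
lemma IsFrame.limitSet_subset {X Y : Fin (n + 1) → ℂ} {T : Matrix (Fin (n + 1)) (Fin (n - 1)) ℂ}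
    (hF : IsFrame X Y T) (hΓ : Γ ≤ PU1 n)
    (hX : ∀ h ∈ U1 n, Matrix.ProjGenLinGroup.mk h ∈ Γ → ∃ c : ℂ, h.1 *ᵥ X = c • X)
    (hY : ∀ h ∈ U1 n, Matrix.ProjGenLinGroup.mk h ∈ Γ → ∃ c : ℂ, h.1 *ᵥ Y = c • Y) :
    limitSet Γ ⊆ {pt X, pt Y} := by
  intro x hx
  obtain ⟨g, hg, b, c, R, hb, hc, hbb, hcc, rfl, hlim⟩ :=
    exists_rankOneLimit_of_mem_limitSet hΓ hx
  -- A fixed point off the hyperplane `c^⊥` has a constant orbit converging to the attracting point,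
  -- so it equals it. The null vector `c` cannot be orthogonal to both `X` and `Y`.
  have key : ∀ P, P ≠ 0 → (∀ h ∈ U1 n, Matrix.ProjGenLinGroup.mk h ∈ Γ →
      ∃ c : ℂ, h.1 *ᵥ P = c • P) → herm P c ≠ 0 → pt b = pt P := by
    intro P hP hfix hPc
    refine hlim.pt_eq_of_tendsto hb hP hPc (tendsto_const_nhds.congr fun m => ?_)
    obtain ⟨d, hd⟩ := hfix _ (hg m).1 (hg m).2
    rw [mk_smul_pt _ hP, hd, pt_smul (inv_mulVec_eigen hP hd).1 hP]
  by_cases h1 : herm X c = 0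
  · right
    refine key Y hF.symm.ne_zero hY fun h2 => ?_
    obtain ⟨d, rfl⟩ := exists_smul_eq_of_null hcc hF.herm_left (herm_comm_eq_zero h1) hF.ne_zero
    have hd : d ≠ 0 := by rintro rfl; simp at hc
    rw [herm_smul_right, hF.herm_right_left, mul_one, star_eq_zero] at h2
    exact hd h2
  · left
    exact key X hF.ne_zero hX h1

/-- The orbit under the powers of `g` of a vector with no component along the repelling
eigenvector `X` is bounded. -/
lemma IsFrame.exists_norm_pow_mulVec_le {X Y : Fin (n + 1) → ℂ}
    {T : Matrix (Fin (n + 1)) (Fin (n - 1)) ℂ} (hF : IsFrame X Y T) {g : GL (Fin (n + 1)) ℂ}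
    (hg : g ∈ U1 n) {c d : ℂ} (hd : ‖d‖ < 1) (hgX : g.1 *ᵥ X = c • X) (hgY : g.1 *ᵥ Y = d • Y)
    (s : ℂ) (u : Fin (n - 1) → ℂ) :
    ∃ C, ∀ m : ℕ, ‖(g ^ m).1 *ᵥ (s • Y + T *ᵥ u)‖ ≤ C := by
  have hgm : ∀ m, g ^ m ∈ U1 n := fun m => (U1 n).pow_mem hg m
  -- The powers of `g` fix the lines of `X` and `Y`, so they preserve the orthogonal complement,
  -- where they are isometries of a definite form and stay bounded.
  have hex : ∀ m, ∃ w, (g ^ m).1 *ᵥ (T *ᵥ u) = T *ᵥ w := by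
    intro m
    refine hF.exists_eq _ ?_ ?_
    · rw [herm_mulVec_U1_left (hgm m),
        (inv_mulVec_eigen hF.ne_zero (pow_mulVec_eigen hgX m)).2, herm_smul_right,
        hF.orthogonal_left, mul_zero]
    · rw [herm_mulVec_U1_left (hgm m),
        (inv_mulVec_eigen hF.symm.ne_zero (pow_mulVec_eigen hgY m)).2, herm_smul_right,
        hF.orthogonal_right, mul_zero]
  choose w hw using hex
  have hwn : ∀ m, ‖w m‖ ≤ √(∑ i, Complex.normSq (u i)) := by
    intro m
    have h1 := herm_mulVec_U1 (hgm m) (T *ᵥ u) (T *ᵥ u)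
    rw [hw, hF.isometry, hF.isometry, star_dotProduct_self, star_dotProduct_self] at h1
    have h2 : ∑ i, Complex.normSq (w m i) = ∑ i, Complex.normSq (u i) := by exact_mod_cast h1
    rw [pi_norm_le_iff_of_nonneg (Real.sqrt_nonneg _)]
    intro i
    rw [← h2]
    refine Real.le_sqrt_of_sq_le ?_
    rw [← Complex.normSq_eq_norm_sq]
    exact Finset.single_le_sum (f := fun i => Complex.normSq (w m i))
      (fun j _ => Complex.normSq_nonneg _) (Finset.mem_univ i)
  obtain ⟨C, hC⟩ := (isCompact_closedBall (0 : Fin (n - 1) → ℂ)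
    √(∑ i, Complex.normSq (u i))).exists_bound_of_continuousOn
    (f := fun w => T *ᵥ w) (by fun_prop)
  refine ⟨‖s‖ * ‖Y‖ + C, fun m => ?_⟩
  rw [Matrix.mulVec_add, Matrix.mulVec_smul, pow_mulVec_eigen hgY, hw]
  refine (norm_add_le _ _).trans (add_le_add ?_ (hC _ ?_))
  · rw [norm_smul, norm_smul, norm_pow]
    gcongr
    exact mul_le_of_le_one_left (norm_nonneg _) (pow_le_one₀ (norm_nonneg _) hd.le)
  · rw [mem_closedBall_zero_iff]
    exact hwn m

/-- In a discrete group the fixed points of a loxodromic element are fixed by the stabilizers of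
each other. -/
lemma IsFrame.exists_smul_of_loxodromic {X Y : Fin (n + 1) → ℂ}
    {T : Matrix (Fin (n + 1)) (Fin (n - 1)) ℂ} (hF : IsFrame X Y T) (hdisc : DiscreteTopology Γ)
    {g h : GL (Fin (n + 1)) ℂ} (hg : g ∈ U1 n) (hgΓ : Matrix.ProjGenLinGroup.mk g ∈ Γ)
    (hh : h ∈ U1 n) (hhΓ : Matrix.ProjGenLinGroup.mk h ∈ Γ) {c d e : ℂ} (hc : 1 < ‖c‖)
    (hd : ‖d‖ < 1) (hgX : g.1 *ᵥ X = c • X) (hgY : g.1 *ᵥ Y = d • Y) (hhX : h.1 *ᵥ X = e • X) :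
    ∃ s : ℂ, h.1 *ᵥ Y = s • Y := by
  by_contra! hcon
  have hX0 := hF.ne_zero
  have hY0 := hF.symm.ne_zero
  have hd0 := (inv_mulVec_eigen hY0 hgY).1
  have hgm : ∀ m, g ^ m ∈ U1 n := fun m => (U1 n).pow_mem hg m
  -- If `h` moves `Y`, these conjugates are bounded and pairwise distinct modulo scalars, which
  -- discreteness excludes.
  set f : ℕ → GL (Fin (n + 1)) ℂ := fun m => (g ^ m)⁻¹ * h * g ^ m with hf
  have hfU : ∀ m, f m ∈ U1 n ∧ Matrix.ProjGenLinGroup.mk (f m) ∈ Γ := by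
    intro m
    refine ⟨(U1 n).mul_mem ((U1 n).mul_mem ((U1 n).inv_mem (hgm m)) hh) (hgm m), ?_⟩
    rw [hf, map_mul, map_mul, map_inv, map_pow]
    exact Γ.mul_mem (Γ.mul_mem (Γ.inv_mem (Γ.pow_mem hgΓ m)) hhΓ) (Γ.pow_mem hgΓ m)
  have hfapp : ∀ m z, (f m).1 *ᵥ z = ((g ^ m)⁻¹).1 *ᵥ (h.1 *ᵥ ((g ^ m).1 *ᵥ z)) := by
    intro m z
    rw [hf, Units.val_mul, Units.val_mul, ← Matrix.mulVec_mulVec, ← Matrix.mulVec_mulVec]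
  have hherm : ∀ m u v, herm ((f m).1 *ᵥ u) v
      = herm (h.1 *ᵥ ((g ^ m).1 *ᵥ u)) ((g ^ m).1 *ᵥ v) := by
    intro m u v
    rw [hfapp, herm_mulVec_U1_left ((U1 n).inv_mem (hgm m)), inv_inv]
  -- Split off the `X`-components of `u` and `v`. The terms containing them do not depend on `m`,
  -- because `h X = e X` and `g ^ m` preserves the form; the rest involves only bounded orbits.
  have hbd : ∀ u v, ∃ C, ∀ m, ‖herm ((f m).1 *ᵥ u) v‖ ≤ C := by
    intro u v
    obtain ⟨u', hu⟩ := hF.exists_decomposition u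
    obtain ⟨v', hv⟩ := hF.exists_decomposition v
    obtain ⟨C₁, hC₁⟩ := hF.exists_norm_pow_mulVec_le hg hd hgX hgY (herm u X) u'
    obtain ⟨C₂, hC₂⟩ := hF.exists_norm_pow_mulVec_le hg hd hgX hgY (herm v X) v'
    rw [add_assoc] at hu hv
    set p := herm u X • Y + T *ᵥ u' with hp
    set q := herm v X • Y + T *ᵥ v' with hq
    clear_value p q
    have hcont : Continuous fun z : (Fin (n + 1) → ℂ) × (Fin (n + 1) → ℂ) =>
        herm (h.1 *ᵥ z.1) z.2 :=
      Continuous.herm_comp (by fun_prop) continuous_snd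
    obtain ⟨C, hC⟩ := ((isCompact_closedBall (0 : Fin (n + 1) → ℂ) C₁).prod
      (isCompact_closedBall (0 : Fin (n + 1) → ℂ) C₂)).exists_bound_of_continuousOn
      hcont.continuousOn
    refine ⟨‖herm u Y * (e * herm X v)‖ + (‖star (herm v Y) * (star e⁻¹ * herm p X)‖ + C),
      fun m => ?_⟩
    have e1 : h.1 *ᵥ ((g ^ m).1 *ᵥ X) = e • ((g ^ m).1 *ᵥ X) := by
      rw [pow_mulVec_eigen hgX, Matrix.mulVec_smul, hhX, smul_comm]
    have e2 : (h⁻¹).1 *ᵥ ((g ^ m).1 *ᵥ X) = e⁻¹ • ((g ^ m).1 *ᵥ X) := by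
      rw [pow_mulVec_eigen hgX, Matrix.mulVec_smul, (inv_mulVec_eigen hX0 hhX).2, smul_comm]
    have e3 : herm (h.1 *ᵥ ((g ^ m).1 *ᵥ X)) ((g ^ m).1 *ᵥ v) = e * herm X v := by
      rw [e1, herm_smul_left, herm_mulVec_U1 (hgm m)]
    have e4 : herm (h.1 *ᵥ ((g ^ m).1 *ᵥ p)) ((g ^ m).1 *ᵥ X) = star e⁻¹ * herm p X := by
      rw [herm_mulVec_U1_left hh, e2, herm_smul_right, herm_mulVec_U1 (hgm m)]
    have e5 : herm ((f m).1 *ᵥ u) v = herm u Y * (e * herm X v)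
        + (star (herm v Y) * (star e⁻¹ * herm p X)
          + herm (h.1 *ᵥ ((g ^ m).1 *ᵥ p)) ((g ^ m).1 *ᵥ q)) := by
      rw [hherm]
      conv_lhs => rw [hu]
      rw [Matrix.mulVec_add, Matrix.mulVec_smul, Matrix.mulVec_add, Matrix.mulVec_smul,
        herm_add_left, herm_smul_left, e3]
      congr 1
      conv_lhs => rw [hv]
      rw [Matrix.mulVec_add, Matrix.mulVec_smul, herm_add_right, herm_smul_right, e4]
    rw [e5]
    refine (norm_add_le _ _).trans (add_le_add_right ((norm_add_le _ _).trans
      (add_le_add_right (hC ((g ^ m).1 *ᵥ p, (g ^ m).1 *ᵥ q) ⟨?_, ?_⟩) _)) _)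
    · rw [mem_closedBall_zero_iff]; exact hC₁ m
    · rw [mem_closedBall_zero_iff]; exact hC₂ m
  have hentry : ∀ i j, ∃ C, ∀ m, ‖(f m).1 i j‖ ≤ C := by
    intro i j
    obtain ⟨v, hv⟩ := dualVec_surjective (Pi.single i (1 : ℂ))
    obtain ⟨C, hC⟩ := hbd (Pi.single j 1) v
    refine ⟨C, fun m => ?_⟩
    have := hC m
    rwa [← dualVec_dotProduct, hv, single_dotProduct, one_mul, Matrix.mulVec_single_one] at this
  choose C hC using hentry
  refine not_bounded_of_injective hdisc hfU ?_ (C := ∑ i, ∑ j, C i j) fun m =>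
    Finset.sum_le_sum fun i _ => Finset.sum_le_sum fun j _ => hC i j m
  set Z := h.1 *ᵥ Y with hZ
  have hZZ : herm Z Z = 0 := (herm_mulVec_U1 hh _ _).trans hF.herm_right
  have hZX : herm Z X ≠ 0 := by
    intro h0
    obtain ⟨a, ha⟩ := exists_smul_eq_of_null hZZ hF.herm_left h0 hX0
    have h1 := herm_mulVec_U1 hh X Y
    rw [hhX, ← hZ, ha, herm_smul_left, herm_smul_right, hF.herm_left, hF.herm_left_right] at h1
    simp at h1
  have hZY : herm Z Y ≠ 0 := by
    intro h0
    obtain ⟨a, ha⟩ := exists_smul_eq_of_null hZZ hF.herm_right h0 hY0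
    exact hcon a ha
  -- Equality would make `Z = h Y` an eigenvector of `g ^ k`, `k = j - i > 0`. As `Z` is orthogonal
  -- to neither `X` nor `Y`, its eigenvalue `ν` would satisfy `ν * star (c ^ k) = 1 = ν * star (d ^
  -- k)`, although `‖d‖ < 1 < ‖c‖`.
  have hlt : ∀ i j, i < j →
      (Matrix.ProjGenLinGroup.mk (f i) : PGL n) ≠ Matrix.ProjGenLinGroup.mk (f j) := by
    intro i j hij heq
    obtain ⟨s, hs, hsf⟩ := exists_smul_of_mk_eq (hfU i).1 (hfU j).1 heq
    have hs0 : s ≠ 0 := by rintro rfl; simp at hs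
    have h1 := congrArg (fun M => (g ^ j).1 *ᵥ (M *ᵥ Y)) hsf
    simp only [Matrix.smul_mulVec, hfapp, pow_mulVec_eigen hgY, Matrix.mulVec_smul] at h1
    rw [← hZ] at h1
    have h2 : (g ^ j).1 *ᵥ (((g ^ j)⁻¹).1 *ᵥ Z) = Z := by
      have := inv_mulVec_mulVec (g ^ j)⁻¹ Z
      rwa [inv_inv] at this
    have h3 : (g ^ j).1 *ᵥ (((g ^ i)⁻¹).1 *ᵥ Z) = (g ^ (j - i)).1 *ᵥ Z := by
      rw [Matrix.mulVec_mulVec, ← Units.val_mul, ← pow_sub g hij.le]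
    rw [h2, h3] at h1
    set k := j - i with hk
    have hk0 : k ≠ 0 := by omega
    set ν := (s * d ^ i)⁻¹ * d ^ j with hν
    have h4 : (g ^ k).1 *ᵥ Z = ν • Z := by
      rw [hν, mul_smul, h1, smul_smul, smul_smul, mul_inv_rev]
      field_simp
      simp
    have h5 : ∀ (P : Fin (n + 1) → ℂ) (a : ℂ), g.1 *ᵥ P = a • P → herm Z P ≠ 0 →
        ν * star (a ^ k) = 1 := by
      intro P a ha hP
      have h6 := herm_mulVec_U1 (hgm k) Z P
      rw [h4, pow_mulVec_eigen ha, herm_smul_left, herm_smul_right, ← mul_assoc] at h6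
      exact mul_right_cancel₀ hP (h6.trans (one_mul _).symm)
    have h6 := h5 X c hgX hZX
    have h7 := h5 Y d hgY hZY
    have hν0 : ν ≠ 0 := by rintro h0; rw [h0] at h6; simp at h6
    have h8 := congrArg norm (star_injective (mul_left_cancel₀ hν0 (h6.trans h7.symm)))
    rw [norm_pow, norm_pow] at h8
    have h9 := one_lt_pow₀ hc hk0
    have h10 := pow_lt_one₀ (norm_nonneg d) hd hk0
    linarith
  intro i j hij
  by_contra hne
  rcases lt_or_gt_of_ne hne with h1 | h1
  · exact hlt i j h1 hij
  · exact hlt j i h1 hij.symm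

/-- A discrete group with an infinite limit set has no fixed point in the boundary. -/
theorem exists_not_fixed (hΓ : Γ ≤ PU1 n) (hdisc : DiscreteTopology Γ)
    (hne : (limitSet Γ).Infinite) {P : Fin (n + 1) → ℂ} (hP : P ≠ 0) (hPP : herm P P = 0) :
    ∃ h ∈ U1 n, Matrix.ProjGenLinGroup.mk h ∈ Γ ∧ ∀ c : ℂ, h.1 *ᵥ P ≠ c • P := by
  by_contra! hfix
  have hlox : ∃ g ∈ U1 n, Matrix.ProjGenLinGroup.mk g ∈ Γ ∧ ∃ c : ℂ, 1 < ‖c‖ ∧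
      g.1 *ᵥ P = c • P := by
    by_contra! hcon
    refine hne ((finite_singleton (pt P)).subset (mem_limitSet_of_fixed hΓ hP hPP
      fun h hh hhΓ => ?_))
    obtain ⟨c, hc⟩ := hfix h hh hhΓ
    -- An eigenvalue of modulus less than one is excluded by passing to the inverse element.
    refine ⟨c, le_antisymm (not_lt.1 fun h1 => hcon h hh hhΓ c h1 hc) (not_lt.1 fun h1 => ?_), hc⟩
    obtain ⟨hc0, hci⟩ := inv_mulVec_eigen hP hc
    refine hcon _ ((U1 n).inv_mem hh) (by rw [map_inv]; exact Γ.inv_mem hhΓ) c⁻¹ ?_ hci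
    rw [norm_inv]
    exact (one_lt_inv₀ (norm_pos_iff.2 hc0)).2 h1
  obtain ⟨g, hg, hgΓ, c, hc, hgP⟩ := hlox
  obtain ⟨Q, hQ, hgQ⟩ := exists_dual_eigenvector hg hP hgP
  have hcn : ‖(star c)⁻¹‖ < 1 := by
    rw [norm_inv, norm_star]
    exact inv_lt_one_of_one_lt₀ hc
  have hQQ := herm_eq_zero_of_eigen hg hgQ hcn.ne
  have hPQ : pt P ≠ pt Q := by
    intro h
    obtain ⟨s, hs, rfl⟩ := exists_smul_of_pt_eq hP hQ h
    rw [Matrix.mulVec_smul, hgP, smul_comm s c P] at hgQ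
    have := smul_left_injective ℂ hQ hgQ
    rw [← show c = (star c)⁻¹ from this] at hcn
    exact absurd hc hcn.not_gt
  obtain ⟨X, Y, T, hF, hX, hY⟩ := exists_isFrame ((mem_boundary_iff hP).2 hPP)
    ((mem_boundary_iff hQ).2 hQQ) hPQ
  obtain ⟨α, hα, rfl⟩ := exists_smul_of_pt_eq hP hF.ne_zero hX.symm
  obtain ⟨β, hβ, rfl⟩ := exists_smul_of_pt_eq hQ hF.symm.ne_zero hY.symm
  have hfix' : ∀ h ∈ U1 n, Matrix.ProjGenLinGroup.mk h ∈ Γ →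
      ∃ c : ℂ, h.1 *ᵥ (α • P) = c • (α • P) := by
    intro h hh hhΓ
    obtain ⟨c, hc⟩ := hfix h hh hhΓ
    exact ⟨c, by rw [Matrix.mulVec_smul, hc, smul_comm]⟩
  refine hne (((finite_singleton _).insert _).subset (hF.limitSet_subset hΓ hfix'
    fun h hh hhΓ => ?_))
  obtain ⟨e, he⟩ := hfix' h hh hhΓ
  exact hF.exists_smul_of_loxodromic hdisc hg hgΓ hh hhΓ hc hcn
    (by rw [Matrix.mulVec_smul, hgP, smul_comm]) (by rw [Matrix.mulVec_smul, hgQ, smul_comm]) he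

end FixedPoint

/-! ### The faithful conjugation representation of `PU(k)` -/

section Adjoint

variable {k : ℕ}

/-- The action of the unitary group on the space of matrices by conjugation. -/
noncomputable def unitaryConj (k : ℕ) :
    Matrix.unitaryGroup (Fin k) ℂ →* ((Fin k → Fin k → ℂ) →L[ℝ] (Fin k → Fin k → ℂ)) where
  toFun A := LinearMap.toContinuousLinearMap
    { toFun := fun M => A.1 * Matrix.of M * A.1ᴴ
      map_add' := fun M N => by
        rw [← Matrix.of_add_of, Matrix.mul_add, Matrix.add_mul]; rfl
      map_smul' := fun c M => by
        rw [← Matrix.smul_of, Matrix.mul_smul, Matrix.smul_mul]; rfl }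
  map_one' := by
    ext M : 1
    change (1 : Matrix (Fin k) (Fin k) ℂ) * Matrix.of M * (1 : Matrix (Fin k) (Fin k) ℂ)ᴴ = M
    rw [Matrix.conjTranspose_one, Matrix.one_mul, Matrix.mul_one]; rfl
  map_mul' A B := by
    ext M : 1
    change (A.1 * B.1) * Matrix.of M * (A.1 * B.1)ᴴ = A.1 * (B.1 * Matrix.of M * B.1ᴴ) * A.1ᴴ
    simp only [Matrix.conjTranspose_mul, Matrix.mul_assoc]

lemma unitaryConj_apply (A : Matrix.unitaryGroup (Fin k) ℂ) (M : Fin k → Fin k → ℂ) :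
    unitaryConj k A M = A.1 * Matrix.of M * A.1ᴴ := rfl

lemma continuous_unitaryConj : Continuous (unitaryConj k) := by
  rw [continuous_clm_apply]
  intro M
  simp only [unitaryConj_apply]
  have h : Continuous fun A : Matrix.unitaryGroup (Fin k) ℂ => A.1 := continuous_subtype_val
  refine continuous_iff_continuousAt.2 fun A => ?_
  have hA : Tendsto (fun A : Matrix.unitaryGroup (Fin k) ℂ => A.1) (𝓝 A) (𝓝 A.1) := h.tendsto A
  exact (hA.matrix_mul tendsto_const_nhds).matrix_mul hA.matrix_conjTranspose

/-- Fixing all unitary matrices under conjugation means being central; conversely central elements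
are scalars of modulus one, which act trivially on all matrices. -/
lemma ker_unitaryConj : (unitaryConj k).ker = Subgroup.center (Matrix.unitaryGroup (Fin k) ℂ) := by
  ext A
  rw [MonoidHom.mem_ker]
  have hA := A.2
  rw [Matrix.mem_unitaryGroup_iff', Matrix.star_eq_conjTranspose] at hA
  constructor
  · intro h
    rw [Subgroup.mem_center_iff]
    intro B
    apply Subtype.ext
    have h1 : A.1 * B.1 * A.1ᴴ = B.1 := by
      have := congrArg (fun f => f B.1) h
      exact this
    have h2 := congrArg (fun M => M * A.1) h1
    simp only [Matrix.mul_assoc, hA, Matrix.mul_one] at h2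
    exact h2.symm
  · intro h
    obtain ⟨c, hc, hAc⟩ := exists_smul_one_of_mem_center h
    have hA' := mul_eq_one_comm.1 hA
    ext M : 1
    rw [unitaryConj_apply]
    have h1 : A.1 * Matrix.of M = Matrix.of M * A.1 := by
      rw [hAc, Matrix.smul_mul, Matrix.mul_smul, Matrix.one_mul, Matrix.mul_one]
    rw [h1, Matrix.mul_assoc, hA', Matrix.mul_one]; rfl

instance isClosed_center_unitaryGroup :
    IsClosed (Subgroup.center (Matrix.unitaryGroup (Fin k) ℂ) :
      Set (Matrix.unitaryGroup (Fin k) ℂ)) := by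
  rw [← ker_unitaryConj]
  exact isClosed_singleton.preimage continuous_unitaryConj

/-- The faithful representation of the projective unitary group by conjugation. -/
noncomputable def projUnitaryConj (k : ℕ) :
    PU k →* ((Fin k → Fin k → ℂ) →L[ℝ] (Fin k → Fin k → ℂ)) :=
  QuotientGroup.lift _ (unitaryConj k) ker_unitaryConj.ge

lemma continuous_projUnitaryConj : Continuous (projUnitaryConj k) :=
  continuous_unitaryConj.quotient_lift _

lemma injective_projUnitaryConj : Function.Injective (projUnitaryConj k) := by
  rw [injective_iff_map_eq_one]
  intro a
  induction a using QuotientGroup.induction_on with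
  | H A =>
    intro h
    rw [QuotientGroup.eq_one_iff, ← ker_unitaryConj]
    exact h

end Adjoint

/-! ### Maps of pencils and classes in `PU(n-1)` -/

section InducedMaps

variable {n : ℕ} {X Y : Fin (n + 1) → ℂ} {T : Matrix (Fin (n + 1)) (Fin (n - 1)) ℂ}
  {Γ : Subgroup (PGL n)}

lemma mk_eq_mk_of_forall_smul {k : ℕ} {A B : Matrix.unitaryGroup (Fin k) ℂ}
    (h : ∀ v, ∃ c : ℂ, A.1 *ᵥ v = c • B.1 *ᵥ v) : (A : PU k) = B := by
  have hB := B.2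
  rw [Matrix.mem_unitaryGroup_iff', Matrix.star_eq_conjTranspose] at hB
  rw [eq_comm, QuotientGroup.eq]
  obtain ⟨c, hc⟩ := eq_smul_one_of_forall_mulVec (A := (B⁻¹ * A).1) fun v => by
    obtain ⟨c, hc⟩ := h v
    refine ⟨c, ?_⟩
    change (B.1ᴴ * A.1) *ᵥ v = _
    rw [← Matrix.mulVec_mulVec, hc, Matrix.mulVec_smul, Matrix.mulVec_mulVec, hB,
      Matrix.one_mulVec]
  exact mem_center_of_eq_smul_one hc

lemma exists_smul_of_mk_eq_mk {k : ℕ} {A B : Matrix.unitaryGroup (Fin k) ℂ}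
    (h : (A : PU k) = B) : ∃ c : ℂ, ‖c‖ = 1 ∧ B.1 = c • A.1 := by
  rw [QuotientGroup.eq] at h
  obtain ⟨c, hc, h1⟩ := exists_smul_one_of_mem_center h
  refine ⟨c, hc, ?_⟩
  have h2 : B.1 = A.1 * (A⁻¹ * B).1 := by
    rw [← Submonoid.coe_mul, mul_inv_cancel_left]
  rw [h2, h1, Matrix.mul_smul, Matrix.mul_one]

lemma IsInducedBy.congr {p q : CP n} {μ : Pencil p → Pencil q}
    {A B : Matrix.unitaryGroup (Fin (n - 1)) ℂ} (hμ : IsInducedBy T μ A.1)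
    (h : (A : PU (n - 1)) = B) : IsInducedBy T μ B.1 := by
  obtain ⟨c, -, hB⟩ := exists_smul_of_mk_eq_mk h
  intro ℓ v hv
  rw [hB, Matrix.smul_mulVec, Matrix.mulVec_smul]
  exact (μ ℓ).1.smul_mem c (hμ ℓ v hv)

namespace IsFrame

lemma induced_unique (hF : IsFrame X Y T) {μ ν : Pencil (pt Y) → Pencil (pt X)}
    {A : Matrix.unitaryGroup (Fin (n - 1)) ℂ} (hμ : IsInducedBy T μ A.1)
    (hν : IsInducedBy T ν A.1) : μ = ν := by
  funext ℓ
  obtain ⟨v, hv, hvm⟩ := hF.symm.exists_mem_pencil ℓ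
  exact hF.pencil_ext (unitary_mulVec_ne_zero A hv) (hμ ℓ v hvm) (hν ℓ v hvm)

lemma mk_eq_of_induced (hF : IsFrame X Y T) {μ : Pencil (pt Y) → Pencil (pt X)}
    {A B : Matrix.unitaryGroup (Fin (n - 1)) ℂ} (hA : IsInducedBy T μ A.1)
    (hB : IsInducedBy T μ B.1) : (A : PU (n - 1)) = B := by
  refine mk_eq_mk_of_forall_smul fun v => ?_
  by_cases hv : v = 0
  · exact ⟨0, by simp [hv]⟩
  have h := hF.symm.mem_line v hv
  exact (hF.mem_pencil_iff _ (unitary_mulVec_ne_zero B hv) (hB _ _ h)).1 (hA _ _ h)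

/-- The operation `⋆` corresponds to the product of matrices. -/
lemma isInducedBy_starOp (hF : IsFrame X Y T) (hX : pt X ∈ boundary n) (hY : pt Y ∈ boundary n)
    {μ ν : Pencil (pt Y) → Pencil (pt X)} {A B : Matrix (Fin (n - 1)) (Fin (n - 1)) ℂ}
    (hμ : IsInducedBy T μ A) (hν : IsInducedBy T ν B) :
    IsInducedBy T (starOp hY hX μ ν) (A * B) := by
  intro ℓ v hv
  rw [← Matrix.mulVec_mulVec]
  refine hμ _ _ ?_
  -- The image of `T` is orthogonal to `Y`, so `T (B v)` already lies in `ν(ℓ) ∩ y^⊥`: the transfer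
  -- between the pencils is the identity in these coordinates.
  refine Submodule.mem_sup_left ⟨hν ℓ v hv, ?_⟩
  exact (mem_perp_pt hF.symm.ne_zero).2 (hF.orthogonal_right _)

/-- The rank one projection which corresponds to a line in a pencil. -/
noncomputable def pencilProj (hF : IsFrame X Y T) (ℓ : Pencil (pt X)) :
    Fin (n - 1) → Fin (n - 1) → ℂ :=
  projMatrix (hF.exists_mem_pencil ℓ).choose

lemma pencilProj_eq (hF : IsFrame X Y T) {ℓ : Pencil (pt X)} {v : Fin (n - 1) → ℂ} (hv : v ≠ 0)
    (h : T *ᵥ v ∈ ℓ.1) : hF.pencilProj ℓ = projMatrix v := by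
  obtain ⟨hw, hwm⟩ := (hF.exists_mem_pencil ℓ).choose_spec
  obtain ⟨c, hc⟩ := (hF.mem_pencil_iff ℓ hv h).1 hwm
  have hc0 : c ≠ 0 := by rintro rfl; exact hw (by rw [hc, zero_smul])
  rw [pencilProj, hc, projMatrix_smul hc0]

/-- As for projective space: a line of the pencil is determined by a projection of `ℂⁿ⁻¹`. The
adjoint of `T` reads off the coordinates of a marked vector continuously. -/
lemma t2Space_pencil (hF : IsFrame X Y T) : T2Space (Pencil (pt X)) := by
  refine T2Space.of_injective_continuous (f := hF.pencilProj) ?_ ?_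
  · intro ℓ ℓ' h
    obtain ⟨v, hv, hvm⟩ := hF.exists_mem_pencil ℓ
    obtain ⟨w, hw, hwm⟩ := hF.exists_mem_pencil ℓ'
    rw [hF.pencilProj_eq hv hvm, hF.pencilProj_eq hw hwm] at h
    obtain ⟨c, rfl⟩ := exists_smul_of_projMatrix_eq hv h
    refine hF.pencil_ext hv hvm ?_
    rw [Matrix.mulVec_smul]
    exact ℓ'.1.smul_mem c hwm
  · let _ : TopologicalSpace (MarkedPencil (pt X)) :=
      TopologicalSpace.induced (fun q => q.1.1) inferInstance
    refine continuous_coinduced_dom.2 ?_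
    have hc : Continuous fun q : MarkedPencil (pt X) => q.1.1 := continuous_induced_dom
    have hne : ∀ q : MarkedPencil (pt X), (Tᴴ * hermMatrix n) *ᵥ q.1.1 ≠ 0 ∧
        T *ᵥ ((Tᴴ * hermMatrix n) *ᵥ q.1.1) ∈ q.1.2.1 := by
      rintro ⟨⟨z, ℓ⟩, hz, hzX⟩
      dsimp only at hz hzX ⊢
      have hzX' := (mem_perp_pt hF.ne_zero).1 (ℓ.2.2.2 hz)
      obtain ⟨u, hu⟩ := hF.exists_decomposition z
      rw [hzX', zero_smul, add_zero] at hu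
      have hu' : (Tᴴ * hermMatrix n) *ᵥ z = u := by
        rw [hu, Matrix.mulVec_add, Matrix.mulVec_smul, hF.adjoint_left, hF.adjoint_mulVec,
          smul_zero, zero_add]
      rw [hu']
      constructor
      · rintro rfl
        apply hzX
        rw [hu, Matrix.mulVec_zero, add_zero, submodule_pt hF.ne_zero]
        exact Submodule.smul_mem _ _ (Submodule.mem_span_singleton_self X)
      · rw [show T *ᵥ u = z - herm z Y • X from (sub_eq_of_eq_add' hu).symm]
        exact ℓ.1.sub_mem hz (ℓ.1.smul_mem _ (hF.left_mem_pencil ℓ))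
    have heq : hF.pencilProj ∘ (fun q : MarkedPencil (pt X) => q.1.2)
        = fun q => projMatrix ((Tᴴ * hermMatrix n) *ᵥ q.1.1) :=
      funext fun q => hF.pencilProj_eq (hne q).1 (hne q).2
    rw [heq]
    refine continuous_iff_continuousAt.2 fun q => ?_
    have hc' : Continuous fun q : MarkedPencil (pt X) => (Tᴴ * hermMatrix n) *ᵥ q.1.1 := by
      fun_prop
    exact ContinuousAt.comp (g := projMatrix)
      (f := fun q : MarkedPencil (pt X) => (Tᴴ * hermMatrix n) *ᵥ q.1.1)
      (continuousAt_projMatrix (hne q).1) hc'.continuousAt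

lemma continuous_pencil_of_unitary (hF : IsFrame X Y T) {v : Fin (n - 1) → ℂ} (hv : v ≠ 0) :
    Continuous fun A : Matrix.unitaryGroup (Fin (n - 1)) ℂ =>
      hF.line (A.1 *ᵥ v) (unitary_mulVec_ne_zero A hv) := by
  let _ : TopologicalSpace (MarkedPencil (pt X)) :=
    TopologicalSpace.induced (fun q => q.1.1) inferInstance
  let f : Matrix.unitaryGroup (Fin (n - 1)) ℂ → MarkedPencil (pt X) := fun A =>
    ⟨(T *ᵥ (A.1 *ᵥ v), hF.line (A.1 *ᵥ v) (unitary_mulVec_ne_zero A hv)),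
      hF.mem_line _ (unitary_mulVec_ne_zero A hv), by
      rw [submodule_pt hF.ne_zero, Submodule.mem_span_singleton]
      rintro ⟨a, ha⟩
      have h1 := congrArg (fun z => herm z Y) ha
      simp only [herm_smul_left, hF.herm_left_right, hF.orthogonal_right, mul_one] at h1
      rw [h1, zero_smul] at ha
      exact hF.mulVec_ne_zero (unitary_mulVec_ne_zero A hv) ha.symm⟩
  have hf : Continuous f := by
    refine continuous_induced_rng.2 ?_
    change Continuous fun A : Matrix.unitaryGroup (Fin (n - 1)) ℂ => T *ᵥ (A.1 *ᵥ v)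
    fun_prop
  exact (continuous_coinduced_rng (f := fun q : MarkedPencil (pt X) => q.1.2)).comp hf

end IsFrame

end InducedMaps

/-! ### The group of Cartan maps -/

section CartanGroup

variable {n : ℕ} {X Y : Fin (n + 1) → ℂ} {T : Matrix (Fin (n + 1)) (Fin (n - 1)) ℂ}
  {Γ : Subgroup (PGL n)}

namespace IsFrame

lemma t2Space_cartanMaps (hF : IsFrame X Y T) : T2Space (CartanMaps Γ (pt Y) (pt X)) := by
  have := hF.t2Space_pencil
  refine T2Space.of_injective_continuous
    (f := fun (μ : CartanMaps Γ (pt Y) (pt X)) (ℓ : Pencil (pt Y)) => μ.1 ℓ) ?_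
    continuous_induced_dom
  intro μ ν h
  exact Subtype.ext (Equiv.ext fun ℓ => congrFun h ℓ)

/-- The Cartan maps are parametrized by a closed subgroup of the projective unitary group. -/
lemma exists_projUnitary (hF : IsFrame X Y T) (hn : n ≠ 0)
    (hne : (unitaryLimits Γ X Y T).Nonempty) :
    CompactSpace (CartanMaps Γ (pt Y) (pt X)) ∧
    ∃ (φ : CartanMaps Γ (pt Y) (pt X) → PU (n - 1)) (S : Subgroup (PU (n - 1))),
      IsClosedEmbedding φ ∧ range φ = S ∧
      ∀ (μ : CartanMaps Γ (pt Y) (pt X)) (g : Matrix.unitaryGroup (Fin (n - 1)) ℂ),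
        φ μ = QuotientGroup.mk g ↔ IsInducedBy T μ.1 g.1 := by
  obtain ⟨S, hS, hSc⟩ := hF.exists_subgroup_eq_unitaryLimits hne
  have hex : ∀ μ : CartanMaps Γ (pt Y) (pt X), ∃ A ∈ S, IsInducedBy T μ.1 A.1 := fun μ => by
    obtain ⟨A, hA, h⟩ := hF.exists_unitary_of_isCartanMap hn μ.2
    exact ⟨A, by rwa [← SetLike.mem_coe, hS], h⟩
  have hex' : ∀ A : S, ∃ μ : CartanMaps Γ (pt Y) (pt X), IsInducedBy T μ.1 A.1.1 := fun A => by
    obtain ⟨μ, hμ, h⟩ := hF.exists_isCartanMap (Γ := Γ) hn (A := A.1) (by rw [← hS]; exact A.2)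
    exact ⟨⟨μ, hμ⟩, h⟩
  choose a haS ha using hex
  choose m hm using hex'
  let φ : CartanMaps Γ (pt Y) (pt X) → PU (n - 1) := fun μ => QuotientGroup.mk (a μ)
  have hφ : ∀ (μ : CartanMaps Γ (pt Y) (pt X)) (g : Matrix.unitaryGroup (Fin (n - 1)) ℂ),
      φ μ = QuotientGroup.mk g ↔ IsInducedBy T μ.1 g.1 := fun μ g =>
    ⟨fun h => (ha μ).congr h, fun h => hF.mk_eq_of_induced (ha μ) h⟩
  have hinj : ∀ {μ ν : CartanMaps Γ (pt Y) (pt X)} {A : Matrix.unitaryGroup (Fin (n - 1)) ℂ},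
      IsInducedBy T μ.1 A.1 → IsInducedBy T ν.1 A.1 → μ = ν := fun h h' =>
    Subtype.ext (DFunLike.coe_injective (hF.induced_unique h h'))
  have hφm : ∀ A : S, φ (m A) = QuotientGroup.mk A.1 := fun A => (hφ _ _).2 (hm A)
  have hφi : Function.Injective φ := fun μ ν h => hinj ((hφ μ (a ν)).1 h) (ha ν)
  have hms : Function.Surjective m := fun μ => ⟨⟨a μ, haS μ⟩, hinj (hm _) (ha μ)⟩
  have hmc : Continuous m := by
    refine continuous_induced_rng.2 (continuous_pi fun ℓ => ?_)
    obtain ⟨v, hv, hvm⟩ := hF.symm.exists_mem_pencil ℓ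
    have h := (hF.continuous_pencil_of_unitary hv).comp (continuous_subtype_val (p := (· ∈ S)))
    refine h.congr fun A => ?_
    exact hF.pencil_ext (unitary_mulVec_ne_zero A.1 hv) (hF.mem_line _ (unitary_mulVec_ne_zero A.1 hv))
      (hm A ℓ v hvm)
  have : CompactSpace S := isCompact_iff_compactSpace.1 hSc.isCompact
  have := hF.t2Space_cartanMaps (Γ := Γ)
  have hcomp : CompactSpace (CartanMaps Γ (pt Y) (pt X)) := hms.compactSpace hmc
  -- The matrices form a compact group and the Cartan maps a Hausdorff space, so the continuous
  -- surjection `m` is a quotient map. Continuity of `φ` can therefore be checked on matrices, and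
  -- compactness makes `φ` a closed embedding.
  have hq : IsQuotientMap m := hmc.isClosedMap.isQuotientMap hmc hms
  have hφc : Continuous φ := by
    rw [hq.continuous_iff]
    refine (QuotientGroup.continuous_mk.comp (continuous_subtype_val (p := (· ∈ S)))).congr
      fun A => ?_
    exact (hφm A).symm
  refine ⟨hcomp, φ, S.map (QuotientGroup.mk' _), hφc.isClosedEmbedding hφi, ?_, hφ⟩
  ext z
  rw [SetLike.mem_coe, Subgroup.mem_map]
  constructor
  · rintro ⟨μ, rfl⟩
    exact ⟨a μ, haS μ, rfl⟩
  · rintro ⟨A, hA, rfl⟩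
    exact ⟨m ⟨A, hA⟩, hφm ⟨A, hA⟩⟩

theorem exists_group_cartanMaps (hF : IsFrame X Y T) (hX : pt X ∈ boundary n)
    (hY : pt Y ∈ boundary n) (hn : n ≠ 0) (hne : (unitaryLimits Γ X Y T).Nonempty) :
    ∃ _grp : Group (CartanMaps Γ (pt Y) (pt X)),
      (∀ (μ ν : CartanMaps Γ (pt Y) (pt X)) (ℓ : Pencil (pt Y)),
        (μ * ν).1 ℓ = starOp hY hX μ.1 ν.1 ℓ) ∧
      CompactSpace (CartanMaps Γ (pt Y) (pt X)) ∧
      T2Space (CartanMaps Γ (pt Y) (pt X)) ∧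
      (∃ (d : ℕ) (_cs : ChartedSpace (EuclideanSpace ℝ (Fin d)) (CartanMaps Γ (pt Y) (pt X))),
        LieGroup (𝓡 d) ∞ (CartanMaps Γ (pt Y) (pt X))) ∧
      ∃ (T : (Fin (n - 1) → ℂ) →ₗ[ℂ] (Fin (n + 1) → ℂ))
        (φ : CartanMaps Γ (pt Y) (pt X) →* PU (n - 1)),
        LinearMap.range T = perp (pt X) ⊓ perp (pt Y) ∧
        (∀ u v, herm (T u) (T v) = ∑ i, u i * star (v i)) ∧
        IsClosedEmbedding φ ∧
        ∀ (μ : CartanMaps Γ (pt Y) (pt X)) (g : Matrix.unitaryGroup (Fin (n - 1)) ℂ),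
          φ μ = QuotientGroup.mk g →
          ∀ (ℓ : Pencil (pt Y)) (v : Fin (n - 1) → ℂ),
            T v ∈ ℓ.1 → T ((g : Matrix _ _ ℂ) *ᵥ v) ∈ (μ.1 ℓ).1 := by
  obtain ⟨hcomp, φ, S, hφe, hφS, hφ⟩ := hF.exists_projUnitary (Γ := Γ) hn hne
  let e : CartanMaps Γ (pt Y) (pt X) ≃ S :=
    (Equiv.ofInjective φ hφe.injective).trans (Equiv.setCongr hφS)
  have he : ∀ μ, (e μ : PU (n - 1)) = φ μ := fun μ => rfl
  -- The group law is pulled back from `PU(n-1)`; it is `⋆` because products of matrices induce `⋆`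
  -- and a matrix determines the map it induces.
  let grp : Group (CartanMaps Γ (pt Y) (pt X)) := e.group
  let Φ : CartanMaps Γ (pt Y) (pt X) →* PU (n - 1) := S.subtype.comp e.mulEquiv.toMonoidHom
  have hΦ : ⇑Φ = φ := rfl
  have hΦe : IsClosedEmbedding Φ := hφe
  refine ⟨grp, fun μ ν ℓ => ?_, hcomp, hF.t2Space_cartanMaps, ?_, Matrix.mulVecLin T, Φ, ?_, ?_,
    hΦe, fun μ g h => (hφ μ g).1 h⟩
  · obtain ⟨A, hA⟩ := QuotientGroup.mk_surjective (φ μ)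
    obtain ⟨B, hB⟩ := QuotientGroup.mk_surjective (φ ν)
    have h1 : φ (μ * ν) = QuotientGroup.mk (A * B) := by
      rw [← hΦ, map_mul, hΦ, ← hA, ← hB]; rfl
    exact congrFun (hF.induced_unique ((hφ _ _).1 h1)
      (hF.isInducedBy_starOp hX hY ((hφ _ _).1 hA.symm) ((hφ _ _).1 hB.symm))) ℓ
  · exact exists_lieGroup_of_injective ((projUnitaryConj (n - 1)).comp Φ)
      (continuous_projUnitaryConj.comp hΦe.continuous)
      (injective_projUnitaryConj.comp hΦe.injective)
  · ext z
    rw [LinearMap.mem_range, Submodule.mem_inf, mem_perp_pt hF.ne_zero, mem_perp_pt hF.symm.ne_zero]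
    constructor
    · rintro ⟨u, rfl⟩
      exact ⟨hF.orthogonal_left u, hF.orthogonal_right u⟩
    · rintro ⟨h1, h2⟩
      obtain ⟨u, rfl⟩ := hF.exists_eq z h1 h2
      exact ⟨u, rfl⟩
  · intro u v
    rw [Matrix.mulVecLin_apply, Matrix.mulVecLin_apply, hF.isometry, dotProduct]
    exact Finset.sum_congr rfl fun i _ => mul_comm _ _

end IsFrame

end CartanGroup

theorem theoremt (n : ℕ) (Γ : Subgroup (PGL n)) (hΓ : Γ ≤ PU1 n) (hdisc : DiscreteTopology Γ)
    (hne : (limitSet Γ).Infinite) (x y : CP n) (hx : x ∈ limitSet Γ) (hy : y ∈ limitSet Γ)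
    (hxy : x ≠ y) :
    ∃ _grp : Group (CartanMaps Γ y x),
      (∀ (μ ν : CartanMaps Γ y x) (ℓ : Pencil y),
        (μ * ν).1 ℓ = starOp hy.1 hx.1 μ.1 ν.1 ℓ) ∧
      CompactSpace (CartanMaps Γ y x) ∧
      T2Space (CartanMaps Γ y x) ∧
      (∃ (d : ℕ) (_cs : ChartedSpace (EuclideanSpace ℝ (Fin d)) (CartanMaps Γ y x)),
        LieGroup (𝓡 d) ∞ (CartanMaps Γ y x)) ∧
      ∃ (T : (Fin (n - 1) → ℂ) →ₗ[ℂ] (Fin (n + 1) → ℂ)) (φ : CartanMaps Γ y x →* PU (n - 1)),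
        LinearMap.range T = perp x ⊓ perp y ∧
        (∀ u v, herm (T u) (T v) = ∑ i, u i * star (v i)) ∧
        IsClosedEmbedding φ ∧
        ∀ (μ : CartanMaps Γ y x) (g : Matrix.unitaryGroup (Fin (n - 1)) ℂ),
          φ μ = QuotientGroup.mk g →
          ∀ (ℓ : Pencil y) (v : Fin (n - 1) → ℂ),
            T v ∈ ℓ.1 → T ((g : Matrix _ _ ℂ) *ᵥ v) ∈ (μ.1 ℓ).1 := by
  obtain ⟨X, Y, T, hF, rfl, rfl⟩ := exists_isFrame hx.1 hy.1 hxy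
  exact hF.exists_group_cartanMaps hx.1 hy.1 (ne_zero_of_mem_boundary hx.1)
    (hF.unitaryLimits_nonempty hΓ hx hy fun P hP hPP => exists_not_fixed hΓ hdisc hne hP hPP)
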